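/- **Setting.** Let $k$ be a positive integer, let $\mathcal G_k$ be the set of $k$-vertex graphs up to isomorphism and let $\gamma:\mathcal G_k\to\mathbb R$. For a finite graph $G$ with $n\ge k$ vertices put $$\Lambda(G)=\sum_{X\in\binom{V(G)}{k}}\gamma(G[X]),\qquad \lambda(G)=\binom nk^{-1}\Lambda(G),$$ and let $\lambda(n)$ be the maximum of $\lambda(G)$ over all graphs $G$ with $n$ vertices. A graph is *complete partite* if its vertex set has a partition into parts such that two distinct vertices are adjacent exactly when they lie in different parts. **Symmetrisability.** $\lambda$ is *symmetrisable* if for every $\varepsilon>0$ there is $n_0>0$ such that every graph $G=(V,E)$ with $n\ge n_0$ vertices satisfies: * (Sym1) there are graphs $G=G_0,G_1,\dots,G_m$ on $V$ with $G_m$ complete partite such that $\lambda(G_{i-1})\le\lambda(G_i)$ and $|E(G_{i-1})\bigtriangleup E(G_i)|<\varepsilon\binom n2$ for all $1\le i\le m$; * (Sym2) if $z\in V$ and $G-z$ is complete partite with parts $V_1,\dots,V_t$, then there are graphs $G=G_0,G_1,\dots,G_m$ on $V$ such that $G_i-z=G-z$, $\lambda(G_{i-1})\le\lambda(G_i)$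 and $|E(G_{i-1})\bigtriangleup E(G_i)|\le\varepsilon(n-1)$ for all $1\le i\le m$, and, for each $j$, either $N_{G_m}(z)\supseteq V_j$ or $N_{G_m}(z)\cap V_j=\varnothing$. **Perfect stability.** For $n$-vertex graphs $G,H$ let $\hat\delta_1(G,H)=\frac2{n^2}\min_\sigma|E(H)\bigtriangleup E(\sigma(G))|$, the minimum being over all bijections $\sigma:V(G)\to V(H)$. $\lambda$ is *perfectly stable* if there is $C>0$ such that for every graph $G$ with $n\ge C$ vertices there is a complete partite graph $H$ with $n$ vertices and $\hat\delta_1(G,H)\le C(\lambda(n)-\lambda(G))$. **Partite limit space.** Let $\overline{\mathcal P}$ be the set of sequences $\mathbf x=(x_1,x_2,\dots)$ with $x_1\ge x_2\ge\dots\ge0$ and $\sum_{i\ge1}x_i\le1$. Put $x_0=1-\sum_{i\ge1}x_i$ and $\mathrm{supp}^*(\mathbf x)=\{i\ge0:x_i>0\}$. A *realisation* $G_{n,\mathbf x}$ is a graph on $n$ vertices whose vertex set is partitioned into classes $V_0,V_1,V_2,\dots$ (possibly empty), in which $V_i$ is independent for $i\ge1$, $V_0$ is a clique, and all pairs between different classes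 are edges. If $x_0=0$, then $V_0=\varnothing$ and $\bigl||V_i|-x_in\bigr|<1$ for $i\ge1$. If $x_0>0$, then for $i\ge1$ we have $|V_i|=\lfloor x_in\rfloor$ when $x_in\ge2$ and $V_i=\varnothing$ otherwise, and $V_0$ consists of the remaining vertices. Let $\lambda(\mathbf x)=\lim_{n\to\infty}\lambda(G_{n,\mathbf x})$ and $$\mathrm{OPT}(\lambda)=\{\mathbf x\in\overline{\mathcal P}:\lambda(\mathbf x)\ge\lambda(\mathbf y)\text{ for all }\mathbf y\in\overline{\mathcal P}\}.$$ (This limit and the two limits below exist and do not depend on the choices made.) **Strictness.** For $i_1,i_2\in\mathrm{supp}^*(\mathbf x)$ let $$\nabla^{\bullet\bullet}_{i_1i_2}\lambda(\mathbf x)=\lim_{n\to\infty}\binom{n-2}{k-2}^{-1}\bigl(\Lambda(G_{n,\mathbf x})-\Lambda(G_{n,\mathbf x}\oplus v_1v_2)\bigr),$$ where $v_1\in V_{i_1}$ and $v_2\in V_{i_2}$ are distinct and $G\oplus v_1v_2$ is $G$ with the adjacency of the pair $v_1v_2$ flipped. For $b:\{1,2,\dots\}\to\{0,1\}$ and $\alpha\in[0,1]$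 let $G_{n,\mathbf x}+_{b,\alpha}u$ be obtained from $G_{n,\mathbf x}$ by adding a new vertex $u$ that, for each $i\ge1$, is joined to all of $V_i$ if $b_i=1$ and to no vertex of $V_i$ if $b_i=0$, and that is joined to exactly $\lfloor\alpha|V_0|\rfloor$ vertices of $V_0$. Let $e_1$ be the function with $e_1(j)=0$ if and only if $j=1$, and let $$\nabla^{\bullet}_{b,\alpha}\lambda(\mathbf x)=\lim_{n\to\infty}\binom n{k-1}^{-1}\bigl(\Lambda(G_{n,\mathbf x}+_{e_1,1}u)-\Lambda(G_{n,\mathbf x}+_{b,\alpha}u)\bigr).$$ $\lambda$ is *strict* if there is $c>0$ such that every $\mathbf x\in\mathrm{OPT}(\lambda)$ satisfies: * (Str1) $\nabla^{\bullet\bullet}_{i_1i_2}\lambda(\mathbf x)\ge c$ for all $i_1,i_2\in\mathrm{supp}^*(\mathbf x)$; * (Str2) for all $b$ and all $\alpha\in[0,1]$ (with $\alpha=1$ if $x_0=0$), $$\nabla^{\bullet}_{b,\alpha}\lambda(\mathbf x)\ge c\Bigl((1-\alpha)x_0+\inf_{i\in\mathrm{supp}^*(\mathbf x)}w_i\Bigr),\qquad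 w_i=\mathbf 1_{i>0}\,b_ix_i+\sum_{j\in\mathrm{supp}^*(\mathbf x)\setminus\{0,i\}}(1-b_j)x_j .$$ **Theorem.** Suppose that $\lambda$ is symmetrisable, that $\mathrm{OPT}(\lambda)$ is finite and that $\lambda$ is strict. Then $\lambda$ is perfectly stable. -/

import Mathlib

open Filter Topology

noncomputable section

namespace PartiteStability

/-! ## Graph parameters that average over `k`-vertex induced subgraphs -/

/-- Two graphs on `Fin k` are identified when they are isomorphic. -/
def isoSetoid (k : ℕ) : Setoid (SimpleGraph (Fin k)) where
  r F F' := Nonempty (F ≃g F')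
  iseqv :=
    { refl := fun _ => ⟨SimpleGraph.Iso.refl⟩
      symm := fun ⟨e⟩ => ⟨e.symm⟩
      trans := fun ⟨e⟩ ⟨e'⟩ => ⟨e.trans e'⟩ }

/-- The set of `k`-vertex graphs up to isomorphism. -/
def GraphClass (k : ℕ) : Type := Quotient (isoSetoid k)

/-- The isomorphism class of a graph with `k` vertices. The vertices are labelled by an arbitrary
bijection with `Fin k`; the class does not depend on it. -/
def isoClass {V : Type*} [Fintype V] {k : ℕ} (h : Fintype.card V = k) (G : SimpleGraph V) :
    GraphClass k :=
  Quotient.mk (isoSetoid k) (G.comap (Fintype.equivFinOfCardEq h).symm)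

/-- `Λ(G) = ∑_X γ(G[X])`, the sum running over all `k`-element vertex sets `X`. -/
def bigLam {k : ℕ} (γ : GraphClass k → ℝ) {V : Type*} [Fintype V] (G : SimpleGraph V) : ℝ :=
  ∑ X : {X : Finset V // X.card = k},
    γ (isoClass (V := {v : V // v ∈ X.1}) (by rw [Fintype.card_coe]; exact X.2)
      (G.comap Subtype.val))

/-- `λ(G) = Λ(G) / (n choose k)` for a graph `G` with `n` vertices. -/
def lam {k : ℕ} (γ : GraphClass k → ℝ) {V : Type*} [Fintype V] (G : SimpleGraph V) : ℝ :=
  bigLam γ G / ((Fintype.card V).choose k : ℝ)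

/-- `λ(n)`, the maximum of `λ(G)` over the (finitely many) graphs `G` on `n` vertices. -/
def lamMax {k : ℕ} (γ : GraphClass k → ℝ) (n : ℕ) : ℝ :=
  ⨆ G : SimpleGraph (Fin n), lam γ G

/-! ## Symmetrisability -/

/-- `|E(G) ∆ E(H)|` for two graphs on the same vertex set. -/
def editCount {V : Type*} (G H : SimpleGraph V) : ℕ :=
  (symmDiff G.edgeSet H.edgeSet).ncard

/-- A function `λ` is symmetrisable if every large graph can be turned into a complete partite
graph by a sequence of small changes that do not decrease `λ` (first part), and, if deleting `z`
leaves a complete partite graph, then the neighbourhood of `z` can be turned into a union of parts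
by a sequence of small changes at `z` that do not decrease `λ` (second part). -/
def Symmetrisable {k : ℕ} (γ : GraphClass k → ℝ) : Prop :=
  ∀ ε : ℝ, 0 < ε → ∃ n₀ : ℕ, 0 < n₀ ∧ ∀ n : ℕ, n₀ ≤ n → ∀ G : SimpleGraph (Fin n),
    (∃ (m : ℕ) (S : ℕ → SimpleGraph (Fin n)),
      S 0 = G ∧ (S m).IsCompleteMultipartite ∧
      ∀ i < m, lam γ (S i) ≤ lam γ (S (i + 1)) ∧
        (editCount (S i) (S (i + 1)) : ℝ) < ε * (n.choose 2 : ℝ)) ∧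
    (∀ (z : Fin n) (hz : (G.induce {z}ᶜ).IsCompleteMultipartite),
      ∃ (m : ℕ) (S : ℕ → SimpleGraph (Fin n)),
        S 0 = G ∧
        (∀ i ≤ m, (S i).induce {z}ᶜ = G.induce {z}ᶜ) ∧
        (∀ i < m, lam γ (S i) ≤ lam γ (S (i + 1)) ∧
          (editCount (S i) (S (i + 1)) : ℝ) ≤ ε * ((n : ℝ) - 1)) ∧
        ∀ P ∈ hz.setoid.classes,
          (∀ v ∈ P, (S m).Adj z v.1) ∨ (∀ v ∈ P, ¬ (S m).Adj z v.1))

/-! ## Perfect stability -/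

/-- The edit distance: the minimum of `|E(H) ∆ E(σ(G))|` over all bijections `σ`. -/
def editDist {n : ℕ} (G H : SimpleGraph (Fin n)) : ℕ :=
  ⨅ σ : Equiv.Perm (Fin n), editCount H (G.map σ.toEmbedding)

/-- The normalised edit distance. -/
def normEditDist {n : ℕ} (G H : SimpleGraph (Fin n)) : ℝ :=
  2 / (n : ℝ) ^ 2 * (editDist G H : ℝ)

/-- `λ` is perfectly stable. -/
def PerfectlyStable {k : ℕ} (γ : GraphClass k → ℝ) : Prop :=
  ∃ C : ℝ, 0 < C ∧ ∀ n : ℕ, C ≤ (n : ℝ) → ∀ G : SimpleGraph (Fin n),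
    ∃ H : SimpleGraph (Fin n), H.IsCompleteMultipartite ∧
      normEditDist G H ≤ C * (lamMax γ n - lam γ G)

/-! ## The partite limit space -/

/-- The partite limit space: sequences `x₁ ≥ x₂ ≥ … ≥ 0` with `∑_{i ≥ 1} x_i ≤ 1`. The value at
index `0` is the redundant coordinate `x₀ = 1 - ∑_{i ≥ 1} x_i ≥ 0`. -/
@[ext]
structure PartiteLimit where
  /-- the coordinates `x₀, x₁, x₂, …` -/
  x : ℕ → ℝ
  nonneg : ∀ i, 0 ≤ x i
  anti : ∀ i j, 1 ≤ i → i ≤ j → x j ≤ x i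
  hasSum : HasSum x 1

/-- `supp*(x)`: the indices `i ≥ 0` (including `0`) with `x_i > 0`. -/
def PartiteLimit.suppStar (x : PartiteLimit) : Set ℕ := {i | 0 < x.x i}

/-- The `n`-vertex realisations of `x`: the vertex set `Fin n` is divided into the classes
`V_i = {v | part v = i}`, `i ≥ 0`. If `x₀ = 0` then `V₀ = ∅` and `||V_i| - x_i n| < 1` for
`i ≥ 1`. If `x₀ > 0` then, for `i ≥ 1`, `|V_i| = ⌊x_i n⌋` when `x_i n ≥ 2` and `V_i = ∅`
otherwise, and `V₀` consists of the remaining vertices. -/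
structure Realisation (x : PartiteLimit) (n : ℕ) where
  /-- the index of the class of a vertex -/
  part : Fin n → ℕ
  part_ne_zero : x.x 0 = 0 → ∀ v, part v ≠ 0
  card_of_zero : x.x 0 = 0 → ∀ i, 1 ≤ i →
    |((Finset.univ.filter fun v => part v = i).card : ℝ) - x.x i * n| < 1
  card_of_pos : 0 < x.x 0 → ∀ i, 1 ≤ i → 2 ≤ x.x i * n →
    (Finset.univ.filter fun v => part v = i).card = ⌊x.x i * n⌋₊
  card_small : 0 < x.x 0 → ∀ i, 1 ≤ i → x.x i * n < 2 →
    (Finset.univ.filter fun v => part v = i).card = 0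

/-- The graph `G_{n,x}` of a realisation: the classes `V_i`, `i ≥ 1`, are independent, all pairs
between different classes are edges, and `V₀` is a clique. -/
def Realisation.graph {x : PartiteLimit} {n : ℕ} (R : Realisation x n) : SimpleGraph (Fin n) where
  Adj u v := u ≠ v ∧ (R.part u ≠ R.part v ∨ R.part u = 0)
  symm := ⟨fun _ _ h => ⟨h.1.symm, by have := h.2; grind⟩⟩
  loopless := ⟨fun _ h => h.1 rfl⟩

/-- The limit, as `n → ∞`, of a quantity `f n a` attached to the objects `a : ι n`, uniformly in
the choice of these objects. -/
def limOrder {ι : ℕ → Type} (f : ∀ n, ι n → ℝ) : ℝ :=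
  limUnder (comap Sigma.fst atTop) (fun a : Σ n, ι n => f a.1 a.2)

/-- `λ(x) = lim λ(G_{n,x})`. -/
def lamLim {k : ℕ} (γ : GraphClass k → ℝ) (x : PartiteLimit) : ℝ :=
  limOrder (ι := fun n => Realisation x n) fun _ R => lam γ R.graph

/-- The set `OPT(λ)` of maximisers of `λ` on the partite limit space. -/
def OPT {k : ℕ} (γ : GraphClass k → ℝ) : Set PartiteLimit :=
  {x | ∀ y, lamLim γ y ≤ lamLim γ x}

/-! ## Strictness -/

/-- `∇••_{uv} λ(G) = (Λ(G) - Λ(G ⊕ uv)) / (n-2 choose k-2)` for distinct vertices `u, v`, where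
`G ⊕ uv` has edge set `E(G) ∆ {uv}`. -/
def nablaPair {k : ℕ} (γ : GraphClass k → ℝ) {n : ℕ} (G : SimpleGraph (Fin n)) (u v : Fin n) : ℝ :=
  (bigLam γ G - bigLam γ (symmDiff G (SimpleGraph.edge u v))) / ((n - 2).choose (k - 2) : ℝ)

/-- A realisation of `x` with distinct vertices `v₁ ∈ V_{i₁}` and `v₂ ∈ V_{i₂}`. -/
structure PairRealisation (x : PartiteLimit) (i₁ i₂ : ℕ) (n : ℕ) extends Realisation x n where
  v₁ : Fin n
  v₂ : Fin n
  ne : v₁ ≠ v₂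
  part_v₁ : part v₁ = i₁
  part_v₂ : part v₂ = i₂

/-- `∇••_{i₁i₂} λ(x) = lim ∇••_{v₁v₂} λ(G_{n,x})`, with `v₁ ∈ V_{i₁}`, `v₂ ∈ V_{i₂}` distinct. -/
def nablaPairLim {k : ℕ} (γ : GraphClass k → ℝ) (i₁ i₂ : ℕ) (x : PartiteLimit) : ℝ :=
  limOrder (ι := fun n => PairRealisation x i₁ i₂ n) fun _ R =>
    nablaPair γ R.toRealisation.graph R.v₁ R.v₂

/-- The graph obtained from `G` by adding a new vertex (`none`) with neighbourhood `N`. -/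
def addVertex {V : Type*} (G : SimpleGraph V) (N : Set V) : SimpleGraph (Option V) where
  Adj
    | some u, some v => G.Adj u v
    | none, some v => v ∈ N
    | some v, none => v ∈ N
    | none, none => False
  symm := ⟨fun a b h => by cases a <;> cases b <;> first | exact h | exact SimpleGraph.Adj.symm h⟩
  loopless := ⟨fun a h => by cases a with
    | none => exact h
    | some v => exact G.loopless.irrefl v h⟩

/-- The function `e_i` with `e_i(j) = 0` if and only if `j = i`. -/
def eFun (i : ℕ) : ℕ → Bool := fun j => decide (j ≠ i)

/-- The neighbourhoods of the new vertex in `G +_{b,α} u`: for `i ≥ 1` all of `V_i` if `b(i) = 1`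
and nothing in `V_i` otherwise, and `⌊α|V₀|⌋` vertices of `V₀`. The value `b 0` is never used. -/
structure Attachment {x : PartiteLimit} {n : ℕ} (R : Realisation x n) (b : ℕ → Bool) (α : ℝ) where
  /-- the neighbourhood of the new vertex -/
  nbhd : Finset (Fin n)
  mem_iff : ∀ v, R.part v ≠ 0 → (v ∈ nbhd ↔ b (R.part v) = true)
  card_zero : (nbhd.filter fun v => R.part v = 0).card =
    ⌊α * ((Finset.univ.filter fun v => R.part v = 0).card : ℝ)⌋₊

/-- `∇•_{b,α} λ(x) = lim (Λ(G_{n,x} +_{e₁,1} u) - Λ(G_{n,x} +_{b,α} u)) / (n choose k-1)`. -/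
def nablaVertexLim {k : ℕ} (γ : GraphClass k → ℝ) (b : ℕ → Bool) (α : ℝ) (x : PartiteLimit) : ℝ :=
  limOrder (ι := fun n => Σ R : Realisation x n, Attachment R (eFun 1) 1 × Attachment R b α)
    fun n a =>
      (bigLam γ (addVertex a.1.graph a.2.1.nbhd) - bigLam γ (addVertex a.1.graph a.2.2.nbhd)) /
        (n.choose (k - 1) : ℝ)

open Classical in
/-- `w_i = 1_{i > 0} b_i x_i + ∑_{j ∈ supp*(x) \ {0,i}} (1 - b_j) x_j`. -/
def wt (x : PartiteLimit) (b : ℕ → Bool) (i : ℕ) : ℝ :=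
  (if 0 < i ∧ b i = true then x.x i else 0) +
    ∑' j : ℕ, if j ∈ x.suppStar \ {0, i} ∧ b j = false then x.x j else 0

/-- `λ` is strict with some constant `c > 0`. In the second condition the infimum over the
non-empty set `supp*(x)` is a minimum whenever this set is finite; by convention `α = 1` if
`x₀ = 0`. -/
def Strict {k : ℕ} (γ : GraphClass k → ℝ) : Prop :=
  ∃ c : ℝ, 0 < c ∧ ∀ x ∈ OPT γ,
    (∀ i₁ ∈ x.suppStar, ∀ i₂ ∈ x.suppStar, c ≤ nablaPairLim γ i₁ i₂ x) ∧
    (∀ (b : ℕ → Bool) (α : ℝ), 0 ≤ α → α ≤ 1 → (x.x 0 = 0 → α = 1) →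
      c * ((1 - α) * x.x 0 + ⨅ i : x.suppStar, wt x b i) ≤ nablaVertexLim γ b α x)

end PartiteStability

end

/-! The parameter `Λ` is a sum over `k`-sets, so every quantity attached to a partite graph (its
density, the effect of flipping a pair, the effect of attaching a vertex) is, up to a vanishing
error, the expectation of a bounded function of a few independent samples of vertex types. Such
expectations are Lipschitz in the type distribution for the `ℓ¹`-distance. Hence all limits exist
uniformly, and both strictness conditions become inequalities valid in every large graph near the
limit.

Local stability (`local_stability`): let `G` be close in edit distance to a partite graph modelled
on a limit satisfying both strictness conditions. By the first condition, correcting a wrong pair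
between vertices with few errors raises `Λ` by order `n^(k-2)` (`flips_gain`). The few vertices with
many errors are reassigned to a class that suits them, if there is one. A vertex that suits no class
loses order `n^(k-1)` (`misfit_loss`): symmetrise its neighbourhood by (Sym2). If it comes near a
class on the way, stop there and correct the remaining linear number of pairs; if it never does, the
second condition bounds the final neighbourhood. Adding these gains, the edit distance from `G` to a
complete partite graph `H` is at most a constant times `λ(H) - λ(G)`, after normalisation.

From local to global (`perfectlyStable_of_two_le`): by compactness, almost optimal complete partite
graphs are close to `OPT` (`exists_opt_closeTo`). If an almost optimal `G` were far from `OPT`, the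
(Sym1) path from it would have to enter the neighbourhood of `OPT` from outside. At the last graph
before entry, local stability supplies a nearby complete partite graph that is at least as good,
hence very close to `OPT`; so that graph was already inside. Graphs that are not almost optimal
satisfy the inequality for a large constant. For `k = 1` the parameter is constant, so strictness
fails. -/

noncomputable section

namespace PartiteStability

open scoped Classical

/-! ## Sampling from a probability distribution on a type -/

/-- A probability distribution on `T`. -/
structure IsDist {T : Type*} (q : T → ℝ) : Prop where
  nonneg : ∀ t, 0 ≤ q t
  hasSum : HasSum q 1

/-- The `ℓ¹`-distance. -/
def tv {T : Type*} (q q' : T → ℝ) : ℝ := ∑' t, |q t - q' t|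

/-- The expectation of `g` over `m` independent samples from `q`. -/
def samp {T : Type*} (q : T → ℝ) : (m : ℕ) → ((Fin m → T) → ℝ) → ℝ
  | 0, g => g Fin.elim0
  | m + 1, g => ∑' t, q t * samp q m (fun f => g (Fin.cons t f))

theorem IsDist.nonempty {T : Type*} {q : T → ℝ} (hq : IsDist q) : Nonempty T := by
  by_contra hT
  rw [not_nonempty_iff] at hT
  have h := hq.hasSum.unique hasSum_empty
  norm_num at h

theorem tv_nonneg {T : Type*} (q q' : T → ℝ) : 0 ≤ tv q q' := tsum_nonneg fun _ => abs_nonneg _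

theorem IsDist.summable_abs_sub {T : Type*} {q q' : T → ℝ} (hq : IsDist q) (hq' : IsDist q') :
    Summable fun t => |q t - q' t| :=
  (hq.hasSum.summable.sub hq'.hasSum.summable).abs

theorem tv_triangle {T : Type*} {q q' q'' : T → ℝ} (hq : IsDist q) (hq' : IsDist q')
    (hq'' : IsDist q'') : tv q q'' ≤ tv q q' + tv q' q'' := by
  unfold tv
  rw [← (hq.summable_abs_sub hq').tsum_add (hq'.summable_abs_sub hq'')]
  exact (hq.summable_abs_sub hq'').tsum_le_tsum (fun t => abs_sub_le _ _ _)
    ((hq.summable_abs_sub hq').add (hq'.summable_abs_sub hq''))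

theorem samp_abs_le {T : Type*} {q : T → ℝ} (hq : IsDist q) {M : ℝ} :
    ∀ (m : ℕ) (g : (Fin m → T) → ℝ), (∀ f, |g f| ≤ M) → |samp q m g| ≤ M
  | 0, g, hg => hg _
  | m + 1, g, hg => by
    have h1 : HasSum (fun t => q t * M) (1 * M) := hq.hasSum.mul_right M
    rw [one_mul] at h1
    simp only [samp]
    rw [← Real.norm_eq_abs]
    refine tsum_of_norm_bounded h1 fun t => ?_
    rw [norm_mul, Real.norm_of_nonneg (hq.nonneg t)]
    exact mul_le_mul_of_nonneg_left (samp_abs_le hq m _ fun f => hg _) (hq.nonneg t)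

theorem IsDist.summable_mul {T : Type*} {q : T → ℝ} (hq : IsDist q) {M : ℝ} {a : T → ℝ}
    (ha : ∀ t, |a t| ≤ M) : Summable fun t => q t * a t := by
  refine Summable.of_norm_bounded (hq.hasSum.summable.mul_right M) fun t => ?_
  rw [norm_mul, Real.norm_of_nonneg (hq.nonneg t)]
  exact mul_le_mul_of_nonneg_left (ha t) (hq.nonneg t)

/-- Replacing the samples from `q` by samples from `q'` one coordinate at a time costs at most `M *
tv q q'` per coordinate. -/
theorem samp_sub_le {T : Type*} {q q' : T → ℝ} (hq : IsDist q) (hq' : IsDist q') {M : ℝ} :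
    ∀ (m : ℕ) (g : (Fin m → T) → ℝ), (∀ f, |g f| ≤ M) →
      |samp q m g - samp q' m g| ≤ m * M * tv q q'
  | 0, g, hg => by simp [samp]
  | m + 1, g, hg => by
    have ha : ∀ t, |samp q m (fun f => g (Fin.cons t f))| ≤ M :=
      fun t => samp_abs_le hq m _ fun f => hg _
    have ha' : ∀ t, |samp q' m (fun f => g (Fin.cons t f))| ≤ M :=
      fun t => samp_abs_le hq' m _ fun f => hg _
    have hM : 0 ≤ M := (abs_nonneg _).trans (hg fun _ => hq.nonempty.some)
    have key : HasSum (fun t => |q t - q' t| * M + q' t * (m * M * tv q q'))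
        (tv q q' * M + 1 * (m * M * tv q q')) :=
      ((hq.summable_abs_sub hq').hasSum.mul_right M).add (hq'.hasSum.mul_right _)
    have h1 := hq.summable_mul ha
    have h2 := hq'.summable_mul ha'
    simp only [samp]
    rw [← h1.tsum_sub h2]
    have := tsum_of_norm_bounded (f := fun t => q t * samp q m (fun f => g (Fin.cons t f)) -
      q' t * samp q' m (fun f => g (Fin.cons t f))) key fun t => ?_
    · rw [Real.norm_eq_abs] at this
      refine this.trans (le_of_eq ?_)
      push_cast; ring
    · have h3 := samp_sub_le hq hq' m (fun f => g (Fin.cons t f)) (fun f => hg _)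
      have : q t * samp q m (fun f => g (Fin.cons t f)) -
          q' t * samp q' m (fun f => g (Fin.cons t f)) =
          (q t - q' t) * samp q m (fun f => g (Fin.cons t f)) +
          q' t * (samp q m (fun f => g (Fin.cons t f)) - samp q' m (fun f => g (Fin.cons t f))) := by
        ring
      rw [this, Real.norm_eq_abs]
      refine (abs_add_le _ _).trans ?_
      rw [abs_mul, abs_mul, abs_of_nonneg (hq'.nonneg t)]
      exact add_le_add (mul_le_mul_of_nonneg_left (ha t) (abs_nonneg _))
        (mul_le_mul_of_nonneg_left h3 (hq'.nonneg t))

/-- The empirical distribution of the values of `τ`. -/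
def emp {V T : Type*} [Fintype V] (τ : V → T) (t : T) : ℝ :=
  ((Finset.univ.filter fun v => τ v = t).card : ℝ) / Fintype.card V

theorem emp_hasSum_mul {V T : Type*} [Fintype V] (τ : V → T) (h : T → ℝ) :
    HasSum (fun t => emp τ t * h t) ((∑ v, h (τ v)) / Fintype.card V) := by
  have h1 : HasSum (fun t => ∑ v : V, if t = τ v then h (τ v) else 0) (∑ v, h (τ v)) :=
    hasSum_sum fun v _ => hasSum_ite_eq (τ v) (h (τ v))
  suffices h2 : (fun t => emp τ t * h t) =
      fun t => (∑ v : V, if t = τ v then h (τ v) else 0) / (Fintype.card V : ℝ) by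
    rw [h2]; exact h1.div_const _
  funext t
  unfold emp
  rw [div_mul_eq_mul_div, Finset.card_filter]
  push_cast
  rw [Finset.sum_mul]
  congr 1
  refine Finset.sum_congr rfl fun v _ => ?_
  by_cases hv : τ v = t
  · subst hv; simp
  · simp [hv, Ne.symm hv]

theorem emp_isDist {V T : Type*} [Fintype V] [Nonempty V] (τ : V → T) : IsDist (emp τ) := by
  refine ⟨fun t => by unfold emp; positivity, ?_⟩
  have := emp_hasSum_mul τ (fun _ => (1 : ℝ))
  simpa using this

/-- Independent samples from `emp τ` are the types of independent uniform vertices, so the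
expectation is an average over all tuples, repetitions included. -/
theorem samp_emp {V T : Type*} [Fintype V] [Nonempty V] (τ : V → T) :
    ∀ (m : ℕ) (g : (Fin m → T) → ℝ),
      samp (emp τ) m g = (∑ f : Fin m → V, g (τ ∘ f)) / (Fintype.card V : ℝ) ^ m
  | 0, g => by
    simp only [samp, pow_zero, div_one, Fintype.sum_unique]
    congr 1
    exact Subsingleton.elim _ _
  | m + 1, g => by
    simp only [samp]
    rw [(emp_hasSum_mul τ _).tsum_eq]
    simp_rw [samp_emp τ m]
    rw [← (Fin.consEquiv (fun _ : Fin (m + 1) => V)).sum_comp, Fintype.sum_prod_type,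
      ← Finset.sum_div, div_div, pow_succ]
    congr 1
    refine Finset.sum_congr rfl fun v _ => Finset.sum_congr rfl fun f _ => ?_
    congr 1
    funext i
    refine Fin.cases ?_ (fun j => ?_) i <;> simp [Fin.consEquiv]

/-! ## Counting tuples -/

/-- Exchanging `f a` with `v` is an involution on the pairs `(f, v)`. -/
theorem sum_update {V : Type*} [Fintype V] {m : ℕ} (a : Fin m) (φ : (Fin m → V) → ℝ) :
    ∑ f : Fin m → V, ∑ v, φ (Function.update f a v) = Fintype.card V * ∑ f, φ f := by
  have h : ∑ x : (Fin m → V) × V, φ (Function.update x.1 a x.2) = ∑ x : (Fin m → V) × V, φ x.1 := by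
    let e : (Fin m → V) × V ≃ (Fin m → V) × V :=
      Function.Involutive.toPerm (fun x => (Function.update x.1 a x.2, x.1 a))
        (fun x => by simp)
    exact Fintype.sum_equiv e _ _ fun x => rfl
  rw [Fintype.sum_prod_type, Fintype.sum_prod_type] at h
  rw [h]
  simp [Finset.mul_sum]

theorem sum_coord {V : Type*} [Fintype V] {m : ℕ} (a : Fin m) (φ : V → ℝ) :
    (Fintype.card V : ℝ) * ∑ f : Fin m → V, φ (f a) = (∑ v, φ v) * (Fintype.card V : ℝ) ^ m := by
  rw [← sum_update a (fun f => φ (f a))]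
  simp [mul_comm]

theorem sum_coord_pair {V : Type*} [Fintype V] {m : ℕ} {a b : Fin m} (hab : a ≠ b)
    (φ : V → V → ℝ) :
    (Fintype.card V : ℝ) ^ 2 * ∑ f : Fin m → V, φ (f a) (f b) =
      (∑ u, ∑ v, φ u v) * (Fintype.card V : ℝ) ^ m := by
  have h1 := sum_update a (fun f : Fin m → V => φ (f a) (f b))
  simp only [Function.update_self, Function.update_of_ne hab.symm] at h1
  rw [pow_two, mul_assoc, ← h1, sum_coord b (fun w => ∑ v, φ v w), Finset.sum_comm]

/-- Union bound over coordinates and pairs of coordinates. It serves twice: with `D` equality it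
discards non-injective tuples, and with `D` the disagreement of two graphs it bounds the tuples on
which they differ. -/
theorem card_tuples_le {V : Type*} [Fintype V] [Nonempty V] {m r : ℕ} (D : V → V → Prop)
    (s : Fin r → V) {d e : ℝ}
    (hd : ∀ i, ((Finset.univ.filter fun u => D (s i) u).card : ℝ) ≤ d * Fintype.card V)
    (he : ∑ u, ((Finset.univ.filter fun v => D u v).card : ℝ) ≤ e * (Fintype.card V : ℝ) ^ 2) :
    ((Finset.univ.filter fun f : Fin m → V =>
      ∃ a, (∃ i, D (s i) (f a)) ∨ ∃ b, b ≠ a ∧ D (f a) (f b)).card : ℝ) ≤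
      (r * m * d + m ^ 2 * e) * (Fintype.card V : ℝ) ^ m := by
  set n : ℝ := (Fintype.card V : ℝ) with hn
  have hn0 : 0 < n := by rw [hn]; exact_mod_cast Fintype.card_pos
  have e0 : 0 ≤ e := by
    by_contra h
    have h1 : e * n ^ 2 < 0 := mul_neg_of_neg_of_pos (not_le.1 h) (by positivity)
    have h2 : 0 ≤ ∑ u, ((Finset.univ.filter fun v => D u v).card : ℝ) :=
      Finset.sum_nonneg fun _ _ => by positivity
    linarith
  have h1 : ∀ (i : Fin r) (a : Fin m), ∑ f : Fin m → V, (if D (s i) (f a) then (1 : ℝ) else 0) ≤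
      d * n ^ m := by
    intro i a
    have h := sum_coord a (fun v => if D (s i) v then (1 : ℝ) else 0)
    have h2 := hd i
    rw [Finset.card_filter] at h2
    push_cast at h2
    rw [← hn] at h
    have : n * ∑ f : Fin m → V, (if D (s i) (f a) then (1 : ℝ) else 0) ≤ n * (d * n ^ m) := by
      rw [h]
      calc _ ≤ d * n * n ^ m := mul_le_mul_of_nonneg_right h2 (by positivity)
        _ = _ := by ring
    exact le_of_mul_le_mul_left this hn0
  have h2 : ∀ (a b : Fin m), ∑ f : Fin m → V, (if b ≠ a ∧ D (f a) (f b) then (1 : ℝ) else 0) ≤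
      e * n ^ m := by
    intro a b
    by_cases hab : b = a
    · simp [hab]; positivity
    · have h := sum_coord_pair (fun h => hab h.symm : a ≠ b) (fun u v => if D u v then (1 : ℝ) else 0)
      have h2 := he
      simp only [Finset.card_filter] at h2
      push_cast at h2
      rw [← hn] at h
      have : n ^ 2 * ∑ f : Fin m → V, (if b ≠ a ∧ D (f a) (f b) then (1 : ℝ) else 0) ≤
          n ^ 2 * (e * n ^ m) := by
        simp only [ne_eq, hab, not_false_eq_true, true_and]
        rw [h]
        calc _ ≤ e * n ^ 2 * n ^ m := mul_le_mul_of_nonneg_right h2 (by positivity)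
          _ = _ := by ring
      exact le_of_mul_le_mul_left this (by positivity)
  rw [Finset.card_filter]
  push_cast
  calc _ ≤ ∑ f : Fin m → V, ((∑ i : Fin r, ∑ a : Fin m, if D (s i) (f a) then (1 : ℝ) else 0) +
        ∑ a : Fin m, ∑ b : Fin m, if b ≠ a ∧ D (f a) (f b) then (1 : ℝ) else 0) := by
        refine Finset.sum_le_sum fun f _ => ?_
        have p1 : ∀ i a, (0 : ℝ) ≤ if D (s i) (f a) then (1 : ℝ) else 0 := fun i a => by
          split_ifs <;> norm_num
        have p2 : ∀ a b, (0 : ℝ) ≤ if b ≠ a ∧ D (f a) (f b) then (1 : ℝ) else 0 := fun i a => by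
          split_ifs <;> norm_num
        have q1 : 0 ≤ ∑ i : Fin r, ∑ a : Fin m, if D (s i) (f a) then (1 : ℝ) else 0 :=
          Finset.sum_nonneg fun i _ => Finset.sum_nonneg fun a _ => p1 i a
        have q2 : 0 ≤ ∑ a : Fin m, ∑ b : Fin m, if b ≠ a ∧ D (f a) (f b) then (1 : ℝ) else 0 :=
          Finset.sum_nonneg fun i _ => Finset.sum_nonneg fun a _ => p2 i a
        split_ifs with h
        · obtain ⟨a, ⟨i, h⟩ | ⟨b, hba, h⟩⟩ := h
          · have : (1 : ℝ) ≤ ∑ i : Fin r, ∑ a : Fin m, if D (s i) (f a) then (1 : ℝ) else 0 := by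
              refine le_trans ?_ (Finset.single_le_sum (f := fun i => ∑ a : Fin m,
                if D (s i) (f a) then (1 : ℝ) else 0)
                (fun i _ => Finset.sum_nonneg fun a _ => p1 i a) (Finset.mem_univ i))
              refine le_trans ?_ (Finset.single_le_sum (f := fun a =>
                if D (s i) (f a) then (1 : ℝ) else 0) (fun a _ => p1 i a) (Finset.mem_univ a))
              simp [h]
            linarith
          · have : (1 : ℝ) ≤ ∑ a : Fin m, ∑ b : Fin m,
                if b ≠ a ∧ D (f a) (f b) then (1 : ℝ) else 0 := by
              refine le_trans ?_ (Finset.single_le_sum (f := fun a => ∑ b : Fin m,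
                if b ≠ a ∧ D (f a) (f b) then (1 : ℝ) else 0)
                (fun i _ => Finset.sum_nonneg fun a _ => p2 i a) (Finset.mem_univ a))
              refine le_trans ?_ (Finset.single_le_sum (f := fun b =>
                if b ≠ a ∧ D (f a) (f b) then (1 : ℝ) else 0) (fun b _ => p2 a b) (Finset.mem_univ b))
              simp [h, hba]
            linarith
        · linarith
    _ = (∑ i : Fin r, ∑ a : Fin m, ∑ f : Fin m → V, if D (s i) (f a) then (1 : ℝ) else 0) +
        ∑ a : Fin m, ∑ b : Fin m, ∑ f : Fin m → V,
          if b ≠ a ∧ D (f a) (f b) then (1 : ℝ) else 0 := by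
        rw [Finset.sum_add_distrib, Finset.sum_comm]
        congr 1
        · exact Finset.sum_congr rfl fun i _ => Finset.sum_comm
        · rw [Finset.sum_comm]
          exact Finset.sum_congr rfl fun i _ => Finset.sum_comm
    _ ≤ (∑ i : Fin r, ∑ a : Fin m, d * n ^ m) + ∑ a : Fin m, ∑ b : Fin m, e * n ^ m :=
        add_le_add (Finset.sum_le_sum fun i _ => Finset.sum_le_sum fun a _ => h1 i a)
          (Finset.sum_le_sum fun i _ => Finset.sum_le_sum fun a _ => h2 i a)
    _ = _ := by simp; ring

/-- Tuples extending `s` to an injective tuple. -/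
def injExt {V : Type*} [Fintype V] {r : ℕ} (m : ℕ) (s : Fin r → V) : Finset (Fin m → V) :=
  Finset.univ.filter fun f => Function.Injective (Fin.append f s)

theorem append_cases {V : Type*} {m r : ℕ} {f : Fin m → V} {s : Fin r → V} (P : V → V → Prop)
    (hsymm : ∀ u v, P u v → P v u) (hs : ∀ i j, i ≠ j → ¬ P (s i) (s j))
    (hf : ¬ ∃ a, (∃ i, P (s i) (f a)) ∨ ∃ b, b ≠ a ∧ P (f a) (f b)) (a b : Fin (m + r))
    (hab : a ≠ b) : ¬ P (Fin.append f s a) (Fin.append f s b) := by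
  push Not at hf
  induction a using Fin.addCases with
  | left a =>
    induction b using Fin.addCases with
    | left b =>
      simp only [Fin.append_left]
      exact (hf a).2 b (fun h => hab (by rw [h]))
    | right j =>
      simp only [Fin.append_left, Fin.append_right]
      exact fun h => (hf a).1 j (hsymm _ _ h)
  | right i =>
    induction b using Fin.addCases with
    | left b =>
      simp only [Fin.append_left, Fin.append_right]
      exact (hf b).1 i
    | right j =>
      simp only [Fin.append_right]
      exact hs i j (fun h => hab (by rw [h]))

theorem card_compl_injExt_le {V : Type*} [Fintype V] [Nonempty V] {r : ℕ} (m : ℕ) (s : Fin r → V)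
    (hs : Function.Injective s) :
    (((injExt m s)ᶜ.card : ℕ) : ℝ) ≤
      ((r * m + m ^ 2) / Fintype.card V) * (Fintype.card V : ℝ) ^ m := by
  have hn0 : (0 : ℝ) < Fintype.card V := by exact_mod_cast Fintype.card_pos
  have h := card_tuples_le (m := m) (fun u v : V => u = v) s (d := 1 / Fintype.card V)
    (e := 1 / Fintype.card V) ?_ ?_
  · refine le_trans ?_ (h.trans (le_of_eq (by ring)))
    norm_cast
    refine Finset.card_le_card fun f hf => ?_
    simp only [injExt, Finset.mem_compl, Finset.mem_filter, Finset.mem_univ, true_and] at hf ⊢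
    by_contra hc
    refine hf fun a b hab => ?_
    by_contra hne
    exact append_cases (fun u v => u = v) (fun _ _ h => h.symm) (fun i j hij h => hij (hs h)) hc
      a b hne hab
  · intro i
    rw [div_mul_cancel₀ _ hn0.ne']
    simp [Finset.filter_eq]
  · simp only [Finset.filter_eq, Finset.mem_univ, if_true, Finset.card_singleton]
    simp
    field_simp
    exact le_rfl

/-- The bridge between counting and sampling. Two errors occur: the tuples that are not injective
extensions of `s`, and the passage from the empirical distribution to `q`. -/
theorem sum_injExt_approx {V T : Type*} [Fintype V] [Nonempty V] {m r : ℕ} (s : Fin r → V)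
    (hs : Function.Injective s) (τ : V → T) {q : T → ℝ} (hq : IsDist q) {g : (Fin m → T) → ℝ}
    {M : ℝ} (hg : ∀ t, |g t| ≤ M) (A : (Fin m → V) → ℝ)
    (hA : ∀ f, Function.Injective (Fin.append f s) → A f = g (τ ∘ f)) :
    |(∑ f ∈ injExt m s, A f) / (Fintype.card V : ℝ) ^ m - samp q m g| ≤
      M * ((r * m + m ^ 2) / Fintype.card V + m * tv (emp τ) q) := by
  have hn0 : (0 : ℝ) < Fintype.card V := by exact_mod_cast Fintype.card_pos
  have hM : 0 ≤ M := (abs_nonneg _).trans (hg (τ ∘ fun _ => Classical.arbitrary V))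
  have h1 : ∑ f ∈ injExt m s, A f = ∑ f ∈ injExt m s, g (τ ∘ f) :=
    Finset.sum_congr rfl fun f hf => hA f (by simpa [injExt] using hf)
  have h2 := Finset.sum_add_sum_compl (injExt m s) (fun f => g (τ ∘ f))
  have h3 : |∑ f ∈ (injExt m s)ᶜ, g (τ ∘ f)| ≤
      M * (((r * m + m ^ 2) / Fintype.card V) * (Fintype.card V : ℝ) ^ m) := by
    refine (Finset.abs_sum_le_sum_abs _ _).trans ?_
    refine (Finset.sum_le_card_nsmul _ _ M fun f _ => hg _).trans ?_
    rw [nsmul_eq_mul, mul_comm]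
    exact mul_le_mul_of_nonneg_left (card_compl_injExt_le m s hs) hM
  have h4 := samp_sub_le (emp_isDist τ) hq m g hg
  rw [samp_emp τ m g, ← h2] at h4
  rw [h1]
  have h5 : |(∑ f ∈ (injExt m s)ᶜ, g (τ ∘ f)) / (Fintype.card V : ℝ) ^ m| ≤
      M * ((r * m + m ^ 2) / Fintype.card V) := by
    rw [abs_div, abs_of_pos (pow_pos hn0 m), div_le_iff₀ (pow_pos hn0 m)]
    linarith
  rw [add_div] at h4
  rw [abs_le] at h4 h5 ⊢
  constructor <;> nlinarith [h4.1, h4.2, h5.1, h5.2]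

/-! ## `Λ` as a sum over tuples -/

/-- The value of `γ` on the graph induced by the tuple `F`. -/
def val {k : ℕ} (γ : GraphClass k → ℝ) {V : Type*} (G : SimpleGraph V) (F : Fin k → V) : ℝ :=
  γ (Quotient.mk (isoSetoid k) (G.comap F))

theorem exists_bound {k : ℕ} (γ : GraphClass k → ℝ) : ∃ M : ℝ, 0 < M ∧ ∀ c, |γ c| ≤ M := by
  have : Finite (GraphClass k) := by unfold GraphClass; infer_instance
  obtain ⟨M, hM⟩ := (Set.finite_range fun c => |γ c|).bddAbove
  exact ⟨max M 1, by positivity, fun c => (hM ⟨c, rfl⟩).trans (le_max_left _ _)⟩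

/-- The summand of `Λ`, extended by zero to all vertex sets. -/
def classVal {k : ℕ} (γ : GraphClass k → ℝ) {V : Type*} (G : SimpleGraph V)
    (X : Finset V) : ℝ :=
  if h : X.card = k then γ (isoClass (V := {v : V // v ∈ X}) (by rw [Fintype.card_coe]; exact h)
    (G.comap Subtype.val)) else 0

theorem bigLam_eq_sum {k : ℕ} (γ : GraphClass k → ℝ) {V : Type*} [Fintype V]
    (G : SimpleGraph V) :
    bigLam γ G = ∑ X ∈ Finset.powersetCard k Finset.univ, classVal γ G X := by
  rw [Finset.sum_subtype (p := fun X : Finset V => X.card = k) _ (fun X => by simp)]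
  unfold bigLam
  refine Finset.sum_congr rfl fun X _ => ?_
  simp [classVal, X.2]

theorem classVal_image {k : ℕ} (γ : GraphClass k → ℝ) {V : Type*} (G : SimpleGraph V)
    (F : Fin k → V) (hF : Function.Injective F) :
    classVal γ G (Finset.univ.image F) = val γ G F := by
  have hX : (Finset.univ.image F).card = k := by
    rw [Finset.card_image_of_injective _ hF]; simp
  rw [classVal, dif_pos hX, val]
  congr 1
  refine Quotient.sound ⟨?_⟩
  let e : {v : V // v ∈ Finset.univ.image F} ≃ Fin k :=
    Fintype.equivFinOfCardEq (by rw [Fintype.card_coe]; exact hX)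
  let f : Fin k ≃ {v : V // v ∈ Finset.univ.image F} :=
    Equiv.ofBijective (fun i => ⟨F i, by simp⟩) ⟨fun i j h => hF (by simpa using h), fun v => by
      obtain ⟨v, hv⟩ := v
      simp only [Finset.mem_image, Finset.mem_univ, true_and] at hv
      obtain ⟨i, rfl⟩ := hv
      exact ⟨i, rfl⟩⟩
  refine ⟨(f.trans e).symm, fun {a b} => ?_⟩
  have h : ∀ a, F ((f.trans e).symm a) = (e.symm a).1 := by
    intro a
    have : f (f.symm (e.symm a)) = e.symm a := f.apply_symm_apply _
    exact congrArg Subtype.val this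
  simp only [SimpleGraph.comap_adj, h]
  rfl

theorem classVal_congr {k : ℕ} (γ : GraphClass k → ℝ) {V : Type*} {G G' : SimpleGraph V}
    {X : Finset V} (h : ∀ u ∈ X, ∀ v ∈ X, (G.Adj u v ↔ G'.Adj u v)) :
    classVal γ G X = classVal γ G' X := by
  have : (G.comap Subtype.val : SimpleGraph {v : V // v ∈ X}) = G'.comap Subtype.val := by
    ext u v
    exact h _ u.2 _ v.2
  simp only [classVal, this]

theorem card_injective_into {V : Type*} [Fintype V] {m : ℕ} (A : Finset V) (hA : A.card = m) :
    (Finset.univ.filter fun f : Fin m → V => Function.Injective f ∧ ∀ i, f i ∈ A).card =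
      m.factorial := by
  have e : {f : Fin m → V // Function.Injective f ∧ ∀ i, f i ∈ A} ≃ (Fin m ↪ A) :=
    { toFun := fun f => ⟨fun i => ⟨f.1 i, f.2.2 i⟩, fun i j h => f.2.1 (by simpa using h)⟩
      invFun := fun f => ⟨fun i => f i, fun i j h => f.injective (Subtype.ext h), fun i => (f i).2⟩
      left_inv := fun f => rfl
      right_inv := fun f => rfl }
  rw [← Fintype.card_subtype, Fintype.card_congr e, Fintype.card_embedding_eq]
  simp [hA, Nat.descFactorial_self]

theorem append_injective_iff {V : Type*} {m r : ℕ} {f : Fin m → V} {s : Fin r → V}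
    (hs : Function.Injective s) :
    Function.Injective (Fin.append f s) ↔ Function.Injective f ∧ ∀ i j, f i ≠ s j := by
  constructor
  · intro h
    refine ⟨fun i j hij => ?_, fun i j hij => ?_⟩
    · have := @h (Fin.castAdd r i) (Fin.castAdd r j) (by simpa using hij)
      exact Fin.castAdd_injective m r this
    · have := @h (Fin.castAdd r i) (Fin.natAdd m j) (by simpa using hij)
      rw [Fin.ext_iff] at this
      simp at this
      omega
  · rintro ⟨h1, h2⟩ a b hab
    by_contra hne
    refine append_cases (fun u v => u = v) (fun _ _ h => h.symm) (fun i j hij h => hij (hs h)) ?_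
      a b hne hab
    rintro ⟨a, ⟨i, h⟩ | ⟨b, hb, h⟩⟩
    · exact h2 a i h.symm
    · exact hb (h1 h).symm

/-- A `k`-set containing the `r` vertices of `s` arises from exactly `m!` tuples, namely the
orderings of its other `m` elements. -/
theorem sum_injExt_val {m r : ℕ} (γ : GraphClass (m + r) → ℝ) {V : Type*} [Fintype V]
    (s : Fin r → V) (hs : Function.Injective s) (G : SimpleGraph V) :
    ∑ f ∈ injExt m s, val γ G (Fin.append f s) = m.factorial *
      ∑ X ∈ (Finset.powersetCard (m + r) Finset.univ).filter (fun X => ∀ i, s i ∈ X),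
        classVal γ G X := by
  rw [← Finset.sum_fiberwise_of_maps_to (t := (Finset.powersetCard (m + r) Finset.univ).filter
    (fun X : Finset V => ∀ i, s i ∈ X))
    (g := fun f : Fin m → V => Finset.univ.image (Fin.append f s)), Finset.mul_sum]
  · refine Finset.sum_congr rfl fun X hX => ?_
    simp only [Finset.mem_filter, Finset.mem_powersetCard, Finset.subset_univ, true_and] at hX
    obtain ⟨hX, hsX⟩ := hX
    have h1 : ((injExt m s).filter fun f => Finset.univ.image (Fin.append f s) = X) =
        Finset.univ.filter fun f : Fin m → V =>
          Function.Injective f ∧ ∀ i, f i ∈ X \ Finset.univ.image s := by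
      ext f
      simp only [injExt, Finset.mem_filter, Finset.mem_univ, true_and, append_injective_iff hs,
        Finset.mem_sdiff, Finset.mem_image, not_exists]
      constructor
      · rintro ⟨⟨hf, hfs⟩, rfl⟩
        refine ⟨hf, fun i => ⟨?_, fun j hj => hfs i j hj.symm⟩⟩
        exact Finset.mem_image.2 ⟨Fin.castAdd r i, by simp⟩
      · rintro ⟨hf, h⟩
        have hfs : ∀ i j, f i ≠ s j := fun i j hij => (h i).2 j hij.symm
        refine ⟨⟨hf, hfs⟩, ?_⟩
        refine Finset.eq_of_subset_of_card_le ?_ ?_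
        · intro v hv
          simp only [Finset.mem_image, Finset.mem_univ, true_and] at hv
          obtain ⟨a, rfl⟩ := hv
          induction a using Fin.addCases with
          | left a => simpa using (h a).1
          | right a => simpa using hsX a
        · rw [Finset.card_image_of_injective _ ((append_injective_iff hs).2 ⟨hf, hfs⟩), hX]
          simp
    have h2 : ∀ f ∈ (injExt m s).filter (fun f => Finset.univ.image (Fin.append f s) = X),
        val γ G (Fin.append f s) = classVal γ G X := by
      intro f hf
      simp only [injExt, Finset.mem_filter, Finset.mem_univ, true_and] at hf
      rw [← hf.2, classVal_image _ _ _ hf.1]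
    rw [Finset.sum_congr rfl h2, Finset.sum_const, h1, card_injective_into, nsmul_eq_mul]
    rw [Finset.card_sdiff_of_subset, hX, Finset.card_image_of_injective _ hs]
    · simp
    · intro v hv
      simp only [Finset.mem_image, Finset.mem_univ, true_and] at hv
      obtain ⟨a, rfl⟩ := hv
      exact hsX a
  · intro f hf
    simp only [injExt, Finset.mem_filter, Finset.mem_univ, true_and] at hf
    simp only [Finset.mem_filter, Finset.mem_powersetCard, Finset.subset_univ, true_and]
    refine ⟨?_, fun i => Finset.mem_image.2 ⟨Fin.natAdd m i, by simp⟩⟩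
    rw [Finset.card_image_of_injective _ hf]
    simp

/-- A `k`-set missing some `s i` induces the same graph in `G` and `G'`, so its terms cancel. The
cases used are `r = 2` (one flipped pair), `r = 1` (changes at one vertex) and `r = 0` (arbitrary
changes). -/
theorem bigLam_sub {m r : ℕ} (γ : GraphClass (m + r) → ℝ) {V : Type*} [Fintype V]
    (s : Fin r → V) (hs : Function.Injective s) {G G' : SimpleGraph V}
    (h : ∀ u v, ¬(G.Adj u v ↔ G'.Adj u v) → ∀ i, s i = u ∨ s i = v) :
    ∑ f ∈ injExt m s, val γ G (Fin.append f s) - ∑ f ∈ injExt m s, val γ G' (Fin.append f s) =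
      m.factorial * (bigLam γ G - bigLam γ G') := by
  rw [sum_injExt_val γ s hs, sum_injExt_val γ s hs, ← mul_sub, bigLam_eq_sum, bigLam_eq_sum,
    ← Finset.sum_filter_add_sum_filter_not (Finset.powersetCard (m + r) Finset.univ)
      (fun X : Finset V => ∀ i, s i ∈ X) (classVal γ G),
    ← Finset.sum_filter_add_sum_filter_not (Finset.powersetCard (m + r) Finset.univ)
      (fun X : Finset V => ∀ i, s i ∈ X) (classVal γ G')]
  have : ∑ X ∈ (Finset.powersetCard (m + r) Finset.univ).filter (fun X : Finset V => ¬ ∀ i, s i ∈ X),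
      classVal γ G X = ∑ X ∈ (Finset.powersetCard (m + r) Finset.univ).filter
        (fun X : Finset V => ¬ ∀ i, s i ∈ X), classVal γ G' X := by
    refine Finset.sum_congr rfl fun X hX => classVal_congr γ fun u hu v hv => ?_
    simp only [Finset.mem_filter, not_forall] at hX
    obtain ⟨-, i, hi⟩ := hX
    by_contra hc
    rcases h u v hc i with h | h
    · exact hi (h ▸ hu)
    · exact hi (h ▸ hv)
  rw [this]
  ring

/-! ## The set of pairs on which two graphs differ -/

/-- The number of vertices `u` such that the graphs differ at the pair `vu`. -/
def difDeg {V : Type*} [Fintype V] (G H : SimpleGraph V) (v : V) : ℕ :=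
  (Finset.univ.filter fun u => ¬(G.Adj v u ↔ H.Adj v u)).card

theorem symmDiff_adj {V : Type*} (G H : SimpleGraph V) (u v : V) :
    (symmDiff G H).Adj u v ↔ ¬(G.Adj u v ↔ H.Adj u v) := by
  simp only [symmDiff, SimpleGraph.sup_adj, SimpleGraph.sdiff_adj]
  tauto

theorem mem_symmDiff_edgeSet {V : Type*} (G H : SimpleGraph V) :
    symmDiff G.edgeSet H.edgeSet = (symmDiff G H).edgeSet := by
  simp [symmDiff]

theorem sum_difDeg {V : Type*} [Fintype V] (G H : SimpleGraph V) :
    ∑ v, difDeg G H v = 2 * editCount G H := by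
  rw [editCount, mem_symmDiff_edgeSet, ← SimpleGraph.coe_edgeFinset, Set.ncard_coe_finset,
    ← SimpleGraph.sum_degrees_eq_twice_card_edges]
  refine Finset.sum_congr rfl fun v _ => ?_
  rw [difDeg, ← SimpleGraph.card_neighborFinset_eq_degree]
  congr 1
  ext u
  simp only [Finset.mem_filter, Finset.mem_univ, true_and, SimpleGraph.mem_neighborFinset,
    symmDiff_adj]

/-- A term can change only if some disagreement has an end among the sampled vertices. Disagreements
inside `s` would affect every term; `hs` excludes them. -/
theorem abs_sum_val_sub_le {m r : ℕ} {γ : GraphClass (m + r) → ℝ} {M : ℝ} (hM : ∀ c, |γ c| ≤ M)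
    {V : Type*} [Fintype V] [Nonempty V] (s : Fin r → V) {G H : SimpleGraph V} {d e : ℝ}
    (hs : ∀ i j, G.Adj (s i) (s j) ↔ H.Adj (s i) (s j))
    (hd : ∀ i, (difDeg G H (s i) : ℝ) ≤ d * Fintype.card V)
    (he : (2 * editCount G H : ℝ) ≤ e * (Fintype.card V : ℝ) ^ 2) :
    |∑ f ∈ injExt m s, val γ G (Fin.append f s) - ∑ f ∈ injExt m s, val γ H (Fin.append f s)| ≤
      2 * M * ((r * m * d + m ^ 2 * e) * (Fintype.card V : ℝ) ^ m) := by
  have hM0 : 0 ≤ M := (abs_nonneg _).trans (hM (Quotient.mk _ ⊥))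
  obtain ⟨D, hD⟩ : ∃ D : V → V → Prop, ∀ u v, D u v ↔ ¬(G.Adj u v ↔ H.Adj u v) :=
    ⟨_, fun _ _ => Iff.rfl⟩
  have hdeg : ∀ v, difDeg G H v = (Finset.univ.filter fun u => D v u).card := by
    intro v
    unfold difDeg
    congr 1; ext u; simp only [Finset.mem_filter, Finset.mem_univ, true_and, hD]
  have h1 := card_tuples_le (m := m) D s (d := d) (e := e) (fun i => by rw [← hdeg]; exact hd i) (by
      refine le_trans (le_of_eq ?_) he
      have h := sum_difDeg G H
      simp only [hdeg] at h
      exact_mod_cast h)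
  obtain ⟨B, hB⟩ : ∃ B : Finset (Fin m → V), B = Finset.univ.filter fun f : Fin m → V =>
      ∃ a, (∃ i, D (s i) (f a)) ∨ ∃ b, b ≠ a ∧ D (f a) (f b) := ⟨_, rfl⟩
  rw [← hB] at h1
  rw [← Finset.sum_sub_distrib]
  have h2 : ∀ f ∈ injExt m s, |val γ G (Fin.append f s) - val γ H (Fin.append f s)| ≤
      if f ∈ B then 2 * M else 0 := by
    intro f _
    split_ifs with hf
    · refine (abs_sub _ _).trans ?_
      have := hM (Quotient.mk (isoSetoid (m + r)) (G.comap (Fin.append f s)))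
      have := hM (Quotient.mk (isoSetoid (m + r)) (H.comap (Fin.append f s)))
      simp only [val]
      linarith
    · have : G.comap (Fin.append f s) = H.comap (Fin.append f s) := by
        ext a b
        by_cases hab : a = b
        · subst hab; simp
        · simp only [hB, Finset.mem_filter, Finset.mem_univ, true_and] at hf
          have := append_cases D (fun u v h => by
              rw [hD] at h ⊢; rwa [G.adj_comm v u, H.adj_comm v u])
            (fun i j _ h => (hD _ _).1 h (hs i j)) hf a b hab
          rw [hD, not_not] at this
          exact this
      simp [val, this]
  calc _ ≤ ∑ f ∈ injExt m s, |val γ G (Fin.append f s) - val γ H (Fin.append f s)| :=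
        Finset.abs_sum_le_sum_abs _ _
    _ ≤ ∑ f ∈ injExt m s, if f ∈ B then 2 * M else 0 := Finset.sum_le_sum h2
    _ ≤ ∑ f : Fin m → V, if f ∈ B then 2 * M else 0 :=
        Finset.sum_le_sum_of_subset_of_nonneg (Finset.subset_univ _) fun _ _ _ => by
          split_ifs <;> positivity
    _ = 2 * M * B.card := by
        rw [← Finset.sum_filter]; simp [mul_comm]
    _ ≤ _ := mul_le_mul_of_nonneg_left h1 (by positivity)

theorem editCount_comm {V : Type*} (G H : SimpleGraph V) : editCount G H = editCount H G := by
  rw [editCount, editCount, symmDiff_comm]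

theorem editCount_triangle {V : Type*} [Finite V] (G H K : SimpleGraph V) :
    editCount G K ≤ editCount G H + editCount H K := by
  unfold editCount
  refine (Set.ncard_le_ncard (t := symmDiff G.edgeSet H.edgeSet ∪ symmDiff H.edgeSet K.edgeSet)
    ?_ (Set.toFinite _)).trans (Set.ncard_union_le _ _)
  exact symmDiff_triangle _ _ _

theorem difDeg_triangle {V : Type*} [Fintype V] (G H K : SimpleGraph V) (v : V) :
    difDeg G K v ≤ difDeg G H v + difDeg H K v := by
  unfold difDeg
  refine (Finset.card_le_card ?_).trans (Finset.card_union_le _ _)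
  intro u
  simp only [Finset.mem_filter, Finset.mem_univ, true_and, Finset.mem_union]
  tauto

theorem difDeg_comm {V : Type*} [Fintype V] (G H : SimpleGraph V) (v : V) :
    difDeg G H v = difDeg H G v := by
  unfold difDeg
  congr 1; ext u; simp only [Finset.mem_filter]; tauto

theorem difDeg_le_editCount {V : Type*} [Fintype V] (G H : SimpleGraph V) (v : V) :
    difDeg G H v ≤ editCount G H := by
  rw [difDeg, editCount, mem_symmDiff_edgeSet, ← SimpleGraph.coe_edgeFinset, Set.ncard_coe_finset]
  refine Finset.card_le_card_of_injOn (fun u => s(v, u)) ?_ ?_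
  · intro u hu
    simp only [Finset.coe_filter, Finset.mem_univ, true_and, Set.mem_ofPred_eq] at hu
    simpa [SimpleGraph.mem_edgeSet, symmDiff_adj] using hu
  · intro u _ w _ h
    simp only [Sym2.eq_iff, true_and] at h
    rcases h with h | ⟨h, h'⟩
    · exact h
    · exact h'.trans h

theorem difDeg_mono {V : Type*} [Fintype V] {G H G' H' : SimpleGraph V} {v : V}
    (h : ∀ u, ¬(G.Adj v u ↔ H.Adj v u) → ¬(G'.Adj v u ↔ H'.Adj v u)) :
    difDeg G H v ≤ difDeg G' H' v := by
  refine Finset.card_le_card fun u hu => ?_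
  simp only [Finset.mem_filter, Finset.mem_univ, true_and] at hu ⊢
  exact h u hu

theorem editCount_mono {V : Type*} [Finite V] {G H G' H' : SimpleGraph V}
    (h : ∀ u v, ¬(G.Adj u v ↔ H.Adj u v) → ¬(G'.Adj u v ↔ H'.Adj u v)) :
    editCount G H ≤ editCount G' H' := by
  unfold editCount
  rw [mem_symmDiff_edgeSet, mem_symmDiff_edgeSet]
  refine Set.ncard_le_ncard ?_ (Set.toFinite _)
  refine SimpleGraph.edgeSet_mono fun u v => ?_
  rw [symmDiff_adj, symmDiff_adj]
  exact h u v

/-! ## Partite graphs -/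

/-- The graph with independent classes `{p = i}`, `i ≥ 1`, the clique `{p = 0}`, and all pairs
between different classes. -/
def partGraph {V : Type*} (p : V → ℕ) : SimpleGraph V where
  Adj u v := u ≠ v ∧ (p u ≠ p v ∨ p u = 0)
  symm := ⟨fun _ _ h => ⟨h.1.symm, by have := h.2; grind⟩⟩
  loopless := ⟨fun _ h => h.1 rfl⟩

theorem partGraph_adj {V : Type*} (p : V → ℕ) (u v : V) :
    (partGraph p).Adj u v ↔ u ≠ v ∧ (p u ≠ p v ∨ p u = 0) := Iff.rfl

theorem Realisation.graph_eq {x : PartiteLimit} {n : ℕ} (R : Realisation x n) :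
    R.graph = partGraph R.part := rfl

theorem partGraph_isCompleteMultipartite {V : Type*} (p : V → ℕ) :
    (partGraph p).IsCompleteMultipartite := by
  refine ⟨fun u v w h1 h2 => ?_⟩
  simp only [partGraph_adj] at *
  grind

theorem partGraph_comap {V W : Type*} (p : V → ℕ) {F : W → V} (hF : Function.Injective F) :
    (partGraph p).comap F = partGraph (p ∘ F) := by
  ext a b
  simp [partGraph_adj, hF.eq_iff]

theorem append_comp {V W : Type*} {m r : ℕ} (p : V → W) (f : Fin m → V) (s : Fin r → V) :
    p ∘ Fin.append f s = Fin.append (p ∘ f) (p ∘ s) := by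
  funext a
  induction a using Fin.addCases <;> simp

/-- The effect on `γ` of flipping the last two vertices, of types `i₁` and `i₂`. -/
def pairVal {m : ℕ} (γ : GraphClass (m + 2) → ℝ) (i₁ i₂ : ℕ) (t : Fin m → ℕ) : ℝ :=
  γ (Quotient.mk (isoSetoid (m + 2)) (partGraph (Fin.append t ![i₁, i₂]))) -
  γ (Quotient.mk (isoSetoid (m + 2)) (symmDiff (partGraph (Fin.append t ![i₁, i₂]))
    (SimpleGraph.edge (Fin.natAdd m 0) (Fin.natAdd m 1))))

/-- The graph in which vertices of given types are joined to a last vertex as prescribed. -/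
def starGraph {m : ℕ} (t : Fin m → ℕ × Bool) : SimpleGraph (Fin (m + 1)) :=
  (addVertex (partGraph fun a => (t a).1) {a | (t a).2 = true}).comap
    (Fin.append some fun _ : Fin 1 => none)

/-- The value of `γ` on `starGraph`. -/
def starVal {m : ℕ} (γ : GraphClass (m + 1) → ℝ) (t : Fin m → ℕ × Bool) : ℝ :=
  γ (Quotient.mk (isoSetoid (m + 1)) (starGraph t))

theorem pair_injective {V : Type*} {u v : V} (h : u ≠ v) : Function.Injective ![u, v] := by
  intro i j hij
  fin_cases i <;> fin_cases j <;> simp_all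

theorem abs_pairVal_le {m : ℕ} {γ : GraphClass (m + 2) → ℝ} {M : ℝ} (hM : ∀ c, |γ c| ≤ M)
    (i₁ i₂ : ℕ) (t : Fin m → ℕ) : |pairVal γ i₁ i₂ t| ≤ 2 * M := by
  refine (abs_sub _ _).trans ?_
  linarith [hM (Quotient.mk (isoSetoid (m + 2)) (partGraph (Fin.append t ![i₁, i₂]))),
    hM (Quotient.mk (isoSetoid (m + 2)) (symmDiff (partGraph (Fin.append t ![i₁, i₂]))
    (SimpleGraph.edge (Fin.natAdd m 0) (Fin.natAdd m 1))))]

theorem flip_adj {V : Type*} (G : SimpleGraph V) (u v a b : V) :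
    (symmDiff G (SimpleGraph.edge u v)).Adj a b ↔
      ¬(G.Adj a b ↔ ((u = a ∧ v = b ∨ u = b ∧ v = a) ∧ a ≠ b)) := by
  rw [symmDiff_adj, SimpleGraph.edge_adj]
  grind

/-- The effect of the flip on an induced subgraph depends only on the classes of its vertices, so
the loss is an expectation over `m` sampled classes. -/
theorem pair_approx {m : ℕ} {γ : GraphClass (m + 2) → ℝ} {M : ℝ} (hM : ∀ c, |γ c| ≤ M)
    {V : Type*} [Fintype V] [Nonempty V] (p : V → ℕ) {v₁ v₂ : V} (hv : v₁ ≠ v₂) {q : ℕ → ℝ}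
    (hq : IsDist q) :
    |m.factorial * (bigLam γ (partGraph p) -
        bigLam γ (symmDiff (partGraph p) (SimpleGraph.edge v₁ v₂))) / (Fintype.card V : ℝ) ^ m -
      samp q m (pairVal γ (p v₁) (p v₂))| ≤
      2 * M * ((2 * m + m ^ 2) / Fintype.card V + m * tv (emp p) q) := by
  rw [← bigLam_sub γ ![v₁, v₂] (pair_injective hv), ← Finset.sum_sub_distrib]
  · have := sum_injExt_approx (m := m) ![v₁, v₂] (pair_injective hv) p hq
      (abs_pairVal_le hM (p v₁) (p v₂)) (fun f => val γ (partGraph p) (Fin.append f ![v₁, v₂]) -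
        val γ (symmDiff (partGraph p) (SimpleGraph.edge v₁ v₂)) (Fin.append f ![v₁, v₂])) ?_
    · exact_mod_cast this
    · intro f hf
      have h1 : (![p v₁, p v₂] : Fin 2 → ℕ) = p ∘ ![v₁, v₂] := by
        funext i; fin_cases i <;> rfl
      simp only [val, pairVal]
      rw [h1, ← append_comp, ← partGraph_comap p hf]
      congr 3
      ext a b
      have e1 : ∀ a, v₁ = Fin.append f ![v₁, v₂] a ↔ Fin.natAdd m 0 = a := by
        intro a
        rw [← hf.eq_iff]
        simp
      have e2 : ∀ a, v₂ = Fin.append f ![v₁, v₂] a ↔ Fin.natAdd m 1 = a := by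
        intro a
        rw [← hf.eq_iff]
        simp
      simp only [SimpleGraph.comap_adj, flip_adj, e1, e2, hf.ne_iff, ne_eq]
  · intro u v h i
    rw [flip_adj] at h
    fin_cases i <;> simp <;> tauto

/-- Away from `z` the graph is partite, so a vertex is described by its class and its adjacency to
`z`. The tuples avoid `z`, which leaves `τ z` free to be chosen so that `emp τ` is convenient. -/
theorem star_approx {m : ℕ} {γ : GraphClass (m + 1) → ℝ} {M : ℝ} (hM : ∀ c, |γ c| ≤ M)
    {V : Type*} [Fintype V] [Nonempty V] (p : V → ℕ) (z : V) (S : SimpleGraph V)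
    (hS : ∀ u v, u ≠ z → v ≠ z → (S.Adj u v ↔ (partGraph p).Adj u v)) (τ : V → ℕ × Bool)
    (hτ : ∀ u, u ≠ z → τ u = (p u, decide (S.Adj z u))) {q : ℕ × Bool → ℝ} (hq : IsDist q) :
    |(∑ f ∈ injExt m ![z], val γ S (Fin.append f ![z])) / (Fintype.card V : ℝ) ^ m -
      samp q m (starVal γ)| ≤ M * ((m + m ^ 2) / Fintype.card V + m * tv (emp τ) q) := by
  have := sum_injExt_approx (m := m) ![z] (Function.injective_of_subsingleton _) τ hq
      (g := starVal γ) (M := M) (fun t => hM _) (fun f => val γ S (Fin.append f ![z])) ?_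
  · refine this.trans (le_of_eq ?_)
    norm_num
  · intro f hf
    simp only [val, starVal]
    congr 2
    rw [append_injective_iff (Function.injective_of_subsingleton _)] at hf
    have hz : ∀ i, f i ≠ z := fun i => hf.2 i 0
    ext a b
    simp only [SimpleGraph.comap_adj, starGraph]
    induction a using Fin.addCases with
    | left a =>
      induction b using Fin.addCases with
      | left b =>
        simp [addVertex, hS _ _ (hz a) (hz b), partGraph_adj, hτ _ (hz a), hτ _ (hz b),
          hf.1.eq_iff]
      | right b => simp [addVertex, hτ _ (hz a), S.adj_comm z]
    | right a =>
      induction b using Fin.addCases with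
      | left b => simp [addVertex, hτ _ (hz b)]
      | right b => simp [addVertex]

theorem whole_approx {k : ℕ} {γ : GraphClass k → ℝ} {M : ℝ} (hM : ∀ c, |γ c| ≤ M)
    {V : Type*} [Fintype V] [Nonempty V] (p : V → ℕ) {q : ℕ → ℝ} (hq : IsDist q) :
    |k.factorial * bigLam γ (partGraph p) / (Fintype.card V : ℝ) ^ k -
      samp q k (fun t => γ (Quotient.mk (isoSetoid k) (partGraph t)))| ≤
      M * (k ^ 2 / Fintype.card V + k * tv (emp p) q) := by
  have h := sum_injExt_val (m := k) (r := 0) γ (Fin.elim0 : Fin 0 → V)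
    (Function.injective_of_subsingleton _) (partGraph p)
  rw [Finset.filter_true_of_mem (fun X _ i => i.elim0)] at h
  rw [bigLam_eq_sum]
  erw [← h]
  have := sum_injExt_approx (m := k) (r := 0) (Fin.elim0 : Fin 0 → V)
      (Function.injective_of_subsingleton _) p hq
      (g := fun t => γ (Quotient.mk (isoSetoid k) (partGraph t))) (M := M) (fun t => hM _)
      (fun f => val γ (partGraph p) (Fin.append f Fin.elim0)) ?_
  · refine this.trans (le_of_eq ?_)
    norm_num
  · intro f hf
    simp only [val]
    rw [partGraph_comap p hf, append_comp]
    congr 3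
    exact Fin.append_right_nil _ _ rfl

/-! ## Distributions of types -/

theorem hasSum_prod_bool {f : ℕ × Bool → ℝ} (hf : ∀ t, 0 ≤ f t) {a : ℝ}
    (h : HasSum (fun i => f (i, true) + f (i, false)) a) : HasSum f a := by
  have hs : Summable f := by
    rw [summable_prod_of_nonneg hf]
    refine ⟨fun i => (hasSum_fintype _).summable, ?_⟩
    simpa [tsum_fintype] using h.summable
  have h1 := hs.hasSum.prod_fiberwise (fun i => hasSum_fintype (fun c => f (i, c)))
  simp only [Fintype.sum_bool] at h1
  rw [h.unique h1]
  exact hs.hasSum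

/-- The distribution of the pair (class, adjacency to the new vertex). -/
def mixq (x : ℕ → ℝ) (b : ℕ → Bool) (α : ℝ) (t : ℕ × Bool) : ℝ :=
  if t.1 = 0 then (if t.2 then α else 1 - α) * x 0 else if t.2 = b t.1 then x t.1 else 0

theorem mixq_add (x : ℕ → ℝ) (b : ℕ → Bool) (α : ℝ) (i : ℕ) :
    mixq x b α (i, true) + mixq x b α (i, false) = x i := by
  unfold mixq
  by_cases hi : i = 0
  · subst hi; simp; ring
  · cases b i <;> simp [hi]

theorem mixq_isDist {x : ℕ → ℝ} (hx : IsDist x) (b : ℕ → Bool) {α : ℝ} (h0 : 0 ≤ α) (h1 : α ≤ 1) :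
    IsDist (mixq x b α) := by
  have hn : ∀ t, 0 ≤ mixq x b α t := by
    intro t
    have := hx.nonneg
    unfold mixq
    split_ifs
    · exact mul_nonneg h0 (this 0)
    · exact mul_nonneg (by linarith) (this 0)
    · exact this _
    · exact le_rfl
  refine ⟨hn, hasSum_prod_bool hn ?_⟩
  simp only [mixq_add]
  exact hx.hasSum

/-- Both distributions split class `i` in the same proportions, which depend only on `b` and `α`;
hence the split preserves `ℓ¹`-distances. -/
theorem tv_mixq {x y : ℕ → ℝ} (hx : IsDist x) (hy : IsDist y) (b : ℕ → Bool) {α : ℝ} (h0 : 0 ≤ α)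
    (h1 : α ≤ 1) : tv (mixq x b α) (mixq y b α) = tv x y := by
  refine (hasSum_prod_bool (fun t => abs_nonneg _) ?_).tsum_eq
  suffices h : (fun i => |mixq x b α (i, true) - mixq y b α (i, true)| +
      |mixq x b α (i, false) - mixq y b α (i, false)|) = fun i => |x i - y i| by
    rw [h]; exact (hx.summable_abs_sub hy).hasSum
  funext i
  unfold mixq
  by_cases hi : i = 0
  · subst hi
    simp only [if_true, Bool.false_eq_true, if_false]
    rw [← mul_sub, ← mul_sub, abs_mul, abs_mul, abs_of_nonneg h0, abs_of_nonneg (sub_nonneg.2 h1)]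
    ring
  · cases b i <;> simp [hi]

/-- Only the types `(0, true)` and `(0, false)` can have different weights, each by at most `3 / n`.
-/
theorem tv_emp_mixq {V : Type*} [Fintype V] [Nonempty V] (p : V → ℕ) (β : V → Bool) (b : ℕ → Bool)
    {α : ℝ} (hb : ∀ u, p u ≠ 0 → β u = b (p u))
    (hα : |((Finset.univ.filter fun u => p u = 0 ∧ β u = true).card : ℝ) -
      α * (Finset.univ.filter fun u => p u = 0).card| ≤ 3) :
    tv (emp fun u => (p u, β u)) (mixq (emp p) b α) ≤ 6 / Fintype.card V := by
  have hn0 : (0 : ℝ) < Fintype.card V := by exact_mod_cast Fintype.card_pos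
  set n : ℝ := (Fintype.card V : ℝ) with hn
  have h1 : ∀ t, |emp (fun u => (p u, β u)) t - mixq (emp p) b α t| ≤
      if t.1 = 0 then 3 / n else 0 := by
    rintro ⟨i, c⟩
    simp only
    split_ifs with hi
    · subst hi
      have hsplit : ((Finset.univ.filter fun u => p u = 0 ∧ β u = true).card : ℝ) +
          (Finset.univ.filter fun u => p u = 0 ∧ β u = false).card =
          (Finset.univ.filter fun u => p u = 0).card := by
        have h := Finset.card_filter_add_card_filter_not (s := Finset.univ.filter fun u => p u = 0)
          (fun u => β u = true)
        rw [Finset.filter_filter, Finset.filter_filter] at h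
        simp only [Bool.not_eq_true] at h
        exact_mod_cast h
      rw [abs_le] at hα
      cases c
      · have : emp (fun u => (p u, β u)) (0, false) - mixq (emp p) b α (0, false) =
          (((Finset.univ.filter fun u => p u = 0 ∧ β u = false).card : ℝ) -
            (1 - α) * (Finset.univ.filter fun u => p u = 0).card) / n := by
          simp only [emp, mixq, Prod.mk.injEq, if_true, Bool.false_eq_true, if_false, ← hn]
          simp only [sub_div, mul_div_assoc]
          congr
        rw [this, abs_div, abs_of_pos hn0]
        gcongr
        rw [abs_le]
        constructor <;> nlinarith [hα.1, hα.2]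
      · have : emp (fun u => (p u, β u)) (0, true) - mixq (emp p) b α (0, true) =
          (((Finset.univ.filter fun u => p u = 0 ∧ β u = true).card : ℝ) -
            α * (Finset.univ.filter fun u => p u = 0).card) / n := by
          simp only [emp, mixq, Prod.mk.injEq, if_true, ← hn]
          simp only [sub_div, mul_div_assoc]
          congr
        rw [this, abs_div, abs_of_pos hn0]
        gcongr
        rw [abs_le]
        constructor <;> nlinarith [hα.1, hα.2]
    · have : emp (fun u => (p u, β u)) (i, c) = mixq (emp p) b α (i, c) := by
        simp only [emp, mixq, hi, if_false, Prod.mk.injEq]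
        split_ifs with hc
        · congr 2
          congr 1
          ext u
          simp only [Finset.mem_filter, Finset.mem_univ, true_and, and_iff_left_iff_imp]
          intro hu
          rw [hb u (by rw [hu]; exact hi), hu, hc]
        · rw [Finset.filter_false_of_mem]
          · simp
          · rintro u - ⟨hu, hu'⟩
            rw [hb u (by rw [hu]; exact hi), hu] at hu'
            exact hc hu'.symm
      rw [this]; simp
  have h2 : HasSum (fun t : ℕ × Bool => if t.1 = 0 then 3 / n else 0) (6 / n) := by
    refine hasSum_prod_bool (fun t => by split_ifs <;> positivity) ?_
    have : HasSum (fun i : ℕ => if i = 0 then 6 / n else 0) (6 / n) := hasSum_ite_eq 0 _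
    convert this using 1
    funext i
    by_cases hi : i = 0
    · simp [hi]; ring
    · simp [hi]
  have h3 : Summable fun t => |emp (fun u => (p u, β u)) t - mixq (emp p) b α t| :=
    Summable.of_nonneg_of_le (fun _ => abs_nonneg _) h1 h2.summable
  exact (h3.tsum_le_tsum h1 h2.summable).trans (le_of_eq h2.tsum_eq)

theorem PartiteLimit.isDist (x : PartiteLimit) : IsDist x.x := ⟨x.nonneg, x.hasSum⟩

/-- For two probability distributions the `ℓ¹`-distance is twice the mass of the positive part of `x
- q`. So a one-sided bound on a finite set carrying almost all of `x` suffices. -/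
theorem tv_le_of_finset {q x : ℕ → ℝ} (hq : IsDist q) (hx : IsDist x) {ε η : ℝ} (hη : 0 ≤ η)
    (I : Finset ℕ) (hI : 1 - ε ≤ ∑ i ∈ I, x i) (h : ∀ i ∈ I, x i - q i ≤ η) :
    tv q x ≤ 2 * (ε + I.card * η) := by
  have h1 : HasSum (fun i => |q i - x i| + (x i - q i)) (tv q x + (1 - 1)) :=
    (hq.summable_abs_sub hx).hasSum.add (hx.hasSum.sub hq.hasSum)
  have h2 : HasSum (fun i => 2 * (x i + if i ∈ I then η - x i else 0))
      (2 * (1 + ∑ i ∈ I, (η - x i))) := by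
    refine (hx.hasSum.add ?_).mul_left 2
    have := hasSum_sum_of_ne_finset_zero (L := SummationFilter.unconditional ℕ) (f := fun i => if i ∈ I then η - x i else 0) (s := I)
      (fun i hi => by simp [hi])
    rwa [Finset.sum_congr rfl (fun i (hi : i ∈ I) => if_pos hi)] at this
  have h3 := hasSum_le (fun i => ?_) h1 h2
  · rw [Finset.sum_sub_distrib, Finset.sum_const, nsmul_eq_mul] at h3
    linarith
  · have := hq.nonneg i
    have := hx.nonneg i
    split_ifs with hi
    · have := h i hi
      rcases abs_cases (q i - x i) with ⟨h, _⟩ | ⟨h, _⟩ <;> rw [h] <;> linarith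
    · rcases abs_cases (q i - x i) with ⟨h, _⟩ | ⟨h, _⟩ <;> rw [h] <;> linarith

/-- If `x₀ > 0`, the classes `i ≥ 1` are only ever rounded down, by at most two vertices each, so
class `0` receives at least its share. The surplus of class `0` can exceed a constant number of
vertices, which is why the bound is one-sided. -/
theorem Realisation.sub_emp_le {x : PartiteLimit} {n : ℕ} (hn : 0 < n) (R : Realisation x n)
    (i : ℕ) : x.x i - emp R.part i ≤ 2 / n := by
  have hn0 : (0 : ℝ) < n := by exact_mod_cast hn
  have : Nonempty (Fin n) := ⟨⟨0, hn⟩⟩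
  have he : ∀ i, emp R.part i = ((Finset.univ.filter fun v => R.part v = i).card : ℝ) / n := by
    intro i
    simp only [emp, Fintype.card_fin]
    congr
  have key : ∀ i, x.x i * n - (Finset.univ.filter fun v => R.part v = i).card ≤ 2 →
      x.x i - emp R.part i ≤ 2 / n := by
    intro i hi
    rw [he, le_div_iff₀ hn0, sub_mul, div_mul_cancel₀ _ hn0.ne']
    exact hi
  rcases eq_or_lt_of_le (x.nonneg 0) with h0 | h0
  · rcases Nat.eq_zero_or_pos i with rfl | hi
    · rw [← h0]
      have : 0 ≤ emp R.part 0 := (emp_isDist R.part).nonneg 0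
      have : 0 ≤ 2 / (n : ℝ) := by positivity
      linarith
    · refine key i ?_
      have := abs_lt.1 (R.card_of_zero h0.symm i hi)
      linarith
  · have hle : ∀ i, 1 ≤ i → emp R.part i ≤ x.x i := by
      intro i hi
      rw [he, div_le_iff₀ hn0]
      rcases le_or_gt 2 (x.x i * n) with h | h
      · rw [R.card_of_pos h0 i hi h]
        exact Nat.floor_le (by linarith)
      · rw [R.card_small h0 i hi h]
        have := x.nonneg i
        simp only [Nat.cast_zero]
        positivity
    rcases Nat.eq_zero_or_pos i with rfl | hi
    · have h1 : HasSum (fun i => x.x i - emp R.part i) (1 - 1) :=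
        x.hasSum.sub (emp_isDist R.part).hasSum
      have h2 := le_hasSum h1 0 (fun j hj => sub_nonneg.2 (hle j (Nat.one_le_iff_ne_zero.2 hj)))
      have : 0 ≤ 2 / (n : ℝ) := by positivity
      linarith
    · refine key i ?_
      rcases le_or_gt 2 (x.x i * n) with h | h
      · rw [R.card_of_pos h0 i hi h]
        have := Nat.lt_floor_add_one (x.x i * n)
        linarith
      · rw [R.card_small h0 i hi h]
        simp only [Nat.cast_zero]
        linarith

theorem Realisation.tv_tendsto (x : PartiteLimit) {ε : ℝ} (hε : 0 < ε) :
    ∃ N : ℕ, 0 < N ∧ ∀ n, N ≤ n → ∀ R : Realisation x n, tv (emp R.part) x.x ≤ ε := by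
  obtain ⟨I, hI⟩ := (x.hasSum.eventually (lt_mem_nhds (show 1 - ε / 4 < 1 by linarith))).exists
  obtain ⟨N, hN⟩ := exists_nat_gt ((I.card : ℝ) * 8 / ε)
  refine ⟨N + 1, by omega, fun n hn R => ?_⟩
  have hn0 : 0 < n := by omega
  have hn' : (0 : ℝ) < n := by exact_mod_cast hn0
  have : Nonempty (Fin n) := ⟨⟨0, hn0⟩⟩
  refine (tv_le_of_finset (emp_isDist R.part) x.isDist (η := 2 / n) (by positivity) I hI.le
    fun i _ => R.sub_emp_le hn0 i).trans ?_
  have h1 : (I.card : ℝ) * 8 / ε < n := hN.trans_le (by exact_mod_cast (by omega : N ≤ n))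
  rw [div_lt_iff₀ hε] at h1
  have : (I.card : ℝ) * (2 / n) ≤ ε / 4 := by
    rw [mul_div_assoc', div_le_iff₀ hn']
    linarith
  linarith

/-! ## Existence of realisations -/

theorem exists_part_of_card {n : ℕ} (s : ℕ → ℕ) (I : Finset ℕ) (hs : ∀ i ∉ I, s i = 0)
    (hn : ∑ i ∈ I, s i = n) :
    ∃ p : Fin n → ℕ, ∀ i, (Finset.univ.filter fun v => p v = i).card = s i := by
  have e : Fin n ≃ Σ i : I, Fin (s i) := Fintype.equivOfCardEq (by
    rw [Fintype.card_sigma]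
    simp only [Fintype.card_fin]
    rw [← hn, ← Finset.sum_coe_sort])
  refine ⟨fun v => (e v).1, fun i => ?_⟩
  by_cases hi : i ∈ I
  · have h : (Finset.univ.filter fun v => ((e v).1 : ℕ) = i) =
        (Finset.univ : Finset (Fin (s i))).image fun j => e.symm ⟨⟨i, hi⟩, j⟩ := by
      ext v
      simp only [Finset.mem_filter, Finset.mem_univ, true_and, Finset.mem_image]
      constructor
      · rintro rfl
        exact ⟨(e v).2, e.symm_apply_apply v⟩
      · rintro ⟨j, rfl⟩
        simp
    rw [h, Finset.card_image_of_injective _ fun a b h => by simpa using h]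
    simp
  · rw [hs i hi, Finset.card_eq_zero, Finset.filter_eq_empty_iff]
    rintro v - rfl
    exact hi (e v).1.2

theorem nonempty_realisation (x : PartiteLimit) (n : ℕ) : Nonempty (Realisation x n) := by
  rcases eq_or_lt_of_le (x.nonneg 0) with h0 | h0
  · let X : ℕ → ℝ := fun i => ∑ j ∈ Finset.range i, x.x j
    have hXmono : Monotone X := monotone_nat_of_le_succ fun i => by
      simp only [X, Finset.sum_range_succ]
      linarith [x.nonneg i]
    have hX1 : ∀ i, X i ≤ 1 := fun i => sum_le_hasSum _ (fun j _ => x.nonneg j) x.hasSum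
    -- Class `i` is the `i`-th interval between the rounded-up partial sums, so its size differs
    -- from `x_i n` by less than one. The rounded sums reach `n` after finitely many steps because
    -- the partial sums times `n` eventually exceed `n - 1`.
    let c : ℕ → ℕ := fun i => ⌈X i * n⌉₊
    have hc : Monotone c := fun i j hij =>
      Nat.ceil_mono (mul_le_mul_of_nonneg_right (hXmono hij) (Nat.cast_nonneg n))
    have hcn : ∀ i, c i ≤ n := fun i => by
      refine Nat.ceil_le.2 ?_
      have := mul_le_mul_of_nonneg_right (hX1 i) (Nat.cast_nonneg (α := ℝ) n)
      linarith
    have hlim : Tendsto (fun i => X i * n) atTop (𝓝 (1 * n)) :=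
      x.hasSum.tendsto_sum_nat.mul_const _
    rw [one_mul] at hlim
    obtain ⟨K, hK⟩ := eventually_atTop.1 (hlim.eventually (lt_mem_nhds (sub_one_lt (n : ℝ))))
    have hcK : ∀ i, K ≤ i → c i = n := by
      intro i hi
      refine le_antisymm (hcn i) ?_
      by_contra hlt
      have h1 := Nat.le_ceil (X i * n)
      have h2 : ((c i : ℕ) : ℝ) ≤ n - 1 := by
        have : c i + 1 ≤ n := by omega
        have : ((c i + 1 : ℕ) : ℝ) ≤ n := by exact_mod_cast this
        push_cast at this
        linarith
      have := hK i hi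
      exact absurd (this.trans_le h1) (not_lt.2 h2)
    obtain ⟨p, hp⟩ := exists_part_of_card (n := n) (fun i => c (i + 1) - c i) (Finset.range K)
      (fun i hi => by
        simp only [Finset.mem_range, not_lt] at hi
        simp only [hcK i hi, hcK (i + 1) (by omega), Nat.sub_self])
      (by
        rw [Finset.sum_range_tsub hc, hcK K le_rfl]
        simp [c, X])
    refine ⟨⟨p, ?_, ?_, ?_, ?_⟩⟩
    · intro _ v hv
      have h1 := hp 0
      have h2 : c (0 + 1) - c 0 = 0 := by simp [c, X, ← h0]
      rw [h2, Finset.card_eq_zero, Finset.filter_eq_empty_iff] at h1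
      exact h1 (Finset.mem_univ v) hv
    · intro _ i _
      rw [hp i, Nat.cast_sub (hc (Nat.le_succ i))]
      have h1 := Nat.le_ceil (X i * n)
      have h2 := Nat.le_ceil (X (i + 1) * n)
      have h3 := Nat.ceil_lt_add_one (a := X i * n)
        (mul_nonneg (Finset.sum_nonneg fun j _ => x.nonneg j) (Nat.cast_nonneg n))
      have h4 := Nat.ceil_lt_add_one (a := X (i + 1) * n)
        (mul_nonneg (Finset.sum_nonneg fun j _ => x.nonneg j) (Nat.cast_nonneg n))
      have h5 : X (i + 1) = X i + x.x i := by simp only [X, Finset.sum_range_succ]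
      have h6 : X (i + 1) * n = X i * n + x.x i * n := by rw [h5]; ring
      simp only [c]
      rw [abs_lt]
      constructor <;> linarith
    · intro h; exact absurd h0.symm h.ne'
    · intro h; exact absurd h0.symm h.ne'
  · rcases Nat.eq_zero_or_pos n with rfl | hn
    · refine ⟨⟨fun _ => 0, fun h => absurd h h0.ne', fun h => absurd h h0.ne', fun _ i _ h => ?_,
        fun _ i _ _ => by simp⟩⟩
      norm_num at h
    have hn' : (0 : ℝ) < n := by exact_mod_cast hn
    have hfin : {i : ℕ | 2 ≤ x.x i * n}.Finite := by
      have := x.hasSum.summable.tendsto_cofinite_zero.eventually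
        (gt_mem_nhds (show (0 : ℝ) < 2 / n by positivity))
      refine (Filter.eventually_cofinite.1 this).subset fun i hi => ?_
      simp only [Set.mem_ofPred_eq, not_lt] at hi ⊢
      rwa [div_le_iff₀ hn']
    let I : Finset ℕ := hfin.toFinset.erase 0
    have hI : ∀ i, i ∈ I ↔ i ≠ 0 ∧ 2 ≤ x.x i * n := by simp [I]
    have hsum : ∑ i ∈ I, ⌊x.x i * n⌋₊ ≤ n := by
      have h1 : (∑ i ∈ I, (⌊x.x i * n⌋₊ : ℝ)) ≤ n := by
        calc _ ≤ ∑ i ∈ I, x.x i * n := Finset.sum_le_sum fun i _ =>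
              Nat.floor_le (mul_nonneg (x.nonneg i) hn'.le)
          _ = (∑ i ∈ I, x.x i) * n := by rw [Finset.sum_mul]
          _ ≤ 1 * n := mul_le_mul_of_nonneg_right
              (sum_le_hasSum _ (fun j _ => x.nonneg j) x.hasSum) hn'.le
          _ = n := one_mul _
      exact_mod_cast h1
    obtain ⟨p, hp⟩ := exists_part_of_card (n := n)
      (fun i => if i = 0 then n - ∑ i ∈ I, ⌊x.x i * n⌋₊ else if i ∈ I then ⌊x.x i * n⌋₊ else 0)
      (insert 0 I) (fun i hi => by
        simp only [Finset.mem_insert, not_or] at hi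
        simp [hi.1, hi.2])
      (by
        rw [Finset.sum_insert (by simp [I])]
        have : ∑ i ∈ I, (if i = 0 then n - ∑ i ∈ I, ⌊x.x i * n⌋₊ else
            if i ∈ I then ⌊x.x i * n⌋₊ else 0) = ∑ i ∈ I, ⌊x.x i * n⌋₊ :=
          Finset.sum_congr rfl fun i hi => by simp [((hI i).1 hi).1, hi]
        rw [this]
        simp only [if_true]
        omega)
    refine ⟨⟨p, fun h => absurd h h0.ne', fun h => absurd h h0.ne', fun _ i hi h => ?_,
        fun _ i hi h => ?_⟩⟩
    · have hi0 : i ≠ 0 := by omega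
      rw [hp, if_neg hi0, if_pos ((hI i).2 ⟨hi0, h⟩)]
    · have hi0 : i ≠ 0 := by omega
      rw [hp, if_neg hi0, if_neg (fun h' => absurd ((hI i).1 h').2 (not_le.2 h))]

theorem Realisation.part_mem {x : PartiteLimit} {n : ℕ} (R : Realisation x n) (v : Fin n) :
    R.part v ∈ x.suppStar := by
  have hpos : 0 < (Finset.univ.filter fun u => R.part u = R.part v).card :=
    Finset.card_pos.2 ⟨v, by simp⟩
  rcases eq_or_lt_of_le (x.nonneg 0) with h0 | h0
  · have h1 := R.card_of_zero h0.symm (R.part v) (Nat.one_le_iff_ne_zero.2 (R.part_ne_zero h0.symm v))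
    refine lt_of_le_of_ne (x.nonneg _) fun h => ?_
    rw [← h, zero_mul, sub_zero, Nat.abs_cast] at h1
    have : (Finset.univ.filter fun u => R.part u = R.part v).card < 1 := by exact_mod_cast h1
    omega
  · by_cases hv : R.part v = 0
    · rw [hv]; exact h0
    · rcases le_or_gt 2 (x.x (R.part v) * n) with h | h
      · refine lt_of_le_of_ne (x.nonneg _) fun h' => ?_
        rw [← h'] at h
        norm_num at h
      · have := R.card_small h0 _ (Nat.one_le_iff_ne_zero.2 hv) h
        omega

/-- Two vertices rather than one, because the pair derivative needs distinct vertices even when both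
lie in the same class. -/
theorem exists_two_le_card {x : PartiteLimit} {i : ℕ} (hi : i ∈ x.suppStar) :
    ∃ N : ℕ, ∀ n, N ≤ n → ∀ R : Realisation x n,
      2 ≤ (Finset.univ.filter fun v => R.part v = i).card := by
  obtain ⟨N, hN⟩ := exists_nat_gt (4 / x.x i)
  have hi' : 0 < x.x i := hi
  rw [div_lt_iff₀ hi'] at hN
  refine ⟨N + 1, fun n hn R => ?_⟩
  have hn0 : (0 : ℝ) < n := by exact_mod_cast (by omega : 0 < n)
  have h1 := R.sub_emp_le (by omega) i
  have h2 : emp R.part i = ((Finset.univ.filter fun v => R.part v = i).card : ℝ) / n := by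
    simp only [emp, Fintype.card_fin]
    congr
  rw [h2, le_div_iff₀ hn0, sub_mul, div_mul_cancel₀ _ hn0.ne'] at h1
  have h3 : (N : ℝ) ≤ n := by exact_mod_cast (by omega : N ≤ n)
  have h4 : (4 : ℝ) < n * x.x i := hN.trans_le (mul_le_mul_of_nonneg_right h3 hi'.le)
  have h5 : (2 : ℝ) ≤ ((Finset.univ.filter fun v => R.part v = i).card : ℝ) := by linarith
  exact_mod_cast h5

theorem eventually_nonempty_pairRealisation {x : PartiteLimit} {i₁ i₂ : ℕ} (h₁ : i₁ ∈ x.suppStar)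
    (h₂ : i₂ ∈ x.suppStar) : ∀ᶠ n in atTop, Nonempty (PairRealisation x i₁ i₂ n) := by
  obtain ⟨N₁, hN₁⟩ := exists_two_le_card h₁
  obtain ⟨N₂, hN₂⟩ := exists_two_le_card h₂
  filter_upwards [eventually_ge_atTop N₁, eventually_ge_atTop N₂] with n hn₁ hn₂
  obtain ⟨R⟩ := nonempty_realisation x n
  have hc₁ := hN₁ n hn₁ R
  obtain ⟨u, hu⟩ := Finset.card_pos.1 (lt_of_lt_of_le two_pos hc₁)
  have hc := hN₂ n hn₂ R
  obtain ⟨v, hv, huv⟩ := Finset.exists_mem_ne (lt_of_lt_of_le one_lt_two hc) u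
  simp only [Finset.mem_filter, Finset.mem_univ, true_and] at hu hv
  exact ⟨⟨R, u, v, huv.symm, hu, hv⟩⟩

theorem nonempty_attachment {x : PartiteLimit} {n : ℕ} (R : Realisation x n) (b : ℕ → Bool) {α : ℝ}
    (h1 : α ≤ 1) : Nonempty (Attachment R b α) := by
  obtain ⟨A, hA, hcard⟩ := Finset.exists_subset_card_eq (s := Finset.univ.filter fun v => R.part v = 0)
    (n := ⌊α * ((Finset.univ.filter fun v => R.part v = 0).card : ℝ)⌋₊) (by
      refine Nat.floor_le_of_le ?_
      have := mul_le_mul_of_nonneg_right h1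
        (Nat.cast_nonneg (α := ℝ) (Finset.univ.filter fun v => R.part v = 0).card)
      linarith)
  refine ⟨⟨A ∪ Finset.univ.filter (fun v => R.part v ≠ 0 ∧ b (R.part v) = true), fun v hv => ?_, ?_⟩⟩
  · simp only [Finset.mem_union, Finset.mem_filter, Finset.mem_univ, true_and, hv, ne_eq,
      not_false_eq_true, or_iff_right_iff_imp]
    intro hvA
    have := hA hvA
    simp only [Finset.mem_filter, Finset.mem_univ, true_and] at this
    exact absurd this hv
  · rw [← hcard]
    congr 1
    ext v
    simp only [Finset.mem_union, Finset.mem_filter, Finset.mem_univ, true_and]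
    constructor
    · rintro ⟨h | h, h'⟩
      · exact h
      · exact absurd h' h.1
    · intro h
      have := hA h
      simp only [Finset.mem_filter, Finset.mem_univ, true_and] at this
      exact ⟨Or.inl h, this⟩

/-! ## The limits -/

/-- Without objects of arbitrarily large order the filter would be trivial and the limit not unique;
`hne` rules this out. -/
theorem limOrder_eq {ι : ℕ → Type} {f : ∀ n, ι n → ℝ} {L : ℝ} (hne : ∀ᶠ n in atTop, Nonempty (ι n))
    (h : Tendsto (fun a : Σ n, ι n => f a.1 a.2) (comap Sigma.fst atTop) (𝓝 L)) :
    limOrder f = L := by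
  have : NeBot (comap (Sigma.fst : (Σ n, ι n) → ℕ) atTop) := by
    refine comap_neBot fun t ht => ?_
    obtain ⟨n, hn, ⟨a⟩⟩ := ((eventually_of_mem ht fun _ h => h).and hne).exists
    exact ⟨⟨n, a⟩, hn⟩
  exact h.limUnder_eq

theorem tendsto_sigma_of_forall {ι : ℕ → Type} {f : ∀ n, ι n → ℝ} {L : ℝ}
    (h : ∀ ε > 0, ∃ N : ℕ, ∀ n, N ≤ n → ∀ a, |f n a - L| ≤ ε) :
    Tendsto (fun a : Σ n, ι n => f a.1 a.2) (comap Sigma.fst atTop) (𝓝 L) := by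
  rw [Metric.tendsto_nhds]
  intro ε hε
  obtain ⟨N, hN⟩ := h (ε / 2) (by positivity)
  filter_upwards [(eventually_ge_atTop N).comap Sigma.fst] with a ha
  rw [Real.dist_eq]
  have := hN a.1 ha a.2
  linarith

theorem forall_of_tendsto_sigma {ι : ℕ → Type} {f : ∀ n, ι n → ℝ} {L : ℝ}
    (h : Tendsto (fun a : Σ n, ι n => f a.1 a.2) (comap Sigma.fst atTop) (𝓝 L)) :
    ∀ ε > 0, ∃ N : ℕ, ∀ n, N ≤ n → ∀ a, |f n a - L| ≤ ε := by
  intro ε hε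
  rw [Metric.tendsto_nhds] at h
  obtain ⟨t, ht, hts⟩ := mem_comap.1 (h ε hε)
  obtain ⟨N, hN⟩ := mem_atTop_sets.1 ht
  refine ⟨N, fun n hn a => ?_⟩
  have : dist (f n a) L < ε := @hts ⟨n, a⟩ (hN n hn)
  rw [Real.dist_eq] at this
  exact this.le

theorem tendsto_choose_ratio (r : ℕ) : ∀ m : ℕ,
    Tendsto (fun n : ℕ => (m.factorial * (n - r).choose m : ℝ) / (n : ℝ) ^ m) atTop (𝓝 1) := by
  have h : ∀ m : ℕ, Tendsto (fun n : ℕ => ((n - r).descFactorial m : ℝ) / (n : ℝ) ^ m) atTop (𝓝 1) := by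
    intro m
    induction m with
    | zero => simp
    | succ m ih =>
      have h1 : Tendsto (fun n : ℕ => ((n - r - m : ℕ) : ℝ) / n) atTop (𝓝 1) := by
        have h2 : Tendsto (fun n : ℕ => 1 - ((r + m : ℕ) : ℝ) / n) atTop (𝓝 (1 - 0)) :=
          tendsto_const_nhds.sub (tendsto_const_div_atTop_nhds_zero_nat _)
        rw [sub_zero] at h2
        refine h2.congr' ?_
        filter_upwards [eventually_ge_atTop (r + m + 1)] with n hn
        have hn0 : (n : ℝ) ≠ 0 := by
          have : n ≠ 0 := by omega
          exact_mod_cast this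
        rw [Nat.sub_sub, Nat.cast_sub (by omega)]
        field_simp
      have := h1.mul ih
      rw [one_mul] at this
      refine this.congr fun n => ?_
      rw [Nat.descFactorial_succ, pow_succ]
      push_cast
      rw [div_mul_div_comm, mul_comm (n : ℝ)]
  intro m
  refine (h m).congr fun n => ?_
  rw [Nat.descFactorial_eq_factorial_mul_choose]
  push_cast
  rfl

/-- The definitions normalise by binomial coefficients, the sampling estimates by powers; the two
agree asymptotically up to the factor `m!`. -/
theorem tendsto_renormalise {ι : ℕ → Type} {A : ∀ n, ι n → ℝ} {L : ℝ} {m : ℕ} {c D : ℕ → ℝ}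
    (hD : ∀ᶠ n in atTop, D n ≠ 0)
    (hc : Tendsto (fun n => m.factorial * c n / D n) atTop (𝓝 1))
    (h : Tendsto (fun a : Σ n, ι n => m.factorial * A a.1 a.2 / D a.1) (comap Sigma.fst atTop) (𝓝 L)) :
    Tendsto (fun a : Σ n, ι n => A a.1 a.2 / c a.1) (comap Sigma.fst atTop) (𝓝 L) := by
  have h1 := h.div (hc.comp tendsto_comap) one_ne_zero
  rw [div_one] at h1
  refine h1.congr' ?_
  filter_upwards [hD.comap Sigma.fst] with a ha
  have : (m.factorial : ℝ) ≠ 0 := by positivity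
  simp only [Function.comp, Pi.div_apply]
  rw [div_div_div_cancel_right₀ ha, mul_div_mul_left _ _ this]

theorem exists_nat_div_le (K : ℝ) {ε : ℝ} (hε : 0 < ε) : ∃ N : ℕ, 0 < N ∧ ∀ n : ℕ, N ≤ n →
    K / n ≤ ε := by
  obtain ⟨N, hN⟩ := exists_nat_gt (K / ε)
  refine ⟨N + 1, by omega, fun n hn => ?_⟩
  have hn0 : (0 : ℝ) < n := by exact_mod_cast (by omega : 0 < n)
  have h3 : (N : ℝ) ≤ n := by exact_mod_cast (by omega : N ≤ n)
  rw [div_le_iff₀ hn0]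
  rw [div_lt_iff₀ hε] at hN
  nlinarith

theorem eventually_pow_ne_zero (m : ℕ) : ∀ᶠ n : ℕ in atTop, (n : ℝ) ^ m ≠ 0 := by
  filter_upwards [eventually_gt_atTop 0] with n hn
  positivity

/-- The limit is the expected value of `γ` on the partite graph of `k` classes sampled from `x`. The
threshold `N` does not depend on the realisation. -/
theorem lam_tendsto {k : ℕ} (γ : GraphClass k → ℝ) (x : PartiteLimit) :
    ∀ ε > 0, ∃ N : ℕ, ∀ n, N ≤ n → ∀ R : Realisation x n, |lam γ R.graph - lamLim γ x| ≤ ε := by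
  obtain ⟨M, hM0, hM⟩ := exists_bound γ
  have h : Tendsto (fun a : Σ n, Realisation x n => lam γ a.2.graph) (comap Sigma.fst atTop)
      (𝓝 (samp x.x k (fun t => γ (Quotient.mk (isoSetoid k) (partGraph t))))) := by
    simp only [lam, Fintype.card_fin]
    refine tendsto_renormalise (A := fun n (R : Realisation x n) => bigLam γ R.graph)
      (c := fun n => (n.choose k : ℝ)) (m := k) (eventually_pow_ne_zero k)
      (by simpa using tendsto_choose_ratio 0 k)
      (tendsto_sigma_of_forall (ι := fun n => Realisation x n)
        (f := fun n R => k.factorial * bigLam γ R.graph / (n : ℝ) ^ k) fun ε hε => ?_)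
    obtain ⟨N₁, hN₁, h₁⟩ := exists_nat_div_le (M * k ^ 2) (show 0 < ε / 2 by positivity)
    obtain ⟨N₂, hN₂, h₂⟩ := Realisation.tv_tendsto x (show 0 < ε / (2 * M * (k + 1)) by positivity)
    refine ⟨max N₁ N₂, fun n hn R => ?_⟩
    have : Nonempty (Fin n) := ⟨⟨0, by omega⟩⟩
    have h3 := whole_approx hM R.part x.isDist
    rw [Fintype.card_fin] at h3
    refine h3.trans ?_
    have h4 := h₁ n (by omega)
    have h5 := h₂ n (by omega) R
    have h6 : M * (k * tv (emp R.part) x.x) ≤ ε / 2 := by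
      rw [le_div_iff₀ (by positivity)] at h5
      have := tv_nonneg (emp R.part) x.x
      nlinarith
    rw [mul_add, ← mul_div_assoc]
    linarith
  have h' : lamLim γ x = _ := limOrder_eq
    (Eventually.of_forall fun n => nonempty_realisation x n) h
  rw [h']
  exact forall_of_tendsto_sigma (ι := fun n => Realisation x n) (f := fun n R => lam γ R.graph) h

theorem nablaPairLim_eq {m : ℕ} (γ : GraphClass (m + 2) → ℝ) {x : PartiteLimit} {i₁ i₂ : ℕ}
    (h₁ : i₁ ∈ x.suppStar) (h₂ : i₂ ∈ x.suppStar) :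
    nablaPairLim γ i₁ i₂ x = samp x.x m (pairVal γ i₁ i₂) := by
  obtain ⟨M, hM0, hM⟩ := exists_bound γ
  refine limOrder_eq (eventually_nonempty_pairRealisation h₁ h₂) ?_
  simp only [nablaPair]
  refine tendsto_renormalise (A := fun n (R : PairRealisation x i₁ i₂ n) =>
      bigLam γ R.toRealisation.graph -
        bigLam γ (symmDiff R.toRealisation.graph (SimpleGraph.edge R.v₁ R.v₂)))
      (c := fun n => ((n - 2).choose (m + 2 - 2) : ℝ)) (m := m) (eventually_pow_ne_zero m)
      (tendsto_choose_ratio 2 m)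
      (tendsto_sigma_of_forall (ι := fun n => PairRealisation x i₁ i₂ n)
        (f := fun n R => m.factorial * (bigLam γ R.toRealisation.graph -
        bigLam γ (symmDiff R.toRealisation.graph (SimpleGraph.edge R.v₁ R.v₂))) / (n : ℝ) ^ m)
        fun ε hε => ?_)
  obtain ⟨N₁, hN₁, h₁⟩ := exists_nat_div_le (2 * M * (2 * m + m ^ 2)) (show 0 < ε / 2 by positivity)
  obtain ⟨N₂, hN₂, h₂⟩ := Realisation.tv_tendsto x (show 0 < ε / (4 * M * (m + 1)) by positivity)
  refine ⟨max N₁ N₂, fun n hn R => ?_⟩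
  have : Nonempty (Fin n) := ⟨⟨0, by omega⟩⟩
  have h3 := pair_approx hM R.part R.ne x.isDist
  rw [Fintype.card_fin, R.part_v₁, R.part_v₂] at h3
  refine h3.trans ?_
  have h4 := h₁ n (by omega)
  have h5 := h₂ n (by omega) R.toRealisation
  have h6 : 2 * M * (m * tv (emp R.part) x.x) ≤ ε / 2 := by
    rw [le_div_iff₀ (by positivity)] at h5
    have := tv_nonneg (emp R.part) x.x
    nlinarith
  rw [mul_add, ← mul_div_assoc]
  linarith

theorem tv_emp_option {V : Type*} [Fintype V] [Nonempty V] (p : Option V → ℕ) :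
    tv (emp p) (emp fun v => p (some v)) ≤ 2 / Fintype.card V := by
  have hn0 : (0 : ℝ) < Fintype.card V := by exact_mod_cast Fintype.card_pos
  set n : ℝ := (Fintype.card V : ℝ) with hn
  have hc : ∀ i, ((Finset.univ.filter fun u => p u = i).card : ℝ) =
      (if i = p none then 1 else 0) + (Finset.univ.filter fun v => p (some v) = i).card := by
    intro i
    rw [Finset.card_filter, Finset.card_filter, Fintype.sum_option]
    push_cast
    congr 1
    simp only [eq_comm]
  have key : ∀ i, |emp p i - emp (fun v => p (some v)) i| ≤
      (1 / n) * (emp (fun v => p (some v)) i + if i = p none then 1 else 0) := by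
    intro i
    have h1 : emp p i = ((if i = p none then 1 else 0) + n * emp (fun v => p (some v)) i) /
        (n + 1) := by
      simp only [emp, Fintype.card_option]
      rw [← hn, mul_div_cancel₀ _ hn0.ne']
      push_cast
      rw [← hn]
      congr 1
      convert hc i
    have h2 : 0 ≤ emp (fun v => p (some v)) i := (emp_isDist _).nonneg i
    have h3 : (0 : ℝ) ≤ if i = p none then 1 else 0 := by split_ifs <;> norm_num
    generalize (if i = p none then (1 : ℝ) else 0) = δ at *
    generalize emp (fun v => p (some v)) i = e at *
    have h4 : emp p i - e = (δ - e) / (n + 1) := by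
      rw [h1]; field_simp; ring
    rw [h4, abs_div, abs_of_pos (show 0 < n + 1 by linarith), div_mul_eq_mul_div, one_mul]
    have : |δ - e| ≤ e + δ := by rw [abs_le]; constructor <;> linarith
    exact div_le_div₀ (by linarith) this hn0 (by linarith)
  have h2 : HasSum (fun i => (1 / n) * (emp (fun v => p (some v)) i + if i = p none then 1 else 0))
      ((1 / n) * (1 + 1)) := ((emp_isDist _).hasSum.add (hasSum_ite_eq _ _)).mul_left _
  refine (((emp_isDist p).summable_abs_sub (emp_isDist _)).tsum_le_tsum key h2.summable).trans
    (le_of_eq ?_)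
  rw [h2.tsum_eq]; ring

theorem sum_attach_approx {m : ℕ} {γ : GraphClass (m + 1) → ℝ} {M : ℝ} (hM : ∀ c, |γ c| ≤ M)
    {x : PartiteLimit} {n : ℕ} (hn : 0 < n) (R : Realisation x n) {b : ℕ → Bool} {α : ℝ}
    (h0 : 0 ≤ α) (h1 : α ≤ 1) (N : Attachment R b α) :
    |(∑ f ∈ injExt m ![none], val γ (addVertex R.graph N.nbhd) (Fin.append f ![none])) /
        ((n + 1 : ℕ) : ℝ) ^ m - samp (mixq x.x b α) m (starVal γ)| ≤
      M * ((m + m ^ 2) / n + m * (8 / n + tv (emp R.part) x.x)) := by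
  have hn0 : (0 : ℝ) < n := by exact_mod_cast hn
  have : Nonempty (Fin n) := ⟨⟨0, hn⟩⟩
  have hM0 : 0 ≤ M := (abs_nonneg _).trans (hM (Quotient.mk _ ⊥))
  -- The new vertex gets a nominal class, `1`, and the adjacency value `b 1`. Any nonzero class
  -- would do: it keeps the count of class `0` unchanged and is consistent with `b`.
  let p : Option (Fin n) → ℕ := fun u => u.elim 1 R.part
  let β : Option (Fin n) → Bool := fun u => u.elim (b 1) fun v => decide (v ∈ N.nbhd)
  have h := star_approx hM p none (addVertex R.graph N.nbhd) (fun u v hu hv => by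
      cases u with
      | none => exact absurd rfl hu
      | some u =>
        cases v with
        | none => exact absurd rfl hv
        | some v => simp [addVertex, Realisation.graph_eq, partGraph_adj, p])
    (fun u => (p u, β u)) (fun u hu => by
      cases u with
      | none => exact absurd rfl hu
      | some u => simp [addVertex, β]) (mixq_isDist x.isDist b h0 h1)
  simp only [Fintype.card_option, Fintype.card_fin] at h
  refine h.trans ?_
  have hcard : ∀ (P : Option (Fin n) → Prop) [DecidablePred P], ¬ P none → (Finset.univ.filter P).card =
      (Finset.univ.filter fun v => P (some v)).card := by
    intro P _ hP
    rw [Finset.card_filter, Finset.card_filter, Fintype.sum_option, if_neg hP, zero_add]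
  have h2 := tv_emp_mixq p β b (α := α) (fun u hu => by
      cases u with
      | none => rfl
      | some u =>
        have := N.mem_iff u hu
        simp only [β, p, Option.elim]
        rw [Bool.eq_iff_iff, decide_eq_true_iff]
        exact this) (by
    rw [hcard _ (by simp [p]), hcard _ (by simp [p])]
    have e1 : (Finset.univ.filter fun v => p (some v) = 0 ∧ β (some v) = true) =
        N.nbhd.filter fun v => R.part v = 0 := by
      ext v
      simp [p, β, and_comm]
    have e2 : (Finset.univ.filter fun v => p (some v) = 0) =
        Finset.univ.filter fun v => R.part v = 0 := rfl
    rw [e1, e2, N.card_zero]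
    have f1 := Nat.floor_le (a := α * ((Finset.univ.filter fun v => R.part v = 0).card : ℝ))
      (by positivity)
    have f2 := Nat.lt_floor_add_one (α * ((Finset.univ.filter fun v => R.part v = 0).card : ℝ))
    rw [abs_le]
    constructor <;> linarith)
  have h3 := tv_mixq (emp_isDist p) x.isDist b h0 h1
  have h4 := tv_triangle (emp_isDist p) (emp_isDist fun v => p (some v)) x.isDist
  have h5 := tv_emp_option p
  have h6 := tv_triangle (emp_isDist fun u => (p u, β u)) (mixq_isDist (emp_isDist p) b h0 h1)
    (mixq_isDist x.isDist b h0 h1)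
  have e3 : (fun v => p (some v)) = R.part := rfl
  rw [e3] at h4 h5
  simp only [Fintype.card_option, Fintype.card_fin] at h2 h5
  have g1 : (6 : ℝ) / ((n + 1 : ℕ) : ℝ) ≤ 6 / n := by
    apply div_le_div_of_nonneg_left (by norm_num) hn0
    push_cast; linarith
  have g2 : ((m : ℝ) + m ^ 2) / ((n + 1 : ℕ) : ℝ) ≤ (m + m ^ 2) / n := by
    apply div_le_div_of_nonneg_left (by positivity) hn0
    push_cast; linarith
  have g3 : (6 : ℝ) / n + 2 / n = 8 / n := by rw [← add_div]; norm_num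
  refine mul_le_mul_of_nonneg_left (add_le_add g2 (mul_le_mul_of_nonneg_left ?_
    (Nat.cast_nonneg m))) hM0
  linarith

theorem nablaVertexLim_eq {m : ℕ} (γ : GraphClass (m + 1) → ℝ) (x : PartiteLimit) (b : ℕ → Bool)
    {α : ℝ} (h0 : 0 ≤ α) (h1 : α ≤ 1) :
    nablaVertexLim γ b α x =
      samp (mixq x.x (eFun 1) 1) m (starVal γ) - samp (mixq x.x b α) m (starVal γ) := by
  obtain ⟨M, hM0, hM⟩ := exists_bound γ
  refine limOrder_eq (Eventually.of_forall fun n => ?_) ?_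
  · obtain ⟨R⟩ := nonempty_realisation x n
    obtain ⟨N₁⟩ := nonempty_attachment R (eFun 1) le_rfl
    obtain ⟨N₂⟩ := nonempty_attachment R b h1
    exact ⟨⟨R, N₁, N₂⟩⟩
  refine tendsto_renormalise (ι := fun n => Σ R : Realisation x n,
      Attachment R (eFun 1) 1 × Attachment R b α)
    (A := fun n a => bigLam γ (addVertex a.1.graph a.2.1.nbhd) -
      bigLam γ (addVertex a.1.graph a.2.2.nbhd))
      (c := fun n => (n.choose (m + 1 - 1) : ℝ)) (m := m)
      -- The graph with the added vertex has `n + 1` vertices, whereas the definition normalises by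
      -- `n.choose (k - 1)`.
      (D := fun n => ((n + 1 : ℕ) : ℝ) ^ m) (Eventually.of_forall fun n => by positivity)
      ?_ (tendsto_sigma_of_forall (ι := fun n => Σ R : Realisation x n,
      Attachment R (eFun 1) 1 × Attachment R b α)
        (f := fun n a => m.factorial * (bigLam γ (addVertex a.1.graph a.2.1.nbhd) -
      bigLam γ (addVertex a.1.graph a.2.2.nbhd)) / ((n + 1 : ℕ) : ℝ) ^ m) fun ε hε => ?_)
  · have := (tendsto_add_atTop_iff_nat 1).2 (tendsto_choose_ratio 1 m)
    simpa using this
  obtain ⟨N₁, hN₁, h₁⟩ := exists_nat_div_le (M * (m + m ^ 2 + 8 * m)) (show 0 < ε / 4 by positivity)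
  obtain ⟨N₂, hN₂, h₂⟩ := Realisation.tv_tendsto x (show 0 < ε / (4 * M * (m + 1)) by positivity)
  refine ⟨max N₁ N₂, fun n hn a => ?_⟩
  obtain ⟨R, A, B⟩ := a
  have hA := sum_attach_approx hM (by omega) R zero_le_one le_rfl A
  have hB := sum_attach_approx hM (by omega) R h0 h1 B
  have h4 := h₁ n (by omega)
  have h5 := h₂ n (by omega) R
  have h6 : M * (m * tv (emp R.part) x.x) ≤ ε / 4 := by
    rw [le_div_iff₀ (by positivity)] at h5
    have := tv_nonneg (emp R.part) x.x
    nlinarith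
  have h7 : M * ((m + m ^ 2) / n + m * (8 / n + tv (emp R.part) x.x)) =
      M * (m + m ^ 2 + 8 * m) / n + M * (m * tv (emp R.part) x.x) := by ring
  rw [h7] at hA hB
  simp only
  rw [← bigLam_sub γ ![none] (Function.injective_of_subsingleton _), sub_div]
  · rw [abs_le] at *
    constructor <;> linarith [hA.1, hA.2, hB.1, hB.2]
  · intro u v h i
    fin_cases i
    cases u with
    | none => simp
    | some u =>
      cases v with
      | none => simp
      | some v => exact absurd Iff.rfl h

/-! ## Correcting pairs one at a time -/

theorem tv_emp_le_card {V : Type*} [Fintype V] [Nonempty V] (p p' : V → ℕ) :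
    tv (emp p) (emp p') ≤ 2 * (Finset.univ.filter fun v => p v ≠ p' v).card / Fintype.card V := by
  have hn0 : (0 : ℝ) < Fintype.card V := by exact_mod_cast Fintype.card_pos
  set n : ℝ := (Fintype.card V : ℝ) with hn
  set B := Finset.univ.filter fun v => p v ≠ p' v with hB
  have h1 : ∀ i, |emp p i - emp p' i| ≤
      (∑ v ∈ B, ((if i = p v then (1 : ℝ) else 0) + if i = p' v then (1 : ℝ) else 0)) / n := by
    intro i
    have : emp p i - emp p' i =
        (∑ v ∈ B, ((if i = p v then (1 : ℝ) else 0) - if i = p' v then (1 : ℝ) else 0)) / n := by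
      have h2 : ∑ v ∈ B, ((if i = p v then (1 : ℝ) else 0) - if i = p' v then (1 : ℝ) else 0) =
          ∑ v, ((if i = p v then (1 : ℝ) else 0) - if i = p' v then (1 : ℝ) else 0) := by
        refine Finset.sum_subset (Finset.subset_univ _) fun v _ hv => ?_
        simp only [hB, Finset.mem_filter, Finset.mem_univ, true_and, not_not] at hv
        simp [hv]
      rw [h2, Finset.sum_sub_distrib]
      simp only [emp, Finset.card_filter]
      push_cast
      rw [← hn, sub_div]
      simp only [eq_comm]
    rw [this, abs_div, abs_of_pos hn0]
    gcongr
    refine (Finset.abs_sum_le_sum_abs _ _).trans (Finset.sum_le_sum fun v _ => ?_)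
    split_ifs <;> norm_num
  have h2 : HasSum (fun i => (∑ v ∈ B, ((if i = p v then (1 : ℝ) else 0) +
      if i = p' v then (1 : ℝ) else 0)) / n) ((∑ v ∈ B, (1 + 1)) / n) :=
    (hasSum_sum fun v _ => (hasSum_ite_eq (p v) (1 : ℝ)).add (hasSum_ite_eq (p' v) 1)).div_const n
  refine (((emp_isDist p).summable_abs_sub (emp_isDist p')).tsum_le_tsum h1 h2.summable).trans
    (le_of_eq ?_)
  rw [h2.tsum_eq]
  simp only [Finset.sum_const, nsmul_eq_mul]
  ring

/-- Flipping a wrong pair removes that pair from the set of disagreements and changes nothing else.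
-/
theorem flip_dif {V : Type*} {J H : SimpleGraph V} {u v : V} (h : ¬(J.Adj u v ↔ H.Adj u v))
    (a b : V) : ¬((symmDiff J (SimpleGraph.edge u v)).Adj a b ↔ H.Adj a b) ↔
      ¬(J.Adj a b ↔ H.Adj a b) ∧ ¬(u = a ∧ v = b ∨ u = b ∧ v = a) := by
  have huv : u ≠ v := by rintro rfl; simp at h
  rw [flip_adj]
  by_cases hab : u = a ∧ v = b ∨ u = b ∧ v = a
  · rcases hab with ⟨rfl, rfl⟩ | ⟨rfl, rfl⟩
    · simp only [and_self, true_or, ne_eq, huv, not_false_eq_true, iff_true, not_true_eq_false,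
        and_false, iff_false, not_not]
      tauto
    · rw [J.adj_comm, H.adj_comm]
      simp only [and_self, or_true, ne_eq, Ne.symm huv, not_false_eq_true, iff_true,
        not_true_eq_false, and_false, iff_false, not_not]
      tauto
  · simp only [hab, false_and, iff_false, not_not, not_false_eq_true, and_true]

theorem editCount_flip {V : Type*} [Finite V] {J K : SimpleGraph V} {u v : V}
    (h : ¬(J.Adj u v ↔ K.Adj u v)) :
    editCount (symmDiff J (SimpleGraph.edge u v)) K + 1 = editCount J K := by
  unfold editCount
  rw [mem_symmDiff_edgeSet, mem_symmDiff_edgeSet]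
  have h1 : (symmDiff (symmDiff J (SimpleGraph.edge u v)) K).edgeSet =
      (symmDiff J K).edgeSet \ {s(u, v)} := by
    ext e
    induction e using Sym2.ind with
    | _ a b =>
      simp only [SimpleGraph.mem_edgeSet, symmDiff_adj J K, symmDiff_adj _ K, flip_dif h,
        Set.mem_sdiff, Set.mem_singleton_iff, Sym2.eq_iff]
      grind
  rw [h1]
  exact Set.ncard_sdiff_singleton_add_one
    (by rw [SimpleGraph.mem_edgeSet, symmDiff_adj]; exact h) (Set.toFinite _)

theorem eq_of_editCount_eq_zero {V : Type*} [Finite V] {J K : SimpleGraph V}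
    (h : editCount J K = 0) : J = K := by
  unfold editCount at h
  rw [Set.ncard_eq_zero (Set.toFinite _), mem_symmDiff_edgeSet, SimpleGraph.edgeSet_eq_empty] at h
  exact symmDiff_eq_bot.1 h

/-- The first strictness condition in terms of samples. -/
def StrictPairs {m : ℕ} (γ : GraphClass (m + 2) → ℝ) (c : ℝ) (x : PartiteLimit) : Prop :=
  ∀ i₁ ∈ x.suppStar, ∀ i₂ ∈ x.suppStar, c ≤ samp x.x m (pairVal γ i₁ i₂)

theorem exists_error_le {A B ε : ℝ} (hB : 0 ≤ B) (hε : 0 < ε) :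
    ∃ δ > 0, ∃ N : ℕ, 0 < N ∧ ∀ n : ℕ, N ≤ n → ∀ t ≤ δ, A / n + B * t ≤ ε := by
  obtain ⟨N, hN, h⟩ := exists_nat_div_le A (half_pos hε)
  refine ⟨ε / (2 * (B + 1)), by positivity, N, hN, fun n hn t ht => ?_⟩
  have h1 := h n hn
  have h2 : B * t ≤ ε / 2 := by
    calc B * t ≤ B * (ε / (2 * (B + 1))) := mul_le_mul_of_nonneg_left ht hB
      _ ≤ (B + 1) * (ε / (2 * (B + 1))) := mul_le_mul_of_nonneg_right (by linarith) (by positivity)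
      _ = ε / 2 := by field_simp
  linarith

/-- In `H = partGraph p`, spoiling the pair `uv` loses about `c n^m / m!`. Correcting it in `J`
gains nearly as much, since `J ⊕ uv` agrees with `H` on `uv`, `J` agrees with `H ⊕ uv` there, and
the remaining disagreements are few both in total and at `u` and `v`. -/
theorem flip_gain {m : ℕ} (γ : GraphClass (m + 2) → ℝ) {c : ℝ} (hc : 0 < c) :
    ∃ δ > 0, ∃ c₁ > 0, ∃ N : ℕ, 0 < N ∧ ∀ x, StrictPairs γ c x → ∀ n : ℕ, N ≤ n →
      ∀ p : Fin n → ℕ, tv (emp p) x.x ≤ δ → ∀ J : SimpleGraph (Fin n), ∀ u v,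
        p u ∈ x.suppStar → p v ∈ x.suppStar → ¬(J.Adj u v ↔ (partGraph p).Adj u v) →
        (difDeg J (partGraph p) u : ℝ) ≤ δ * n → (difDeg J (partGraph p) v : ℝ) ≤ δ * n →
        (editCount J (partGraph p) : ℝ) ≤ δ * n ^ 2 →
        c₁ * n ^ m ≤ bigLam γ (symmDiff J (SimpleGraph.edge u v)) - bigLam γ J := by
  obtain ⟨M, hM0, hM⟩ := exists_bound γ
  obtain ⟨δ₁, hδ₁, N, hN, hE⟩ := exists_error_le (A := 2 * M * (2 * m + m ^ 2)) (B := 2 * M * m)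
    (by positivity) (half_pos hc)
  -- The second bound makes each of the two comparisons of `J` with `H` cost at most `c / 8`; of the
  -- `c / 2` left after sampling errors, `c / 4` survives.
  set δ := min δ₁ (c / (4 * (4 * M * (2 * m + 2 * m ^ 2) + 1))) with hδ
  have hδ0 : 0 < δ := by positivity
  refine ⟨δ, hδ0, c / (4 * m.factorial), by positivity, N, hN, ?_⟩
  intro x hx n hn p hp J u v hu hv hJ hdu hdv hed
  have hn0 : (0 : ℝ) < n := by exact_mod_cast (by omega : 0 < n)
  have : Nonempty (Fin n) := ⟨⟨0, by omega⟩⟩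
  have huv : u ≠ v := by rintro rfl; simp at hJ
  set H := partGraph p with hH
  have h1 := pair_approx hM p huv x.isDist
  rw [← hH, Fintype.card_fin] at h1
  have h2 := hE n hn _ (hp.trans (min_le_left _ _))
  have h3 := hx _ hu _ hv
  have hnm : (0 : ℝ) < (n : ℝ) ^ m := by positivity
  have h4 : c / 2 * n ^ m ≤
      m.factorial * (bigLam γ H - bigLam γ (symmDiff H (SimpleGraph.edge u v))) := by
    have h5 : 2 * M * ((2 * m + m ^ 2) / n + m * tv (emp p) x.x) =
      2 * M * (2 * m + m ^ 2) / n + 2 * M * m * tv (emp p) x.x := by ring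
    rw [h5] at h1
    rw [← le_div_iff₀ hnm]
    linarith [(abs_le.1 h1).1]
  have inj := pair_injective huv
  have hJ' : ¬(H.Adj u v ↔ J.Adj u v) := fun h => hJ h.symm
  rw [← bigLam_sub γ ![u, v] inj (fun a b h i => by
    rw [flip_adj] at h
    fin_cases i <;> simp <;> tauto)] at h4
  have h6 := bigLam_sub γ ![u, v] inj (G := symmDiff J (SimpleGraph.edge u v)) (G' := J)
    (fun a b h i => by
    rw [flip_adj] at h
    fin_cases i <;> simp <;> tauto)
  have hs : ∀ a b, (a = u ∨ a = v) → (b = u ∨ b = v) →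
      ((symmDiff J (SimpleGraph.edge u v)).Adj a b ↔ H.Adj a b) ∧
      (J.Adj a b ↔ (symmDiff H (SimpleGraph.edge u v)).Adj a b) := by
    intro a b ha hb
    have e1 := flip_dif hJ a b
    have e2 := flip_dif hJ' a b
    by_cases hab : a = b
    · subst hab; simp
    · have : u = a ∧ v = b ∨ u = b ∧ v = a := by
        rcases ha with rfl | rfl <;> rcases hb with rfl | rfl <;> simp_all
      simp only [this, not_true_eq_false, and_false, iff_false, not_not] at e1 e2
      exact ⟨e1, e2.symm⟩
  have m1 : ∀ a, difDeg (symmDiff J (SimpleGraph.edge u v)) H a ≤ difDeg J H a := fun a =>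
    difDeg_mono fun b h => ((flip_dif hJ a b).1 h).1
  have m2 : ∀ a, difDeg J (symmDiff H (SimpleGraph.edge u v)) a ≤ difDeg J H a := fun a => by
    rw [difDeg_comm, difDeg_comm J]
    exact difDeg_mono fun b h => ((flip_dif hJ' a b).1 h).1
  have m3 : editCount (symmDiff J (SimpleGraph.edge u v)) H ≤ editCount J H :=
    editCount_mono fun a b h => ((flip_dif hJ a b).1 h).1
  have m4 : editCount J (symmDiff H (SimpleGraph.edge u v)) ≤ editCount J H := by
    rw [editCount_comm, editCount_comm J]
    exact editCount_mono fun a b h => ((flip_dif hJ' a b).1 h).1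
  have hij : ∀ i : Fin 2, (![u, v] i = u ∨ ![u, v] i = v) := by
    intro i; fin_cases i <;> simp
  have hdeg : ∀ i : Fin 2, (difDeg J H (![u, v] i) : ℝ) ≤ δ * n := by
    intro i; fin_cases i
    · exact hdu
    · exact hdv
  -- Here `e = 2 * δ` because the total error is measured over ordered pairs, which count each edge
  -- twice.
  have h7 := abs_sum_val_sub_le (m := m) hM ![u, v] (G := symmDiff J (SimpleGraph.edge u v)) (H := H)
    (d := δ) (e := 2 * δ) (fun i j => (hs _ _ (hij i) (hij j)).1)
    (fun i => by
      rw [Fintype.card_fin]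
      exact le_trans (by exact_mod_cast m1 _) (hdeg i))
    (by
      rw [Fintype.card_fin]
      have : (editCount (symmDiff J (SimpleGraph.edge u v)) H : ℝ) ≤ editCount J H := by
        exact_mod_cast m3
      linarith)
  have h8 := abs_sum_val_sub_le (m := m) hM ![u, v] (G := J) (H := symmDiff H (SimpleGraph.edge u v))
    (d := δ) (e := 2 * δ) (fun i j => (hs _ _ (hij i) (hij j)).2)
    (fun i => by
      rw [Fintype.card_fin]
      exact le_trans (by exact_mod_cast m2 _) (hdeg i))
    (by
      rw [Fintype.card_fin]
      have : (editCount J (symmDiff H (SimpleGraph.edge u v)) : ℝ) ≤ editCount J H := by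
        exact_mod_cast m4
      linarith)
  rw [Fintype.card_fin] at h7 h8
  push_cast at h7 h8
  have h9 : 4 * M * (2 * m + 2 * m ^ 2) * δ ≤ c / 4 := by
    have : δ ≤ c / (4 * (4 * M * (2 * m + 2 * m ^ 2) + 1)) := min_le_right _ _
    rw [le_div_iff₀ (by positivity)] at this
    nlinarith
  have h10 : 2 * M * ((2 * m * δ + m ^ 2 * (2 * δ)) * n ^ m) ≤ c / 8 * n ^ m := by
    have := mul_le_mul_of_nonneg_right h9 hnm.le
    nlinarith
  have h11 : c / 4 * n ^ m ≤ m.factorial *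
      (bigLam γ (symmDiff J (SimpleGraph.edge u v)) - bigLam γ J) := by
    rw [← h6]
    linarith [(abs_le.1 h7).1, (abs_le.1 h8).2]
  have hf : (0 : ℝ) < m.factorial := by positivity
  calc c / (4 * m.factorial) * n ^ m = (c / 4 * n ^ m) / m.factorial := by field_simp
    _ ≤ _ := by rw [div_le_iff₀ hf]; linarith

/-- `K` arises from `J` by correcting some of its wrong pairs. Each correction shrinks the set of
disagreements with `partGraph p`, so the hypotheses of `flip_gain` persist and its gains add up. -/
theorem flips_gain {m : ℕ} (γ : GraphClass (m + 2) → ℝ) {c : ℝ} (hc : 0 < c) :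
    ∃ δ > 0, ∃ c₁ > 0, ∃ N : ℕ, 0 < N ∧ ∀ x, StrictPairs γ c x → ∀ n : ℕ, N ≤ n →
      ∀ p : Fin n → ℕ, tv (emp p) x.x ≤ δ → ∀ J K : SimpleGraph (Fin n),
        (∀ a b, ¬(J.Adj a b ↔ K.Adj a b) → ¬(J.Adj a b ↔ (partGraph p).Adj a b)) →
        (∀ a b, ¬(J.Adj a b ↔ K.Adj a b) →
          p a ∈ x.suppStar ∧ (difDeg J (partGraph p) a : ℝ) ≤ δ * n) →
        (editCount J (partGraph p) : ℝ) ≤ δ * n ^ 2 →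
        c₁ * editCount J K * n ^ m ≤ bigLam γ K - bigLam γ J := by
  obtain ⟨δ, hδ, c₁, hc₁, N, hN, h⟩ := flip_gain γ hc
  refine ⟨δ, hδ, c₁, hc₁, N, hN, ?_⟩
  intro x hx n hn p hp J K
  induction ht : editCount J K generalizing J with
  | zero =>
    intro _ _ _
    rw [eq_of_editCount_eq_zero ht]
    simp
  | succ t ih =>
    intro h1 h2 h3
    have hne : J ≠ K := by
      rintro rfl
      simp [editCount] at ht
    obtain ⟨u, v, huv⟩ : ∃ u v, ¬(J.Adj u v ↔ K.Adj u v) := by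
      by_contra hcon
      push Not at hcon
      exact hne (by ext u v; exact hcon u v)
    have hvu : ¬(J.Adj v u ↔ K.Adj v u) := by rwa [J.adj_comm, K.adj_comm]
    have hH := h1 u v huv
    have g := h x hx n hn p hp J u v (h2 u v huv).1 (h2 v u hvu).1 hH (h2 u v huv).2
      (h2 v u hvu).2 h3
    have hcount := editCount_flip huv
    have m1 : ∀ a, difDeg (symmDiff J (SimpleGraph.edge u v)) (partGraph p) a ≤
        difDeg J (partGraph p) a := fun a =>
      difDeg_mono fun b h => ((flip_dif hH a b).1 h).1
    have m3 : editCount (symmDiff J (SimpleGraph.edge u v)) (partGraph p) ≤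
        editCount J (partGraph p) := editCount_mono fun a b h => ((flip_dif hH a b).1 h).1
    have g2 := ih (symmDiff J (SimpleGraph.edge u v)) (by omega)
      (fun a b hab => by
        have := (flip_dif huv a b).1 hab
        exact (flip_dif hH a b).2 ⟨h1 a b this.1, this.2⟩)
      (fun a b hab => by
        have := (flip_dif huv a b).1 hab
        refine ⟨(h2 a b this.1).1, le_trans ?_ (h2 a b this.1).2⟩
        exact_mod_cast m1 a)
      (le_trans (by exact_mod_cast m3) h3)
    push_cast
    linarith

/-! ## Vertices that fit into no class -/

/-- The second strictness condition in terms of samples. -/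
def StrictVertex {m : ℕ} (γ : GraphClass (m + 1) → ℝ) (c : ℝ) (x : PartiteLimit) : Prop :=
  ∀ (b : ℕ → Bool) (α : ℝ), 0 ≤ α → α ≤ 1 → (x.x 0 = 0 → α = 1) →
    c * ((1 - α) * x.x 0 + ⨅ i : x.suppStar, wt x b i) ≤
      samp (mixq x.x (eFun 1) 1) m (starVal γ) - samp (mixq x.x b α) m (starVal γ)

/-- The class to which vertices that fit nowhere are assigned. -/
def PartiteLimit.star (x : PartiteLimit) : ℕ := if 0 < x.x 1 then 1 else 0

theorem PartiteLimit.eq_zero_of_star {x : PartiteLimit} (h : ¬ 0 < x.x 1) {i : ℕ} (hi : i ≠ 0) :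
    x.x i = 0 :=
  le_antisymm ((x.anti 1 i le_rfl (Nat.one_le_iff_ne_zero.2 hi)).trans (not_lt.1 h)) (x.nonneg i)

theorem PartiteLimit.star_mem (x : PartiteLimit) : x.star ∈ x.suppStar := by
  unfold star
  split_ifs with h
  · exact h
  · have h1 : HasSum x.x (x.x 0) := hasSum_single 0 fun i hi => x.eq_zero_of_star h hi
    have := h1.unique x.hasSum
    change 0 < x.x 0
    rw [this]; norm_num

/-- If `x₁ = 0`, monotonicity puts all the mass on class `0`, and attaching by `e₁` or by `e₀` means
joining to everything. -/
theorem mixq_star (x : PartiteLimit) : mixq x.x (eFun x.star) 1 = mixq x.x (eFun 1) 1 := by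
  unfold PartiteLimit.star
  split_ifs with h
  · rfl
  · funext t
    unfold mixq
    by_cases ht : t.1 = 0
    · simp [ht]
    · simp [ht, x.eq_zero_of_star h ht]

theorem wt_nonneg (x : PartiteLimit) (b : ℕ → Bool) (i : ℕ) : 0 ≤ wt x b i := by
  unfold wt
  refine add_nonneg ?_ (tsum_nonneg fun j => ?_)
  · split_ifs
    · exact x.nonneg i
    · exact le_rfl
  · split_ifs
    · exact x.nonneg j
    · exact le_rfl

theorem attach_approx {m : ℕ} {γ : GraphClass (m + 1) → ℝ} {M : ℝ} (hM : ∀ c, |γ c| ≤ M)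
    {x : PartiteLimit} {n : ℕ} (hn : 0 < n) (p : Fin n → ℕ) (z : Fin n) (S : SimpleGraph (Fin n))
    (hS : ∀ u v, u ≠ z → v ≠ z → (S.Adj u v ↔ (partGraph p).Adj u v)) {b : ℕ → Bool} {α : ℝ}
    (h0 : 0 ≤ α) (h1 : α ≤ 1) (hb : ∀ u, u ≠ z → p u ≠ 0 → (S.Adj z u ↔ b (p u) = true))
    (hα : |((Finset.univ.filter fun u => p u = 0 ∧ S.Adj z u).card : ℝ) -
      α * (Finset.univ.filter fun u => p u = 0).card| ≤ 2) :
    |(∑ f ∈ injExt m ![z], val γ S (Fin.append f ![z])) / (n : ℝ) ^ m -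
      samp (mixq x.x b α) m (starVal γ)| ≤
      M * (m + m ^ 2 + 6 * m) / n + M * m * tv (emp p) x.x := by
  have hn0 : (0 : ℝ) < n := by exact_mod_cast hn
  have : Nonempty (Fin n) := ⟨⟨0, hn⟩⟩
  have hM0 : 0 ≤ M := (abs_nonneg _).trans (hM (Quotient.mk _ ⊥))
  -- `S.Adj z z` is false, which may contradict `b`; so the value at `z` is set to `b (p z)`. This
  -- changes the count in class `0` by at most one, raising the tolerance from `2` to `3`.
  let β : Fin n → Bool := fun u => if u = z then b (p z) else decide (S.Adj z u)
  have h := star_approx hM p z S hS (fun u => (p u, β u)) (fun u hu => by simp [β, hu])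
    (mixq_isDist x.isDist b h0 h1)
  rw [Fintype.card_fin] at h
  refine h.trans ?_
  have h2 := tv_emp_mixq p β b (α := α) (fun u hu => by
      by_cases huz : u = z
      · simp [β, huz]
      · simp only [β, huz, if_false]
        rw [Bool.eq_iff_iff, decide_eq_true_iff]
        exact hb u huz hu) (by
    have c1 : (Finset.univ.filter fun u => p u = 0 ∧ S.Adj z u).card ≤
        (Finset.univ.filter fun u => p u = 0 ∧ β u = true).card := by
      refine Finset.card_le_card fun u hu => ?_
      simp only [Finset.mem_filter, Finset.mem_univ, true_and] at hu ⊢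
      have : u ≠ z := hu.2.ne'
      simp [β, this, hu]
    have c2 : (Finset.univ.filter fun u => p u = 0 ∧ β u = true).card ≤
        (Finset.univ.filter fun u => p u = 0 ∧ S.Adj z u).card + 1 := by
      refine (Finset.card_le_card fun u hu => ?_).trans (Finset.card_insert_le z _)
      simp only [Finset.mem_insert, Finset.mem_filter, Finset.mem_univ, true_and] at hu ⊢
      by_cases huz : u = z
      · exact Or.inl huz
      · simp only [β, huz, if_false, decide_eq_true_eq] at hu
        exact Or.inr hu
    have c1' : ((Finset.univ.filter fun u => p u = 0 ∧ S.Adj z u).card : ℝ) ≤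
        (Finset.univ.filter fun u => p u = 0 ∧ β u = true).card := by exact_mod_cast c1
    have c2' : ((Finset.univ.filter fun u => p u = 0 ∧ β u = true).card : ℝ) ≤
        (Finset.univ.filter fun u => p u = 0 ∧ S.Adj z u).card + 1 := by exact_mod_cast c2
    rw [abs_le] at hα ⊢
    constructor <;> linarith [hα.1, hα.2])
  rw [Fintype.card_fin] at h2
  have h3 := tv_mixq (emp_isDist p) x.isDist b h0 h1
  have h6 := tv_triangle (emp_isDist fun u => (p u, β u)) (mixq_isDist (emp_isDist p) b h0 h1)
    (mixq_isDist x.isDist b h0 h1)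
  have h7 : tv (emp fun u => (p u, β u)) (mixq x.x b α) ≤ 6 / n + tv (emp p) x.x := by linarith
  calc _ ≤ M * ((m + m ^ 2) / n + m * (6 / n + tv (emp p) x.x)) := by gcongr
    _ = _ := by ring

theorem reassign_adj_off {V : Type*} [DecidableEq V] (p : V → ℕ) (z : V) (i : ℕ) {u v : V} (hu : u ≠ z)
    (hv : v ≠ z) : (partGraph (Function.update p z i)).Adj u v ↔ (partGraph p).Adj u v := by
  simp [partGraph_adj, hu, hv]

theorem reassign_adj {V : Type*} [DecidableEq V] (p : V → ℕ) (z : V) (i : ℕ) {u : V} (hu : u ≠ z) :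
    (partGraph (Function.update p z i)).Adj z u ↔ (i ≠ p u ∨ i = 0) := by
  simp [partGraph_adj, hu, Ne.symm hu]

/-- A vertex placed in class `i` is attached according to `e_i` with `α = 1`, up to the vertex `z`
itself. This also covers the clique class `i = 0`. -/
theorem reassign_approx {m : ℕ} {γ : GraphClass (m + 1) → ℝ} {M : ℝ} (hM : ∀ c, |γ c| ≤ M)
    {x : PartiteLimit} {n : ℕ} (hn : 0 < n) (p : Fin n → ℕ) (z : Fin n) (i : ℕ) :
    |(∑ f ∈ injExt m ![z], val γ (partGraph (Function.update p z i)) (Fin.append f ![z])) /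
        (n : ℝ) ^ m - samp (mixq x.x (eFun i) 1) m (starVal γ)| ≤
      M * (m + m ^ 2 + 6 * m) / n + M * m * tv (emp p) x.x := by
  refine attach_approx hM hn p z _ (fun u v hu hv => reassign_adj_off p z i hu hv) zero_le_one le_rfl
    (fun u hu hpu => ?_) ?_
  · rw [reassign_adj p z i hu]
    simp only [eFun, decide_eq_true_eq]
    grind
  · have c1 : (Finset.univ.filter fun u => p u = 0 ∧
        (partGraph (Function.update p z i)).Adj z u).card ≤
        (Finset.univ.filter fun u => p u = 0).card := by
      refine Finset.card_le_card fun u hu => ?_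
      simp only [Finset.mem_filter, Finset.mem_univ, true_and] at hu ⊢
      exact hu.1
    have c2 : (Finset.univ.filter fun u => p u = 0).card ≤ (Finset.univ.filter fun u => p u = 0 ∧
        (partGraph (Function.update p z i)).Adj z u).card + 1 := by
      refine (Finset.card_le_card fun u hu => ?_).trans (Finset.card_insert_le z _)
      simp only [Finset.mem_insert, Finset.mem_filter, Finset.mem_univ, true_and] at hu ⊢
      by_cases huz : u = z
      · exact Or.inl huz
      · refine Or.inr ⟨hu, ?_⟩
        rw [reassign_adj p z i huz, hu]
        tauto
    have c1' : ((Finset.univ.filter fun u => p u = 0 ∧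
        (partGraph (Function.update p z i)).Adj z u).card : ℝ) ≤
        (Finset.univ.filter fun u => p u = 0).card := by exact_mod_cast c1
    have c2' : ((Finset.univ.filter fun u => p u = 0).card : ℝ) ≤
        (Finset.univ.filter fun u => p u = 0 ∧
        (partGraph (Function.update p z i)).Adj z u).card + 1 := by exact_mod_cast c2
    rw [abs_le]
    constructor <;> linarith

/-- The number of pairs at `z` that are wrong for the class `i`, in terms of the limit. -/
theorem difDeg_reassign_le {x : PartiteLimit} {n : ℕ} (hn : 0 < n) (p : Fin n → ℕ) (z : Fin n)
    (S : SimpleGraph (Fin n)) {b : ℕ → Bool} {α : ℝ}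
    (h0 : 0 ≤ α) (h1 : α ≤ 1) (hb : ∀ u, u ≠ z → p u ≠ 0 → (S.Adj z u ↔ b (p u) = true))
    (hα : ((Finset.univ.filter fun u => p u = 0 ∧ S.Adj z u).card : ℝ) =
      α * (Finset.univ.filter fun u => p u = 0).card) (i : ℕ) :
    (difDeg S (partGraph (Function.update p z i)) z : ℝ) ≤
      ((1 - α) * x.x 0 + wt x b i + tv (emp p) x.x) * n := by
  have hn0 : (0 : ℝ) < n := by exact_mod_cast hn
  have : Nonempty (Fin n) := ⟨⟨0, hn⟩⟩
  -- `h j` is the proportion of class `j` that is wrongly attached if `z` is to belong to class `i`: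
  -- non-neighbours in class `0`, neighbours in class `i ≥ 1`, non-neighbours in the other classes.
  let h : ℕ → ℝ := fun j => (if j = 0 then 1 - α else 0) + ((if j = i ∧ 0 < i ∧ b i = true then 1 else 0) +
    if j ≠ 0 ∧ j ≠ i ∧ b j = false then 1 else 0)
  have hh : ∀ j, |h j| ≤ 1 := by
    intro j
    simp only [h]
    rw [abs_le]
    by_cases hj : j = 0
    · subst hj
      rw [if_pos rfl, if_neg (by omega), if_neg (by simp)]
      constructor <;> linarith
    · by_cases hji : j = i
      · subst hji
        rw [if_neg hj]
        split_ifs <;> simp_all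
      · rw [if_neg hj]
        split_ifs <;> simp_all
  have e1 : HasSum (fun j => x.x j * h j) ((1 - α) * x.x 0 + wt x b i) := by
    have s1 : HasSum (fun j => if j = 0 then (1 - α) * x.x 0 else 0) ((1 - α) * x.x 0) :=
      hasSum_ite_eq 0 _
    have s2 : HasSum (fun j => if j = i then (if 0 < i ∧ b i = true then x.x i else 0) else 0)
        (if 0 < i ∧ b i = true then x.x i else 0) := hasSum_ite_eq i _
    have s3 : Summable fun j : ℕ => if j ∈ x.suppStar \ {0, i} ∧ b j = false then x.x j else 0 := by
      refine Summable.of_nonneg_of_le (fun j => ?_) (fun j => ?_) x.hasSum.summable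
      · split_ifs
        · exact x.nonneg j
        · exact le_rfl
      · split_ifs
        · exact le_rfl
        · exact x.nonneg j
    have s4 := s1.add (s2.add s3.hasSum)
    have : (fun j => x.x j * h j) = fun j => (if j = 0 then (1 - α) * x.x 0 else 0) +
        ((if j = i then (if 0 < i ∧ b i = true then x.x i else 0) else 0) +
        if j ∈ x.suppStar \ {0, i} ∧ b j = false then x.x j else 0) := by
      funext j
      simp only [h, mul_add]
      congr 1
      · split_ifs with hj
        · rw [hj]; ring
        · ring
      congr 1
      · by_cases hj : j = i
        · subst hj; simp
        · simp [hj]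
      · by_cases hj : 0 < x.x j
        · have : j ∈ x.suppStar := hj
          simp [this, and_assoc]
        · have : x.x j = 0 := le_antisymm (not_lt.1 hj) (x.nonneg j)
          simp [this]
    rw [this]
    convert s4 using 1
    unfold wt
    congr!
  -- Estimating with a single sample exchanges the average of `h` over the vertices for its average
  -- under `x`.
  have e2 := samp_sub_le (emp_isDist p) x.isDist 1 (fun f => h (f 0)) (fun f => hh _)
  simp only [samp, Fin.cons_zero] at e2
  rw [e1.tsum_eq, (emp_hasSum_mul p h).tsum_eq, Fintype.card_fin] at e2
  have e3 : (∑ v, h (p v)) ≤ ((1 - α) * x.x 0 + wt x b i + tv (emp p) x.x) * n := by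
    rw [← div_le_iff₀ hn0]
    push_cast at e2
    linarith [(abs_le.1 e2).2]
  refine le_trans ?_ e3
  have e4 : ∑ v, h (p v) = (∑ v, if p v = 0 ∧ ¬ S.Adj z v then (1 : ℝ) else 0) +
      ∑ v, ((if p v = i ∧ 0 < i ∧ b i = true then (1 : ℝ) else 0) +
      if p v ≠ 0 ∧ p v ≠ i ∧ b (p v) = false then 1 else 0) := by
    simp only [h]
    rw [Finset.sum_add_distrib]
    congr 1
    have t1 : ((Finset.univ.filter fun u => p u = 0 ∧ S.Adj z u).card : ℝ) +
        ((Finset.univ.filter fun u => p u = 0 ∧ ¬S.Adj z u).card : ℝ) =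
        (Finset.univ.filter fun u => p u = 0).card := by
      have t := Finset.card_filter_add_card_filter_not (s := Finset.univ.filter fun u => p u = 0)
        (fun u => S.Adj z u)
      rw [Finset.filter_filter, Finset.filter_filter] at t
      exact_mod_cast t
    rw [← Finset.sum_filter, ← Finset.sum_filter, Finset.sum_const, Finset.sum_const,
      nsmul_eq_mul, nsmul_eq_mul]
    linarith
  rw [e4, ← Finset.sum_add_distrib, difDeg, Finset.card_filter]
  push_cast
  refine Finset.sum_le_sum fun u _ => ?_
  have nn : (0 : ℝ) ≤ (if p u = 0 ∧ ¬ S.Adj z u then (1 : ℝ) else 0) +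
      ((if p u = i ∧ 0 < i ∧ b i = true then (1 : ℝ) else 0) +
      if p u ≠ 0 ∧ p u ≠ i ∧ b (p u) = false then 1 else 0) := by positivity
  by_cases hu : ¬(S.Adj z u ↔ (partGraph (Function.update p z i)).Adj z u)
  · rw [if_pos hu]
    by_cases huz : u = z
    · subst huz; simp at hu
    rw [reassign_adj p z i huz] at hu
    have q1 : (0 : ℝ) ≤ if p u = 0 ∧ ¬ S.Adj z u then (1 : ℝ) else 0 := by positivity
    have q2 : (0 : ℝ) ≤ if p u = i ∧ 0 < i ∧ b i = true then (1 : ℝ) else 0 := by positivity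
    have q3 : (0 : ℝ) ≤ if p u ≠ 0 ∧ p u ≠ i ∧ b (p u) = false then (1 : ℝ) else 0 := by positivity
    by_cases hp0 : p u = 0
    · have : ¬ S.Adj z u := by
        intro h; apply hu; simp [h, hp0]; tauto
      rw [if_pos ⟨hp0, this⟩]
      linarith
    · have hbu := hb u huz hp0
      by_cases hpi : p u = i
      · have hi0 : 0 < i := by omega
        have : b i = true := by
          rw [← hpi, ← hbu]
          by_contra hc
          apply hu
          simp only [hc, false_iff]
          omega
        rw [if_pos (show p u = i ∧ 0 < i ∧ b i = true from ⟨hpi, hi0, this⟩)]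
        linarith
      · have : b (p u) = false := by
          rw [← Bool.not_eq_true, ← hbu]
          intro hc
          apply hu
          simp only [hc, true_iff]
          exact Or.inl (Ne.symm hpi)
        rw [if_pos (show p u ≠ 0 ∧ p u ≠ i ∧ b (p u) = false from ⟨hp0, hpi, this⟩)]
        linarith
  · rw [if_neg hu]
    exact nn

theorem lam_le_iff {k : ℕ} (γ : GraphClass k → ℝ) {n : ℕ} (hn : k ≤ n) (G H : SimpleGraph (Fin n)) :
    lam γ G ≤ lam γ H ↔ bigLam γ G ≤ bigLam γ H := by
  have : (0 : ℝ) < (n.choose k : ℝ) := by exact_mod_cast Nat.choose_pos hn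
  simp only [lam, Fintype.card_fin]
  exact div_le_div_iff_of_pos_right this

theorem bigLam_sub_of_off {m : ℕ} (γ : GraphClass (m + 1) → ℝ) {n : ℕ} (z : Fin n)
    {G H : SimpleGraph (Fin n)} (h : ∀ u v, u ≠ z → v ≠ z → (G.Adj u v ↔ H.Adj u v)) :
    ∑ f ∈ injExt m ![z], val γ G (Fin.append f ![z]) -
      ∑ f ∈ injExt m ![z], val γ H (Fin.append f ![z]) =
      m.factorial * (bigLam γ G - bigLam γ H) := by
  refine bigLam_sub γ ![z] (Function.injective_of_subsingleton _) fun u v huv i => ?_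
  fin_cases i
  by_contra hc
  simp only [Fin.zero_eta, Matrix.cons_val_zero, not_or] at hc
  exact huv (h u v (Ne.symm hc.1) (Ne.symm hc.2))

/-- A sequence of graphs given by the second symmetrisation condition. -/
theorem exists_vertex_symmetrisation {k : ℕ} {γ : GraphClass k → ℝ} (hsym : Symmetrisable γ) {ε : ℝ}
    (hε : 0 < ε) : ∃ N : ℕ, 0 < N ∧ ∀ n : ℕ, N ≤ n → ∀ (p : Fin n → ℕ) (z : Fin n)
      (S : SimpleGraph (Fin n)), (∀ u v, u ≠ z → v ≠ z → (S.Adj u v ↔ (partGraph p).Adj u v)) →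
      ∃ (l : ℕ) (T : ℕ → SimpleGraph (Fin n)), T 0 = S ∧
        (∀ i ≤ l, ∀ u v, u ≠ z → v ≠ z → ((T i).Adj u v ↔ (partGraph p).Adj u v)) ∧
        (∀ i < l, bigLam γ (T i) ≤ bigLam γ (T (i + 1)) ∧
          (editCount (T i) (T (i + 1)) : ℝ) ≤ ε * n) ∧
        ∀ u v, u ≠ z → v ≠ z → p u ≠ 0 → p u = p v → ((T l).Adj z u ↔ (T l).Adj z v) := by
  obtain ⟨N, hN, h⟩ := hsym ε hε
  -- Requiring `n ≥ k` makes the binomial coefficient positive, so that `λ` and `Λ` order graphs in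
  -- the same way.
  refine ⟨N + k, by omega, fun n hn p z S hS => ?_⟩
  have hz : (S.induce {z}ᶜ).IsCompleteMultipartite := by
    refine ⟨fun u v w h1 h2 => ?_⟩
    simp only [SimpleGraph.comap_adj, Function.Embedding.subtype_apply] at h1 h2 ⊢
    rw [hS _ _ u.2 v.2] at h1
    rw [hS _ _ v.2 w.2] at h2
    rw [hS _ _ u.2 w.2]
    exact (partGraph_isCompleteMultipartite p).trans _ _ _ h1 h2
  obtain ⟨l, T, h0, h1, h2, h3⟩ := (h n (by omega) S).2 z hz
  refine ⟨l, T, h0, fun i hi u v hu hv => ?_, fun i hi => ⟨?_, ?_⟩, fun u v hu hv hpu huv => ?_⟩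
  · rw [← hS u v hu hv]
    have := congrArg (fun G : SimpleGraph ({z}ᶜ : Set (Fin n)) => G.Adj ⟨u, hu⟩ ⟨v, hv⟩) (h1 i hi)
    simpa using this
  · exact (lam_le_iff γ (by omega) _ _).1 (h2 i hi).1
  · refine (h2 i hi).2.trans ?_
    nlinarith
  -- The parts of `S - z` are its non-adjacency classes. Two vertices of the same class `≥ 1` share
  -- a part, while each vertex of the clique class is a part by itself; hence the restriction `p u ≠
  -- 0`.
  · have hP := hz.setoid.mem_classes ⟨u, hu⟩
    have hu' : (⟨u, hu⟩ : ({z}ᶜ : Set (Fin n))) ∈ {x | hz.setoid x ⟨u, hu⟩} := hz.setoid.refl' _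
    have hv' : (⟨v, hv⟩ : ({z}ᶜ : Set (Fin n))) ∈ {x | hz.setoid x ⟨u, hu⟩} := by
      change ¬ S.Adj v u
      rw [hS v u hv hu, partGraph_adj]
      rintro ⟨-, h | h⟩
      · exact h huv.symm
      · exact hpu (huv.trans h)
    rcases h3 _ hP with h | h
    · exact ⟨fun _ => h _ hv', fun _ => h _ hu'⟩
    · exact ⟨fun h' => absurd h' (h _ hu'), fun h' => absurd h' (h _ hv')⟩

-- Symmetrise at `z`. Either some graph on the way has fewer than `θ n` wrong pairs at `z` for some
-- class `i`, or the final graph has at least `θ n` for every class in the support. In the first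
-- case, the first such graph still has at least `θ n / 2` wrong pairs; correcting them gains order
-- `n^(m+1)`, and then moving `z` from class `i` to the class `x.star` loses almost nothing by
-- strictness. In the second case, the second strictness condition applies to the final
-- neighbourhood with a weight bounded below.
set_option maxHeartbeats 1000000 in
theorem misfit_loss {m : ℕ} {γ : GraphClass (m + 2) → ℝ} (hsym : Symmetrisable γ) {c : ℝ}
    (hc : 0 < c) {δ₁ : ℝ} (hδ₁ : 0 < δ₁) :
    ∃ c₂ > 0, ∃ δ₂ > 0, ∃ N : ℕ, 0 < N ∧ ∀ x : PartiteLimit, StrictPairs γ c x →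
      StrictVertex (m := m + 1) γ c x → ∀ n : ℕ, N ≤ n → ∀ p : Fin n → ℕ,
      (∀ v, p v ∈ x.suppStar) → tv (emp p) x.x ≤ δ₂ → ∀ z, p z = x.star → ∀ S : SimpleGraph (Fin n),
      (∀ u v, u ≠ z → v ≠ z → (S.Adj u v ↔ (partGraph p).Adj u v)) →
      (∀ i ∈ x.suppStar, δ₁ * n ≤ difDeg S (partGraph (Function.update p z i)) z) →
      c₂ * n ^ (m + 1) ≤ bigLam γ (partGraph p) - bigLam γ S := by
  obtain ⟨M, hM0, hM⟩ := exists_bound γ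
  obtain ⟨δ₃, hδ₃, c₁, hc₁, N₁, hN₁, hflip⟩ := flips_gain γ hc
  set θ := min δ₁ δ₃ with hθ
  have hθ0 : 0 < θ := by positivity
  have hθ1 : θ ≤ δ₁ := min_le_left _ _
  have hθ3 : θ ≤ δ₃ := min_le_right _ _
  obtain ⟨N₂, hN₂, hS2⟩ := exists_vertex_symmetrisation hsym (half_pos hθ0)
  have hF : (0 : ℝ) < (m + 1).factorial := by positivity
  have hF1 : (1 : ℝ) ≤ (m + 1).factorial := by exact_mod_cast Nat.factorial_pos _
  -- Each comparison with the limit has error `η` and two are made in either case, so half of the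
  -- main terms `c * θ / 2` and `c₁ * θ / 2` remains.
  set η := min (c * θ / 8) (c₁ * θ / 8) with hη
  have hη0 : 0 < η := by positivity
  obtain ⟨δ₄, hδ₄, N₃, hN₃, herr⟩ := exists_error_le
    (A := M * ((m + 1 : ℕ) + (m + 1 : ℕ) ^ 2 + 6 * (m + 1 : ℕ))) (B := M * (m + 1 : ℕ))
    (by positivity) hη0
  obtain ⟨N₄, hN₄, h4⟩ := exists_nat_div_le 2 (half_pos hδ₃)
  obtain ⟨N₅, hN₅, h5⟩ := exists_nat_div_le 1 hδ₃
  refine ⟨min (c * θ / (4 * (m + 1).factorial)) (c₁ * θ / 4), by positivity,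
    min (min δ₄ (θ / 2)) (δ₃ / 2), by positivity, N₁ + N₂ + N₃ + N₄ + N₅, by omega, ?_⟩
  intro x hx1 hx2 n hn p hps htv z hpz S hS hbad
  have hn0 : 0 < n := by omega
  have hnR : (0 : ℝ) < n := by exact_mod_cast hn0
  have hne : Nonempty (Fin n) := ⟨z⟩
  have hnm : (0 : ℝ) < (n : ℝ) ^ (m + 1) := by positivity
  have htv4 : tv (emp p) x.x ≤ δ₄ := htv.trans ((min_le_left _ _).trans (min_le_left _ _))
  have htvθ : tv (emp p) x.x ≤ θ / 2 := htv.trans ((min_le_left _ _).trans (min_le_right _ _))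
  have htv3 : tv (emp p) x.x ≤ δ₃ / 2 := htv.trans (min_le_right _ _)
  have hE := herr n (by omega) _ htv4
  have hstar := reassign_approx (m := m + 1) hM (x := x) hn0 p z x.star
  rw [mixq_star, ← hpz, Function.update_eq_self] at hstar
  obtain ⟨l, T, hT0, hToff, hTstep, hTl⟩ := hS2 n (by omega) p z S hS
  have hmono : ∀ j ≤ l, bigLam γ S ≤ bigLam γ (T j) := by
    intro j
    induction j with
    | zero => intro _; rw [hT0]
    | succ j ih => intro hj; exact (ih (by omega)).trans (hTstep j (by omega)).1
  by_cases hcase : ∃ j, j ≤ l ∧ ∃ i ∈ x.suppStar,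
      (difDeg (T j) (partGraph (Function.update p z i)) z : ℝ) < θ * n
  · set j := Nat.find hcase with hj
    obtain ⟨hjl, i, hi, hji⟩ := Nat.find_spec hcase
    rw [← hj] at hjl hji
    have hj0 : j ≠ 0 := by
      intro h0
      rw [h0, hT0] at hji
      have := hbad i hi
      nlinarith
    obtain ⟨j', hj'⟩ := Nat.exists_eq_succ_of_ne_zero hj0
    have hprev : θ * n ≤ difDeg (T j') (partGraph (Function.update p z i)) z := by
      by_contra hlt
      exact Nat.find_min hcase (show j' < j by omega) ⟨by omega, i, hi, not_le.1 hlt⟩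
    have hstep := (hTstep j' (by omega)).2
    rw [show j' + 1 = j from hj'.symm] at hstep
    set K := partGraph (Function.update p z i) with hK
    -- The preceding graph had at least `θ n` wrong pairs, and one symmetrisation step changes at
    -- most `θ n / 2` pairs.
    have hlow : θ / 2 * n ≤ difDeg (T j) K z := by
      have h1 : (difDeg (T j') K z : ℝ) ≤ difDeg (T j') (T j) z + difDeg (T j) K z := by
        exact_mod_cast difDeg_triangle _ _ _ _
      have h2 : (difDeg (T j') (T j) z : ℝ) ≤ editCount (T j') (T j) := by
        exact_mod_cast difDeg_le_editCount _ _ _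
      linarith
    have hoff : ∀ u v, u ≠ z → v ≠ z → ((T j).Adj u v ↔ K.Adj u v) := fun u v hu hv => by
      rw [hToff j hjl u v hu hv, hK, reassign_adj_off p z i hu hv]
    have hdeg1 : ∀ a, a ≠ z → difDeg (T j) K a ≤ 1 := by
      intro a ha
      rw [difDeg, ← Finset.card_singleton z]
      refine Finset.card_le_card fun u hu => ?_
      simp only [Finset.mem_filter, Finset.mem_univ, true_and, Finset.mem_singleton] at hu ⊢
      by_contra huz
      exact hu (hoff a u ha huz)
    have h1n : (1 : ℝ) ≤ δ₃ * n := by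
      have := h5 n (by omega)
      rwa [div_le_iff₀ hnR] at this
    have hdeg : ∀ a, (difDeg (T j) K a : ℝ) ≤ δ₃ * n := by
      intro a
      by_cases ha : a = z
      · rw [ha]
        exact hji.le.trans (mul_le_mul_of_nonneg_right hθ3 hnR.le)
      · exact le_trans (by exact_mod_cast hdeg1 a ha) h1n
    have hcount : (editCount (T j) K : ℝ) ≤ δ₃ * n ^ 2 := by
      have h1 : (2 * editCount (T j) K : ℝ) = ∑ a, (difDeg (T j) K a : ℝ) := by
        exact_mod_cast (sum_difDeg (T j) K).symm
      have h2 : ∑ a, (difDeg (T j) K a : ℝ) ≤ ∑ a : Fin n, δ₃ * n :=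
        Finset.sum_le_sum fun a _ => hdeg a
      simp only [Finset.sum_const, Finset.card_univ, Fintype.card_fin, nsmul_eq_mul] at h2
      have h3 : (0 : ℝ) ≤ editCount (T j) K := by positivity
      nlinarith
    have htvK : tv (emp (Function.update p z i)) x.x ≤ δ₃ := by
      have h1 := tv_triangle (emp_isDist (Function.update p z i)) (emp_isDist p) x.isDist
      have h2 := tv_emp_le_card (Function.update p z i) p
      have h3 : (Finset.univ.filter fun v => Function.update p z i v ≠ p v).card ≤ 1 := by
        rw [← Finset.card_singleton z]
        refine Finset.card_le_card fun u hu => ?_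
        simp only [Finset.mem_filter, Finset.mem_univ, true_and, Finset.mem_singleton] at hu ⊢
        by_contra huz
        exact hu (Function.update_of_ne huz _ _)
      have h4' := h4 n (by omega)
      rw [Fintype.card_fin] at h2
      have h6 : 2 * ((Finset.univ.filter fun v => Function.update p z i v ≠ p v).card : ℝ) / n ≤
          2 / n := by
        have : ((Finset.univ.filter fun v => Function.update p z i v ≠ p v).card : ℝ) ≤ 1 := by
          exact_mod_cast h3
        gcongr
        linarith
      linarith
    have hgain := hflip x hx1 n (by omega) (Function.update p z i) htvK (T j) K (fun a b h => h)
      (fun a b _ => ⟨by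
        by_cases ha : a = z
        · rw [ha, Function.update_self]; exact hi
        · rw [Function.update_of_ne ha]; exact hps a, hdeg a⟩) hcount
    have hKi := reassign_approx (m := m + 1) hM (x := x) hn0 p z i
    -- Only non-negativity of the right-hand side of strictness is used here: no class is
    -- asymptotically better for `z` than `x.star`.
    have hstr := hx2 (eFun i) 1 zero_le_one le_rfl (fun _ => rfl)
    have hstr0 : 0 ≤ c * ((1 - 1) * x.x 0 + ⨅ i' : x.suppStar, wt x (eFun i) i') := by
      have : 0 ≤ ⨅ i' : x.suppStar, wt x (eFun i) i' := Real.iInf_nonneg fun _ => wt_nonneg _ _ _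
      rw [sub_self, zero_mul, zero_add]
      positivity
    have hdiff := bigLam_sub_of_off (m := m + 1) γ z (G := partGraph p) (H := K)
      (fun u v hu hv => (reassign_adj_off p z i hu hv).symm)
    have h7 : -(2 * η) * (n : ℝ) ^ (m + 1) ≤
        (m + 1).factorial * (bigLam γ (partGraph p) - bigLam γ K) := by
      rw [← hdiff, ← le_div_iff₀ hnm, sub_div]
      linarith [(abs_le.1 hstar).1, (abs_le.1 hKi).2]
    -- The lower bound is non-positive and `(m + 1)! ≥ 1`, so dividing by the factorial is harmless.
    have h8 : -(2 * η) * (n : ℝ) ^ (m + 1) ≤ bigLam γ (partGraph p) - bigLam γ K := by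
      by_contra hlt
      push Not at hlt
      have h0 : -(2 * η) * (n : ℝ) ^ (m + 1) ≤ 0 := by
        have : 0 ≤ 2 * η * (n : ℝ) ^ (m + 1) := by positivity
        linarith
      nlinarith
    have h9 : c₁ * θ / 2 * (n : ℝ) ^ (m + 1) ≤ bigLam γ K - bigLam γ (T j) := by
      refine le_trans ?_ hgain
      have h1 : θ / 2 * n ≤ (editCount (T j) K : ℝ) :=
        hlow.trans (by exact_mod_cast difDeg_le_editCount _ _ _)
      have h2 := mul_le_mul_of_nonneg_left h1 hc₁.le
      have h3 := mul_le_mul_of_nonneg_right h2 (pow_pos hnR m).le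
      calc _ = c₁ * (θ / 2 * n) * (n : ℝ) ^ m := by ring
        _ ≤ _ := h3
    have h10 : min (c * θ / (4 * (m + 1).factorial)) (c₁ * θ / 4) ≤ c₁ * θ / 2 - 2 * η := by
      have h1 : η ≤ c₁ * θ / 8 := min_le_right _ _
      have h2 : min (c * θ / (4 * (m + 1).factorial)) (c₁ * θ / 4) ≤ c₁ * θ / 4 := min_le_right _ _
      linarith
    have h11 := mul_le_mul_of_nonneg_right h10 hnm.le
    have h12 := hmono j hjl
    linarith
  · push Not at hcase
    have hlast := hcase l le_rfl
    set b : ℕ → Bool := fun i => decide (∃ u, u ≠ z ∧ p u = i ∧ (T l).Adj z u) with hb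
    obtain ⟨A, hA⟩ : ∃ A : ℝ, A = ((Finset.univ.filter fun u => p u = 0 ∧ (T l).Adj z u).card : ℝ) :=
      ⟨_, rfl⟩
    obtain ⟨Z, hZ⟩ : ∃ Z : ℝ, Z = ((Finset.univ.filter fun u => p u = 0).card : ℝ) := ⟨_, rfl⟩
    have hAZ : A ≤ Z := by
      have : (Finset.univ.filter fun u => p u = 0 ∧ (T l).Adj z u).card ≤
          (Finset.univ.filter fun u => p u = 0).card := by
        refine Finset.card_le_card fun u hu => ?_
        simp only [Finset.mem_filter, Finset.mem_univ, true_and] at hu ⊢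
        exact hu.1
      rw [hA, hZ]
      exact_mod_cast this
    have hA0 : 0 ≤ A := by rw [hA]; positivity
    have hZ0 : 0 ≤ Z := by rw [hZ]; positivity
    -- `α` is the proportion of class `0` joined to `z`, and `1` when that class is empty. If `x₀ =
    -- 0` the class is empty, since all labels lie in the support; this gives the required
    -- convention.
    obtain ⟨α, hα0, hα1, hαx, hαA⟩ : ∃ α : ℝ, 0 ≤ α ∧ α ≤ 1 ∧ (x.x 0 = 0 → α = 1) ∧ A = α * Z := by
      by_cases hZz : Z = 0
      · exact ⟨1, zero_le_one, le_rfl, fun _ => rfl, by linarith⟩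
      · refine ⟨A / Z, by positivity, div_le_one_of_le₀ hAZ hZ0, fun h0 => ?_,
          (div_mul_cancel₀ _ hZz).symm⟩
        exfalso
        apply hZz
        rw [hZ, Finset.filter_false_of_mem]
        · simp
        · intro v _ hv
          have : 0 < x.x (p v) := hps v
          rw [hv, h0] at this
          exact lt_irrefl _ this
    have hbu : ∀ u, u ≠ z → p u ≠ 0 → ((T l).Adj z u ↔ b (p u) = true) := by
      intro u hu hpu
      simp only [hb, decide_eq_true_eq]
      constructor
      · exact fun h => ⟨u, hu, rfl, h⟩
      · rintro ⟨v, hv, hpv, h⟩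
        exact (hTl u v hu hv hpu hpv.symm).2 h
    have happ := attach_approx (m := m + 1) hM (x := x) hn0 p z (T l) (hToff l le_rfl) hα0 hα1 hbu
      (by rw [← hA, ← hZ, hαA, sub_self, abs_zero]; norm_num)
    have hstr := hx2 b α hα0 hα1 hαx
    -- For each class, `θ n` wrong pairs force `(1 - α) x₀ + wt x b i ≥ θ` up to the `ℓ¹`-error,
    -- which is at most `θ / 2`.
    have hinf : θ / 2 ≤ (1 - α) * x.x 0 + ⨅ i : x.suppStar, wt x b i := by
      have : Nonempty x.suppStar := ⟨⟨_, x.star_mem⟩⟩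
      rw [← sub_le_iff_le_add']
      refine le_ciInf fun i => ?_
      have h1 := difDeg_reassign_le (x := x) hn0 p z (T l) hα0 hα1 hbu
        (by rw [← hA, ← hZ]; exact hαA) i
      have h2 := (hlast i i.2).trans h1
      have h3 := le_of_mul_le_mul_right h2 hnR
      linarith
    have h6 := mul_le_mul_of_nonneg_left hinf hc.le
    have hdiff := bigLam_sub_of_off (m := m + 1) γ z (G := partGraph p) (H := T l)
      (fun u v hu hv => (hToff l le_rfl u v hu hv).symm)
    have h7 : c * θ / 4 * (n : ℝ) ^ (m + 1) ≤
        (m + 1).factorial * (bigLam γ (partGraph p) - bigLam γ (T l)) := by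
      rw [← hdiff, ← le_div_iff₀ hnm, sub_div]
      have : η ≤ c * θ / 8 := min_le_left _ _
      linarith [(abs_le.1 hstar).1, (abs_le.1 happ).2]
    have h8 : c * θ / (4 * (m + 1).factorial) * (n : ℝ) ^ (m + 1) ≤
        bigLam γ (partGraph p) - bigLam γ (T l) := by
      rw [← mul_le_mul_iff_right₀ hF]
      refine le_trans (le_of_eq ?_) h7
      field_simp
    have h9 := mul_le_mul_of_nonneg_right
      (min_le_left (c * θ / (4 * (m + 1).factorial)) (c₁ * θ / 4)) hnm.le
    have h12 := hmono l le_rfl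
    linarith

/-! ## Graphs close to a realisation of a maximiser -/

theorem editCount_le_of_touch {V : Type*} [Fintype V] {G H : SimpleGraph V} (R : Finset V)
    (h : ∀ u v, ¬(G.Adj u v ↔ H.Adj u v) → u ∈ R ∨ v ∈ R) :
    editCount G H ≤ R.card * Fintype.card V := by
  rw [editCount, mem_symmDiff_edgeSet]
  have h1 : (symmDiff G H).edgeSet ⊆
      (((R ×ˢ Finset.univ).image fun x : V × V => s(x.1, x.2) : Finset (Sym2 V)) : Set (Sym2 V)) := by
    intro e
    induction e using Sym2.ind with
    | _ a b =>
      intro hab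
      rw [SimpleGraph.mem_edgeSet, symmDiff_adj] at hab
      simp only [Finset.coe_image, Set.mem_image, Finset.mem_coe, Finset.mem_product,
        Finset.mem_univ, and_true, Prod.exists]
      rcases h a b hab with h | h
      · exact ⟨a, b, h, rfl⟩
      · exact ⟨b, a, h, Sym2.eq_swap⟩
  refine (Set.ncard_le_ncard h1 (Finset.finite_toSet _)).trans ?_
  rw [Set.ncard_coe_finset]
  refine Finset.card_image_le.trans ?_
  rw [Finset.card_product, Finset.card_univ]

/-- The graph agreeing with `G` on pairs meeting `C` and with `H` on the other pairs. -/
def mixGraph {V : Type*} (G H : SimpleGraph V) (C : Finset V) : SimpleGraph V where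
  Adj u v := if u ∈ C ∨ v ∈ C then G.Adj u v else H.Adj u v
  symm := ⟨fun u v h => by
    simp only [or_comm (a := v ∈ C), G.adj_comm v, H.adj_comm v]; exact h⟩
  loopless := ⟨fun u h => by split_ifs at h <;> simp at h⟩

theorem mixGraph_adj {V : Type*} (G H : SimpleGraph V) (C : Finset V) (u v : V) :
    (mixGraph G H C).Adj u v ↔ if u ∈ C ∨ v ∈ C then G.Adj u v else H.Adj u v := Iff.rfl

theorem mixGraph_empty {V : Type*} (G H : SimpleGraph V) : mixGraph G H ∅ = H := by
  ext u v
  simp [mixGraph_adj]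

/-- Correcting the vertices of a small set one at a time. -/
theorem mixGraph_gain {m : ℕ} {γ : GraphClass (m + 2) → ℝ} {M : ℝ} (hM : ∀ c, |γ c| ≤ M)
    {n : ℕ} (G H : SimpleGraph (Fin n)) {β c₂ : ℝ} (hβ : 0 ≤ β)
    (hβc : 8 * M * ((m + 1) + 2 * (m + 1) ^ 2) * β ≤ c₂) (B : Finset (Fin n))
    (hB : (B.card : ℝ) ≤ β * n)
    (hz : ∀ z ∈ B, c₂ * n ^ (m + 1) ≤ bigLam γ H - bigLam γ (mixGraph G H {z})) :
    ∀ C ⊆ B, c₂ / 2 * C.card * n ^ (m + 1) ≤ bigLam γ H - bigLam γ (mixGraph G H C) := by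
  intro C
  induction C using Finset.induction with
  | empty => intro _; simp [mixGraph_empty]
  | insert z C hzC ih =>
    intro hCB
    have hzB : z ∈ B := hCB (Finset.mem_insert_self _ _)
    have hCB' : C ⊆ B := (Finset.subset_insert _ _).trans hCB
    have hne : Nonempty (Fin n) := ⟨z⟩
    have hC : (C.card : ℝ) ≤ β * n := le_trans (by exact_mod_cast Finset.card_le_card hCB') hB
    have hcount : ∀ G₁ G₂ : SimpleGraph (Fin n),
        (∀ u v, ¬(G₁.Adj u v ↔ G₂.Adj u v) → u ∈ C ∨ v ∈ C) →
        (2 * editCount G₁ G₂ : ℝ) ≤ 2 * β * (Fintype.card (Fin n) : ℝ) ^ 2 := by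
      intro G₁ G₂ h
      have h1 : (editCount G₁ G₂ : ℝ) ≤ C.card * n := by
        have := editCount_le_of_touch C h
        rw [Fintype.card_fin] at this
        exact_mod_cast this
      rw [Fintype.card_fin]
      nlinarith [mul_le_mul_of_nonneg_right hC (Nat.cast_nonneg (α := ℝ) n)]
    have hdeg : ∀ G₁ G₂ : SimpleGraph (Fin n),
        (∀ u, ¬(G₁.Adj z u ↔ G₂.Adj z u) → u ∈ C) →
        ∀ i : Fin 1, (difDeg G₁ G₂ (![z] i) : ℝ) ≤ β * Fintype.card (Fin n) := by
      intro G₁ G₂ h i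
      fin_cases i
      rw [Fintype.card_fin]
      refine le_trans ?_ hC
      have : difDeg G₁ G₂ z ≤ C.card := Finset.card_le_card fun u hu => by
        simp only [Finset.mem_filter, Finset.mem_univ, true_and] at hu
        exact h u hu
      exact_mod_cast this
    have hs : ∀ G₁ G₂ : SimpleGraph (Fin n), ∀ i j : Fin 1,
        G₁.Adj (![z] i) (![z] j) ↔ G₂.Adj (![z] i) (![z] j) := by
      intro G₁ G₂ i j
      rw [Subsingleton.elim i j]; simp
    -- The gain from correcting `z` in the presence of the uncorrected set `C` is compared with the
    -- gain when only `z` is uncorrected. The graphs compared differ only on pairs meeting `C`, and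
    -- `C` has at most `β n` vertices.
    have e1 := abs_sum_val_sub_le (m := m + 1) hM ![z] (G := mixGraph G H C) (H := H) (hs _ _)
      (hdeg _ _ fun u hu => by
        rw [mixGraph_adj] at hu
        by_contra huC
        simp [hzC, huC] at hu)
      (hcount _ _ fun u v hu => by
        rw [mixGraph_adj] at hu
        by_contra huC
        simp [huC] at hu)
    have e2 := abs_sum_val_sub_le (m := m + 1) hM ![z] (G := mixGraph G H (insert z C))
      (H := mixGraph G H {z}) (hs _ _)
      (hdeg _ _ fun u hu => by
        simp [mixGraph_adj] at hu)
      (hcount _ _ fun u v hu => by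
        rw [mixGraph_adj, mixGraph_adj] at hu
        by_contra huC
        rw [not_or] at huC
        simp [huC.1, huC.2] at hu)
    have d1 := bigLam_sub_of_off (m := m + 1) γ z (G := mixGraph G H C)
      (H := mixGraph G H (insert z C)) (fun u v hu hv => by simp [mixGraph_adj, hu, hv])
    have d2 := bigLam_sub_of_off (m := m + 1) γ z (G := H)
      (H := mixGraph G H {z}) (fun u v hu hv => by simp [mixGraph_adj, hu, hv])
    have hF : (1 : ℝ) ≤ (m + 1).factorial := by exact_mod_cast Nat.factorial_pos _
    have hP : (0 : ℝ) ≤ (n : ℝ) ^ (m + 1) := by positivity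
    have h1 := hz z hzB
    rw [Fintype.card_fin] at e1 e2
    push_cast at e1 e2
    set E := 2 * M * ((1 * (m + 1) * β + (m + 1) ^ 2 * (2 * β)) * (n : ℝ) ^ (m + 1)) with hE
    have h2 : 2 * E ≤ c₂ / 2 * (n : ℝ) ^ (m + 1) := by
      have := mul_le_mul_of_nonneg_right hβc hP
      nlinarith
    have h3 : (m + 1).factorial * (c₂ * (n : ℝ) ^ (m + 1)) - 2 * E ≤
        (m + 1).factorial * (bigLam γ (mixGraph G H C) - bigLam γ (mixGraph G H (insert z C))) := by
      have := mul_le_mul_of_nonneg_left h1 (by linarith : (0 : ℝ) ≤ (m + 1).factorial)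
      rw [← d1]
      linarith [(abs_le.1 e1).1, (abs_le.1 e2).2]
    have h4 : c₂ / 2 * (n : ℝ) ^ (m + 1) ≤
        bigLam γ (mixGraph G H C) - bigLam γ (mixGraph G H (insert z C)) := by
      have hE0 : 0 ≤ 2 * E := by
        have hM0 : 0 ≤ M := (abs_nonneg _).trans (hM (Quotient.mk _ ⊥))
        rw [hE]; positivity
      have h5 : 2 * E ≤ (m + 1).factorial * (c₂ / 2 * (n : ℝ) ^ (m + 1)) := by nlinarith
      have hF0 : (0 : ℝ) < (m + 1).factorial := by linarith
      rw [← mul_le_mul_iff_right₀ hF0]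
      linarith
    have h6 := ih hCB'
    rw [Finset.card_insert_of_notMem hzC]
    push_cast
    linarith

/-- `W` consists of the vertices with many wrong pairs; they are relabelled to fit where possible,
and `B` collects those that fit no class. Going from `G` to `H` through the graph that keeps `G` at
`B` and is `H` elsewhere, `flips_gain` pays for the first stage pair by pair. In the second stage
each vertex of `B` gains order `n^(m+1)`, which pays for its at most `n` pairs. -/
theorem local_stability {m : ℕ} {γ : GraphClass (m + 2) → ℝ} (hsym : Symmetrisable γ) {c : ℝ}
    (hc : 0 < c) :
    ∃ δ > 0, ∃ C > 0, ∃ N : ℕ, 0 < N ∧ ∀ x : PartiteLimit, StrictPairs γ c x →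
      StrictVertex (m := m + 1) γ c x → ∀ n : ℕ, N ≤ n → ∀ p : Fin n → ℕ,
      (∀ v, p v ∈ x.suppStar) → tv (emp p) x.x ≤ δ → ∀ G : SimpleGraph (Fin n),
      (editCount G (partGraph p) : ℝ) ≤ δ * n ^ 2 →
      ∃ H : SimpleGraph (Fin n), H.IsCompleteMultipartite ∧
        editCount G H * (n : ℝ) ^ m ≤ C * (bigLam γ H - bigLam γ G) := by
  obtain ⟨M, hM0, hM⟩ := exists_bound γ
  obtain ⟨δf, hδf, c₁, hc₁, N₁, hN₁, hflip⟩ := flips_gain γ hc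
  set d := δf / 4 with hd
  have hd0 : 0 < d := by positivity
  -- The threshold is `d / 2` because a vertex is judged misfit against the old labels `p`; against
  -- the new labels `p'` its error counts can drop by `β n ≤ d n / 2`.
  obtain ⟨c₂, hc₂, δ₂, hδ₂, N₂, hN₂, hmis⟩ := misfit_loss hsym hc (half_pos hd0)
  set Q := 8 * M * (((m : ℝ) + 1) + 2 * (m + 1) ^ 2) with hQ
  have hQ0 : 0 < Q := by positivity
  obtain ⟨β, hβ0, hβd, hβ2, hβQ⟩ : ∃ β : ℝ, 0 < β ∧ β ≤ d / 2 ∧ β ≤ δ₂ / 4 ∧ β ≤ c₂ / Q :=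
    ⟨min (d / 2) (min (δ₂ / 4) (c₂ / Q)), by positivity, min_le_left _ _,
      (min_le_right _ _).trans (min_le_left _ _), (min_le_right _ _).trans (min_le_right _ _)⟩
  rw [le_div_iff₀ hQ0] at hβQ
  obtain ⟨δ, hδ0, hδd, hδβ, hδ2⟩ : ∃ δ : ℝ, 0 < δ ∧ δ ≤ d ∧ δ ≤ β * d / 2 ∧ δ ≤ δ₂ / 2 :=
    ⟨min d (min (β * d / 2) (δ₂ / 2)), by positivity, min_le_left _ _,
      (min_le_right _ _).trans (min_le_left _ _), (min_le_right _ _).trans (min_le_right _ _)⟩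
  have hcm : 0 < min c₁ (c₂ / 2) := by positivity
  refine ⟨δ, hδ0, 1 / min c₁ (c₂ / 2), by positivity, N₁ + N₂, by omega, ?_⟩
  intro x hx1 hx2 n hn p hps htv G hG
  have hn0 : 0 < n := by omega
  have hnR : (0 : ℝ) < n := by exact_mod_cast hn0
  have hne : Nonempty (Fin n) := ⟨⟨0, hn0⟩⟩
  -- vertices with many wrong pairs
  let W : Finset (Fin n) := Finset.univ.filter fun v => d * n ≤ difDeg G (partGraph p) v
  have hW : (W.card : ℝ) ≤ β * n := by
    have h1 : (2 * editCount G (partGraph p) : ℝ) = ∑ a, (difDeg G (partGraph p) a : ℝ) := by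
      exact_mod_cast (sum_difDeg G (partGraph p)).symm
    have h2 : ∑ a ∈ W, d * n ≤ ∑ a ∈ W, (difDeg G (partGraph p) a : ℝ) :=
      Finset.sum_le_sum fun a ha => (Finset.mem_filter.1 ha).2
    have h3 : ∑ a ∈ W, (difDeg G (partGraph p) a : ℝ) ≤ ∑ a, (difDeg G (partGraph p) a : ℝ) :=
      Finset.sum_le_sum_of_subset_of_nonneg (Finset.subset_univ _) fun _ _ _ => by positivity
    rw [Finset.sum_const, nsmul_eq_mul] at h2
    have h4 : W.card * (d * n) ≤ 2 * (δ * n ^ 2) := by linarith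
    have h5 : (W.card : ℝ) * (d * n) ≤ β * n * (d * n) := by
      have : δ * n ^ 2 ≤ β * d / 2 * n ^ 2 := mul_le_mul_of_nonneg_right hδβ (by positivity)
      nlinarith
    exact le_of_mul_le_mul_right h5 (by positivity)
  obtain ⟨p', hp's, hp'W, hp'B⟩ : ∃ p' : Fin n → ℕ, (∀ v, p' v ∈ x.suppStar) ∧
      (∀ v, v ∉ W → p' v = p v) ∧ ∀ v,
        ((difDeg G (partGraph (Function.update p v (p' v))) v : ℝ) < d * n) ∨
        (v ∈ W ∧ p' v = x.star ∧
          ∀ i ∈ x.suppStar, d * n ≤ difDeg G (partGraph (Function.update p v i)) v) := by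
    have : ∀ v, ∃ j ∈ x.suppStar, (v ∉ W → j = p v) ∧
        (((difDeg G (partGraph (Function.update p v j)) v : ℝ) < d * n) ∨
        (v ∈ W ∧ j = x.star ∧
          ∀ i ∈ x.suppStar, d * n ≤ difDeg G (partGraph (Function.update p v i)) v)) := by
      intro v
      by_cases hv : v ∈ W
      · by_cases hi : ∃ i ∈ x.suppStar,
            (difDeg G (partGraph (Function.update p v i)) v : ℝ) < d * n
        · obtain ⟨i, hi, hi'⟩ := hi
          exact ⟨i, hi, fun h => absurd hv h, Or.inl hi'⟩
        · push Not at hi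
          exact ⟨x.star, x.star_mem, fun h => absurd hv h, Or.inr ⟨hv, rfl, hi⟩⟩
      · refine ⟨p v, hps v, fun _ => rfl, Or.inl ?_⟩
        rw [Function.update_eq_self]
        simpa [W] using hv
    choose p' h1 h2 h3 using this
    exact ⟨p', h1, h2, h3⟩
  set H := partGraph p' with hH
  have hreas : ∀ v i, (difDeg (partGraph (Function.update p v i))
      (partGraph (Function.update p' v i)) v : ℝ) ≤ β * n := by
    intro v i
    refine le_trans ?_ hW
    have : difDeg (partGraph (Function.update p v i)) (partGraph (Function.update p' v i)) v ≤
        W.card := by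
      refine Finset.card_le_card fun u hu => ?_
      simp only [Finset.mem_filter, Finset.mem_univ, true_and] at hu
      by_contra huW
      apply hu
      by_cases huv : u = v
      · subst huv; simp
      · rw [reassign_adj p v i huv, reassign_adj p' v i huv, hp'W u huW]
    exact_mod_cast this
  have hpp' : (editCount (partGraph p) H : ℝ) ≤ β * n ^ 2 := by
    have h1 := editCount_le_of_touch (G := partGraph p) (H := H) W fun u v huv => by
      by_contra hc
      rw [not_or] at hc
      apply huv
      rw [hH, partGraph_adj, partGraph_adj, hp'W u hc.1, hp'W v hc.2]
    rw [Fintype.card_fin] at h1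
    have h2 : (editCount (partGraph p) H : ℝ) ≤ W.card * n := by exact_mod_cast h1
    nlinarith [mul_le_mul_of_nonneg_right hW hnR.le]
  have hGH : (editCount G H : ℝ) ≤ (δ + β) * n ^ 2 := by
    have : (editCount G H : ℝ) ≤ editCount G (partGraph p) + editCount (partGraph p) H := by
      exact_mod_cast editCount_triangle _ _ _
    linarith
  have htv' : tv (emp p') x.x ≤ 2 * β + δ := by
    have h1 := tv_triangle (emp_isDist p') (emp_isDist p) x.isDist
    have h2 := tv_emp_le_card p' p
    rw [Fintype.card_fin] at h2
    have h3 : ((Finset.univ.filter fun v => p' v ≠ p v).card : ℝ) ≤ β * n := by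
      refine le_trans ?_ hW
      have : (Finset.univ.filter fun v => p' v ≠ p v).card ≤ W.card := by
        refine Finset.card_le_card fun u hu => ?_
        simp only [Finset.mem_filter, Finset.mem_univ, true_and] at hu
        by_contra huW
        exact hu (hp'W u huW)
      exact_mod_cast this
    have h4 : 2 * ((Finset.univ.filter fun v => p' v ≠ p v).card : ℝ) / n ≤ 2 * β := by
      rw [div_le_iff₀ hnR]; linarith
    linarith
  let B : Finset (Fin n) := Finset.univ.filter fun v => v ∈ W ∧ p' v = x.star ∧
    ∀ i ∈ x.suppStar, d * n ≤ difDeg G (partGraph (Function.update p v i)) v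
  have hBW : (B.card : ℝ) ≤ β * n := by
    refine le_trans ?_ hW
    have : B.card ≤ W.card := Finset.card_le_card fun v hv => (Finset.mem_filter.1 hv).2.1
    exact_mod_cast this
  have hgood : ∀ v, v ∉ B → (difDeg G H v : ℝ) ≤ δf * n := by
    intro v hv
    have h1 := (hp'B v).resolve_right (by simpa [B] using hv)
    have h2 := hreas v (p' v)
    rw [Function.update_eq_self] at h2
    have h3 : (difDeg G H v : ℝ) ≤ difDeg G (partGraph (Function.update p v (p' v))) v +
        difDeg (partGraph (Function.update p v (p' v))) (partGraph p') v := by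
      exact_mod_cast difDeg_triangle _ _ _ _
    nlinarith
  -- correct the pairs of good vertices
  have hstepA := hflip x hx1 n (by omega) p' (by linarith) G (mixGraph G H B)
    (fun a b hab => by
      rw [mixGraph_adj] at hab
      split_ifs at hab with h
      · exact absurd Iff.rfl hab
      · exact hab)
    (fun a b hab => ⟨hp's a, hgood a fun ha => by
      rw [mixGraph_adj, if_pos (Or.inl ha)] at hab
      exact hab Iff.rfl⟩)
    (hGH.trans (mul_le_mul_of_nonneg_right (by linarith) (by positivity)))
  -- Each misfit carries the label `x.star`, the reference class in `misfit_loss`.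
  have hstepB := mixGraph_gain hM G H hβ0.le (c₂ := c₂) (by linarith) B hBW (fun z hz => by
    have hz' := (Finset.mem_filter.1 hz).2
    refine hmis x hx1 hx2 n (by omega) p' hp's (by linarith) z hz'.2.1 (mixGraph G H {z})
      (fun u v hu hv => by simp [mixGraph_adj, hu, hv, hH]) fun i hi => ?_
    have h1 := hz'.2.2 i hi
    have h2 := hreas z i
    have h3 : (difDeg G (partGraph (Function.update p z i)) z : ℝ) ≤
        difDeg G (partGraph (Function.update p' z i)) z +
        difDeg (partGraph (Function.update p' z i)) (partGraph (Function.update p z i)) z := by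
      exact_mod_cast difDeg_triangle _ _ _ _
    rw [difDeg_comm (partGraph (Function.update p' z i))] at h3
    have h4 : difDeg (mixGraph G H {z}) (partGraph (Function.update p' z i)) z =
        difDeg G (partGraph (Function.update p' z i)) z := by
      unfold difDeg
      congr 1
      ext u
      simp [mixGraph_adj]
    rw [h4]
    nlinarith) B subset_rfl
  refine ⟨H, partGraph_isCompleteMultipartite p', ?_⟩
  have h1 : (editCount G H : ℝ) ≤ editCount G (mixGraph G H B) + B.card * n := by
    have h2 := editCount_triangle G (mixGraph G H B) H
    have h3 := editCount_le_of_touch (G := mixGraph G H B) (H := H) B fun u v huv => by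
      rw [mixGraph_adj] at huv
      split_ifs at huv with h
      · exact h
      · exact absurd Iff.rfl huv
    rw [Fintype.card_fin] at h3
    exact_mod_cast h2.trans (Nat.add_le_add_left h3 _)
  have hP : (0 : ℝ) ≤ (n : ℝ) ^ m := by positivity
  have hm1 := min_le_left c₁ (c₂ / 2)
  have hm2 := min_le_right c₁ (c₂ / 2)
  rw [one_div, inv_mul_eq_div, le_div_iff₀ hcm]
  have g1 : min c₁ (c₂ / 2) * (editCount G (mixGraph G H B) * (n : ℝ) ^ m) ≤
      c₁ * (editCount G (mixGraph G H B) * (n : ℝ) ^ m) :=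
    mul_le_mul_of_nonneg_right hm1 (by positivity)
  have g2 : min c₁ (c₂ / 2) * (B.card * n * (n : ℝ) ^ m) ≤ c₂ / 2 * (B.card * n * (n : ℝ) ^ m) :=
    mul_le_mul_of_nonneg_right hm2 (by positivity)
  have g3 := mul_le_mul_of_nonneg_left (mul_le_mul_of_nonneg_right h1 hP) hcm.le
  have g4 : c₂ / 2 * (B.card * n * (n : ℝ) ^ m) = c₂ / 2 * B.card * (n : ℝ) ^ (m + 1) := by ring
  linarith

/-! ## Complete partite graphs that almost maximise `λ` -/

/-- Sorting the sizes in the order dual lists the parts by decreasing size. Labels are shifted by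
one, leaving `0` for the clique class, which is empty here; labels beyond the number of parts are
empty too. -/
theorem exists_sorted_part {n : ℕ} {H : SimpleGraph (Fin n)} (hH : H.IsCompleteMultipartite) :
    ∃ q : Fin n → ℕ, (∀ v, q v ≠ 0) ∧ (∀ u v, H.Adj u v ↔ q u ≠ q v) ∧
      ∀ i j, 1 ≤ i → i ≤ j → (Finset.univ.filter fun v => q v = j).card ≤
        (Finset.univ.filter fun v => q v = i).card := by
  let e := Fintype.equivFin (Quotient hH.setoid)
  let size : Fin (Fintype.card (Quotient hH.setoid)) → ℕᵒᵈ := fun i =>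
    OrderDual.toDual (Finset.univ.filter fun v : Fin n => e (Quotient.mk hH.setoid v) = i).card
  let σ := Tuple.sort size
  have hσ : Monotone (size ∘ σ) := Tuple.monotone_sort size
  refine ⟨fun v => (σ.symm (e (Quotient.mk hH.setoid v))).val + 1, fun v => Nat.succ_ne_zero _, ?_, ?_⟩
  · intro u v
    have h1 : Quotient.mk hH.setoid u = Quotient.mk hH.setoid v ↔ ¬ H.Adj u v := Quotient.eq
    rw [ne_eq, add_left_inj, Fin.val_inj, σ.symm.injective.eq_iff, e.injective.eq_iff, h1, not_not]
  · have hcard : ∀ i (hi : i < Fintype.card (Quotient hH.setoid)),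
        (Finset.univ.filter fun v : Fin n =>
          (σ.symm (e (Quotient.mk hH.setoid v))).val + 1 = i + 1) =
        Finset.univ.filter fun v : Fin n => e (Quotient.mk hH.setoid v) = σ ⟨i, hi⟩ := by
      intro i hi
      ext v
      simp only [Finset.mem_filter, Finset.mem_univ, true_and, add_left_inj]
      rw [← Equiv.symm_apply_eq, Fin.ext_iff]
    intro i j hi hij
    obtain ⟨i, rfl⟩ := Nat.exists_eq_add_of_le' hi
    obtain ⟨j, rfl⟩ := Nat.exists_eq_add_of_le' (hi.trans hij)
    by_cases hj : j < Fintype.card (Quotient hH.setoid)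
    · rw [hcard j hj, hcard i (by omega)]
      exact hσ (show (⟨i, by omega⟩ : Fin (Fintype.card (Quotient hH.setoid))) ≤ ⟨j, hj⟩ by
        rw [Fin.mk_le_mk]; omega)
    · rw [Finset.filter_false_of_mem]
      · simp
      · intro v _ hv
        have h1 := (σ.symm (e (Quotient.mk hH.setoid v))).isLt
        have h2 : (σ.symm (e (Quotient.mk hH.setoid v))).val + 1 = j + 1 := hv
        omega

/-- Permuting the vertices of a realisation. -/
def Realisation.perm {x : PartiteLimit} {n : ℕ} (R : Realisation x n) (σ : Equiv.Perm (Fin n)) :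
    Realisation x n :=
  have h : ∀ i, (Finset.univ.filter fun v => R.part (σ v) = i).card =
      (Finset.univ.filter fun v => R.part v = i).card := fun i =>
    Finset.card_equiv σ fun v => by simp
  { part := fun v => R.part (σ v)
    part_ne_zero := fun h0 v => R.part_ne_zero h0 _
    card_of_zero := fun h0 i hi => by rw [h]; exact R.card_of_zero h0 i hi
    card_of_pos := fun h0 i hi h' => by rw [h]; exact R.card_of_pos h0 i hi h'
    card_small := fun h0 i hi h' => by rw [h]; exact R.card_small h0 i hi h' }

/-- Permute a realisation so that its labels agree with `q` as often as possible. If neither class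
of label `i` contained the other, a swap between the two differences would increase the agreement.
-/
theorem exists_aligned (x : PartiteLimit) {n : ℕ} (q : Fin n → ℕ) :
    ∃ R : Realisation x n, ∀ i, (∀ v, q v = i → R.part v = i) ∨ ∀ v, R.part v = i → q v = i := by
  obtain ⟨R⟩ := nonempty_realisation x n
  obtain ⟨σ, hσ⟩ := Finite.exists_max fun σ : Equiv.Perm (Fin n) =>
    (Finset.univ.filter fun v => R.part (σ v) = q v).card
  refine ⟨R.perm σ, fun i => ?_⟩
  by_contra hc
  push Not at hc
  obtain ⟨⟨v, hv, hv'⟩, u, hu, hu'⟩ := hc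
  change R.part (σ v) ≠ i at hv'
  change R.part (σ u) = i at hu
  refine absurd (hσ ((Equiv.swap u v).trans σ)) (not_le.2 (Finset.card_lt_card ?_))
  rw [Finset.ssubset_iff]
  refine ⟨v, by simp [hv, hv'], fun w hw => ?_⟩
  simp only [Finset.mem_insert, Finset.mem_filter, Finset.mem_univ, true_and] at hw ⊢
  rcases hw with rfl | hw
  · simp [hu, hv]
  · have h1 : w ≠ u := by rintro rfl; exact hu' (hw.symm.trans hu)
    have h2 : w ≠ v := by rintro rfl; exact hv' (hw.trans hv)
    simpa [Equiv.swap_apply_of_ne_of_ne h1 h2] using hw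

/-- By nestedness, the number of vertices on which `p` and `q` disagree about one of the labels `1,
…, I` is at most the sum of the size differences. At any other vertex, a wrong pair leads to such a
vertex or stays inside a class with label beyond `I`. -/
theorem editCount_aligned_le {n : ℕ} {H : SimpleGraph (Fin n)} {p q : Fin n → ℕ}
    (hq0 : ∀ v, q v ≠ 0) (hq : ∀ u v, H.Adj u v ↔ q u ≠ q v)
    (hal : ∀ i, (∀ v, q v = i → p v = i) ∨ ∀ v, p v = i → q v = i) (I : ℕ) {s t : ℝ}
    (hs : ∀ i, I < i → ((Finset.univ.filter fun v => q v = i).card : ℝ) ≤ s)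
    (ht : ∀ i, I < i → ((Finset.univ.filter fun v => p v = i).card : ℝ) ≤ t) :
    (editCount H (partGraph p) : ℝ) ≤ n * (2 * ∑ i ∈ Finset.Icc 1 I,
      |((Finset.univ.filter fun v => q v = i).card : ℝ) -
        (Finset.univ.filter fun v => p v = i).card| + s + t) := by
  let A : ℕ → Finset (Fin n) := fun i => Finset.univ.filter fun v => ¬(q v = i ↔ p v = i)
  have hA : ∀ i, ((A i).card : ℝ) ≤ |((Finset.univ.filter fun v => q v = i).card : ℝ) -
        (Finset.univ.filter fun v => p v = i).card| := by
    intro i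
    have key : ∀ f g : Fin n → ℕ, (∀ v, f v = i → g v = i) →
        ((Finset.univ.filter fun v => ¬(f v = i ↔ g v = i)).card : ℝ) =
        ((Finset.univ.filter fun v => g v = i).card : ℝ) -
          (Finset.univ.filter fun v => f v = i).card := by
      intro f g h
      have h1 : (Finset.univ.filter fun v => ¬(f v = i ↔ g v = i)) =
          (Finset.univ.filter fun v => g v = i) \ Finset.univ.filter fun v => f v = i := by
        ext v
        have := h v
        simp only [Finset.mem_filter, Finset.mem_univ, true_and, Finset.mem_sdiff]
        tauto
      rw [h1, Finset.card_sdiff_of_subset (fun v hv => by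
          simp only [Finset.mem_filter, Finset.mem_univ, true_and] at hv ⊢; exact h v hv),
        Nat.cast_sub (Finset.card_le_card fun v hv => by
          simp only [Finset.mem_filter, Finset.mem_univ, true_and] at hv ⊢; exact h v hv)]
    rcases hal i with h | h
    · rw [abs_sub_comm]
      exact (key q p h).le.trans (le_abs_self _)
    · refine le_trans (le_of_eq ?_) ((key p q h).le.trans (le_abs_self _))
      simp only [A, iff_comm]
  let D : Finset (Fin n) := (Finset.Icc 1 I).biUnion A
  set sd := ∑ i ∈ Finset.Icc 1 I, |((Finset.univ.filter fun v => q v = i).card : ℝ) -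
        (Finset.univ.filter fun v => p v = i).card| with hsd
  have hD : (D.card : ℝ) ≤ sd := by
    have h1 : (D.card : ℝ) ≤ ∑ i ∈ Finset.Icc 1 I, ((A i).card : ℝ) := by
      exact_mod_cast Finset.card_biUnion_le
    exact h1.trans (Finset.sum_le_sum fun i _ => hA i)
  have hDn : ∀ v, v ∉ D → ∀ i, 1 ≤ i → i ≤ I → (q v = i ↔ p v = i) := by
    intro v hv i h1 h2
    by_contra hc
    exact hv (Finset.mem_biUnion.2 ⟨i, Finset.mem_Icc.2 ⟨h1, h2⟩, by simp [A]; tauto⟩)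
  have hs0 : 0 ≤ s := le_trans (by positivity) (hs (I + 1) (by omega))
  have ht0 : 0 ≤ t := le_trans (by positivity) (ht (I + 1) (by omega))
  have hsd0 : 0 ≤ sd := Finset.sum_nonneg fun _ _ => abs_nonneg _
  have hdeg : ∀ v, v ∉ D → (difDeg H (partGraph p) v : ℝ) ≤ sd + s + t := by
    intro v hv
    have h1 : difDeg H (partGraph p) v ≤ D.card +
        (if I < q v then (Finset.univ.filter fun u => q u = q v).card else 0) +
        (if I < p v then (Finset.univ.filter fun u => p u = p v).card else 0) := by
      have : (Finset.univ.filter fun u => ¬(H.Adj v u ↔ (partGraph p).Adj v u)) ⊆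
          (D ∪ (if I < q v then (Finset.univ.filter fun u => q u = q v) else ∅)) ∪
          (if I < p v then (Finset.univ.filter fun u => p u = p v) else ∅) := by
        intro u hu
        simp only [Finset.mem_filter, Finset.mem_univ, true_and] at hu
        by_contra hc
        simp only [Finset.mem_union, not_or] at hc
        obtain ⟨⟨huD, h1⟩, h2⟩ := hc
        by_cases huv : v = u
        · subst huv; simp at hu
        rw [hq, partGraph_adj] at hu
        have hq1 : 1 ≤ q v := Nat.one_le_iff_ne_zero.2 (hq0 v)
        by_cases hqv : q v ≤ I
        · have e1 := (hDn v hv (q v) hq1 hqv).1 rfl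
          have e2 := hDn u huD (q v) hq1 hqv
          apply hu
          rw [e1]
          constructor
          · intro h
            exact ⟨huv, Or.inl fun h' => h (e2.2 h'.symm).symm⟩
          · rintro ⟨-, h | h⟩ h'
            · exact h (e2.1 h'.symm).symm
            · exact hq0 v h
        · rw [if_pos (by omega)] at h1
          simp only [Finset.mem_filter, Finset.mem_univ, true_and] at h1
          apply hu
          refine ⟨fun _ => ⟨huv, ?_⟩, fun _ h => h1 h.symm⟩
          by_cases hp0 : p v = 0
          · exact Or.inr hp0
          · left
            have hpI : I < p v := by
              by_contra hcon
              have := (hDn v hv (p v) (by omega) (by omega)).2 rfl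
              omega
            rw [if_pos hpI] at h2
            simp only [Finset.mem_filter, Finset.mem_univ, true_and] at h2
            exact fun h => h2 h.symm
      refine (Finset.card_le_card this).trans ((Finset.card_union_le _ _).trans ?_)
      refine Nat.add_le_add ((Finset.card_union_le _ _).trans (Nat.add_le_add_left ?_ _)) ?_
      · split_ifs <;> simp
      · split_ifs <;> simp
    have h2 : (difDeg H (partGraph p) v : ℝ) ≤ D.card +
        (if I < q v then ((Finset.univ.filter fun u => q u = q v).card : ℝ) else 0) +
        (if I < p v then ((Finset.univ.filter fun u => p u = p v).card : ℝ) else 0) := by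
      exact_mod_cast h1
    have h3 : (if I < q v then ((Finset.univ.filter fun u => q u = q v).card : ℝ) else 0) ≤ s := by
      split_ifs with h
      · exact hs _ h
      · exact hs0
    have h4 : (if I < p v then ((Finset.univ.filter fun u => p u = p v).card : ℝ) else 0) ≤ t := by
      split_ifs with h
      · exact ht _ h
      · exact ht0
    linarith
  have hdeg' : ∀ v, (difDeg H (partGraph p) v : ℝ) ≤ (sd + s + t) + if v ∈ D then (n : ℝ) else 0 := by
    intro v
    split_ifs with hv
    · have : difDeg H (partGraph p) v ≤ n := by
        refine (Finset.card_le_univ _).trans ?_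
        simp
      have : (difDeg H (partGraph p) v : ℝ) ≤ n := by exact_mod_cast this
      linarith
    · rw [add_zero]; exact hdeg v hv
  have h1 : (2 * editCount H (partGraph p) : ℝ) = ∑ a, (difDeg H (partGraph p) a : ℝ) := by
    exact_mod_cast (sum_difDeg H (partGraph p)).symm
  have h2 := Finset.sum_le_sum fun v (_ : v ∈ Finset.univ) => hdeg' v
  rw [← h1, Finset.sum_add_distrib, ← Finset.sum_filter] at h2
  simp only [Finset.sum_const, Finset.card_univ, Fintype.card_fin, nsmul_eq_mul,
    Finset.filter_mem_eq_inter, Finset.univ_inter] at h2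
  have h3 : (0 : ℝ) ≤ editCount H (partGraph p) := by positivity
  have h4 := mul_le_mul_of_nonneg_right hD (Nat.cast_nonneg (α := ℝ) n)
  nlinarith

/-- The case of no fixed vertices; the constant `8` absorbs `k! * n.choose k > n^k / 2`, valid for
large `n`. -/
theorem abs_lam_sub_le {k : ℕ} {γ : GraphClass k → ℝ} {M : ℝ} (hM0 : 0 < M) (hM : ∀ c, |γ c| ≤ M) :
    ∃ N : ℕ, 0 < N ∧ ∀ n : ℕ, N ≤ n → ∀ G H : SimpleGraph (Fin n), ∀ ε : ℝ,
      (editCount G H : ℝ) ≤ ε * n ^ 2 → |lam γ G - lam γ H| ≤ 8 * M * k ^ 2 * ε := by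
  obtain ⟨N, hN⟩ := eventually_atTop.1 ((tendsto_choose_ratio 0 k).eventually
    (lt_mem_nhds (show (1 / 2 : ℝ) < 1 by norm_num)))
  refine ⟨N + 1, by omega, fun n hn G H ε hε => ?_⟩
  have hnR : (0 : ℝ) < n := by exact_mod_cast (by omega : 0 < n)
  have hne : Nonempty (Fin n) := ⟨⟨0, by omega⟩⟩
  have hnk : (0 : ℝ) < (n : ℝ) ^ k := by positivity
  have h1 := hN n (by omega)
  rw [lt_div_iff₀ hnk, Nat.sub_zero] at h1
  have h2 := bigLam_sub (m := k) (r := 0) γ (Fin.elim0 : Fin 0 → Fin n)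
    (Function.injective_of_subsingleton _) (G := G) (G' := H) (fun _ _ _ i => i.elim0)
  have h3 := abs_sum_val_sub_le (m := k) (r := 0) hM (Fin.elim0 : Fin 0 → Fin n) (G := G) (H := H)
    (d := 0) (e := 2 * ε) (fun i => i.elim0) (fun i => i.elim0) (by rw [Fintype.card_fin]; linarith)
  rw [h2, Fintype.card_fin, abs_mul, abs_of_nonneg (by positivity : (0 : ℝ) ≤ k.factorial)] at h3
  have hch : (0 : ℝ) < (n.choose k : ℝ) := by
    have : (0 : ℝ) < k.factorial * (n.choose k : ℝ) := by linarith
    exact pos_of_mul_pos_right this (by positivity)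
  simp only [lam, Fintype.card_fin]
  rw [← sub_div, abs_div, abs_of_pos hch, div_le_iff₀ hch]
  have hf : (0 : ℝ) < k.factorial := by positivity
  rw [← mul_le_mul_iff_right₀ hf]
  refine h3.trans ?_
  have hε0 : 0 ≤ ε := by
    by_contra hlt
    have h4 : ε * n ^ 2 < 0 := mul_neg_of_neg_of_pos (not_le.1 hlt) (by positivity)
    have : (0 : ℝ) ≤ editCount G H := by positivity
    linarith
  have h5 : 8 * M * k ^ 2 * ε * (1 / 2 * (n : ℝ) ^ k) ≤
      8 * M * k ^ 2 * ε * (k.factorial * (n.choose k : ℝ)) :=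
    mul_le_mul_of_nonneg_left h1.le (by positivity)
  push_cast
  linarith

theorem lam_le_lamMax {k : ℕ} (γ : GraphClass k → ℝ) {n : ℕ} (G : SimpleGraph (Fin n)) :
    lam γ G ≤ lamMax γ n :=
  le_ciSup (Set.finite_range _).bddAbove G

/-- The graph is close to the partite limit `x`. -/
def CloseTo {n : ℕ} (G : SimpleGraph (Fin n)) (x : PartiteLimit) (δ : ℝ) : Prop :=
  ∃ p : Fin n → ℕ, (∀ v, p v ∈ x.suppStar) ∧ tv (emp p) x.x ≤ δ ∧
    (editCount G (partGraph p) : ℝ) ≤ δ * n ^ 2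

/-- The missing mass is assigned to coordinate `0`. -/
theorem exists_limit_of_seq (a : ℕ → ℝ) (hn : ∀ i, 0 ≤ a i)
    (hanti : ∀ i j, 1 ≤ i → i ≤ j → a j ≤ a i) (hsum : ∀ I : Finset ℕ, ∑ i ∈ I, a i ≤ 1) :
    ∃ x : PartiteLimit, ∀ i, 1 ≤ i → x.x i = a i := by
  have hs : Summable a := summable_of_sum_le hn hsum
  have ht : ∑' i, a i ≤ 1 := hs.tsum_le_of_sum_le hsum
  have h1 := hs.hasSum.add (hasSum_ite_eq 0 (1 - ∑' i, a i))
  rw [add_sub_cancel] at h1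
  refine ⟨⟨fun i => a i + if i = 0 then 1 - ∑' i, a i else 0, fun i => ?_, fun i j hi hij => ?_, h1⟩,
    fun i hi => ?_⟩
  · have := hn i
    split_ifs <;> linarith
  · rw [if_neg (by omega), if_neg (by omega), add_zero, add_zero]
    exact hanti i j hi hij
  · simp only
    rw [if_neg (by omega), add_zero]

theorem Realisation.card_le {x : PartiteLimit} {n : ℕ} (R : Realisation x n) {i : ℕ} (hi : 1 ≤ i) :
    ((Finset.univ.filter fun v => R.part v = i).card : ℝ) ≤ x.x i * n + 1 := by
  have hx : 0 ≤ x.x i * n := mul_nonneg (x.nonneg i) (Nat.cast_nonneg n)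
  rcases eq_or_lt_of_le (x.nonneg 0) with h0 | h0
  · have := abs_lt.1 (R.card_of_zero h0.symm i hi)
    linarith
  · rcases le_or_gt 2 (x.x i * n) with h | h
    · rw [R.card_of_pos h0 i hi h]
      linarith [Nat.floor_le hx]
    · rw [R.card_small h0 i hi h]
      simp only [Nat.cast_zero]
      linarith

/-- Otherwise there are ever better complete partite graphs of growing order, all far from `OPT`.
The sorted part proportions converge coordinatewise along a subsequence, to some `x`. The graphs are
then within `o(n²)` edits of realisations of `x`, so `x` is optimal and the graphs are close to it,
a contradiction. -/
theorem exists_opt_closeTo {k : ℕ} (γ : GraphClass k → ℝ) {δ : ℝ} (hδ : 0 < δ) :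
    ∃ η > 0, ∃ N : ℕ, ∀ n : ℕ, N ≤ n → ∀ H : SimpleGraph (Fin n), H.IsCompleteMultipartite →
      lamMax γ n - η ≤ lam γ H → ∃ x ∈ OPT γ, CloseTo H x δ := by
  obtain ⟨M, hM0, hM⟩ := exists_bound γ
  by_contra hcon
  push Not at hcon
  have hseq : ∀ j : ℕ, ∃ n : ℕ, j + 1 ≤ n ∧ ∃ (H : SimpleGraph (Fin n)) (q : Fin n → ℕ),
      lamMax γ n - 1 / ((j : ℝ) + 1) ≤ lam γ H ∧ (∀ x ∈ OPT γ, ¬ CloseTo H x δ) ∧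
      (∀ v, q v ≠ 0) ∧ (∀ u v, H.Adj u v ↔ q u ≠ q v) ∧
      ∀ i i', 1 ≤ i → i ≤ i' → (Finset.univ.filter fun v => q v = i').card ≤
        (Finset.univ.filter fun v => q v = i).card := by
    intro j
    obtain ⟨n, hn, H, hH, hle, hcl⟩ := hcon (1 / ((j : ℝ) + 1)) (by positivity) (j + 1)
    obtain ⟨q, h1, h2, h3⟩ := exists_sorted_part hH
    exact ⟨n, hn, H, q, hle, hcl, h1, h2, h3⟩
  choose n hn H q hle hcl hq0 hq hqs using hseq
  let y : ℕ → ℕ → ℝ := fun j i => ((Finset.univ.filter fun v => q j v = i).card : ℝ) / n j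
  have hnR : ∀ j, (0 : ℝ) < n j := fun j => by
    have := hn j
    exact_mod_cast (by omega : 0 < n j)
  have hne : ∀ j, Nonempty (Fin (n j)) := fun j => ⟨⟨0, by have := hn j; omega⟩⟩
  have hy : ∀ j, y j ∈ Set.pi Set.univ fun _ : ℕ => Set.Icc (0 : ℝ) 1 := by
    intro j i _
    refine ⟨by positivity, div_le_one_of_le₀ ?_ (hnR j).le⟩
    have := Finset.card_le_univ (Finset.univ.filter fun v => q j v = i)
    rw [Fintype.card_fin] at this
    exact_mod_cast this
  -- Compactness in the product topology only: mass may escape into ever smaller parts, and this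
  -- mass becomes the clique class of the limit.
  obtain ⟨a, -, φ, hφ, hlim⟩ :=
    (isCompact_univ_pi fun _ : ℕ => isCompact_Icc (a := (0 : ℝ)) (b := 1)).tendsto_subseq hy
  rw [tendsto_pi_nhds] at hlim
  simp only [Function.comp] at hlim
  obtain ⟨x, hx⟩ := exists_limit_of_seq a
    (fun i => ge_of_tendsto' (hlim i) fun j => (hy (φ j) i trivial).1)
    (fun i i' hi hii' => le_of_tendsto_of_tendsto' (hlim i') (hlim i) fun j => by
      refine div_le_div_of_nonneg_right ?_ (hnR _).le
      exact_mod_cast hqs (φ j) i i' hi hii')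
    (fun I => le_of_tendsto' (tendsto_finsetSum I fun i _ => hlim i) fun j => by
      have h1 : ∑ i ∈ I, emp (q (φ j)) i ≤ 1 :=
        sum_le_hasSum _ (fun i _ => (emp_isDist (q (φ j))).nonneg i) (emp_isDist (q (φ j))).hasSum
      refine le_trans (le_of_eq (Finset.sum_congr rfl fun i _ => ?_)) h1
      simp only [y, emp, Fintype.card_fin]
      congr)
  choose R hR using fun j => exists_aligned x (q (φ j))
  have hnφ : Tendsto (fun j => n (φ j)) atTop atTop :=
    tendsto_atTop_mono (fun j => (hφ.le_apply (x := j)).trans ((Nat.le_succ _).trans (hn (φ j))))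
      tendsto_id
  have htv : ∀ ε > 0, ∀ᶠ j in atTop, tv (emp (R j).part) x.x ≤ ε := by
    intro ε hε
    obtain ⟨N, -, hN⟩ := Realisation.tv_tendsto x hε
    filter_upwards [hnφ.eventually_ge_atTop N] with j hj
    exact hN _ hj (R j)
  have hedit : ∀ ε > 0, ∀ᶠ j in atTop,
      (editCount (H (φ j)) (partGraph (R j).part) : ℝ) ≤ ε * (n (φ j) : ℝ) ^ 2 := by
    intro ε hε
    -- Sizes decrease, so once class `I + 1` is small all later ones are. Merging or splitting such
    -- classes costs few edits, and only finitely many classes need to match.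
    obtain ⟨I, hI⟩ : ∃ I : ℕ, x.x (I + 1) < ε / 8 :=
      ((x.hasSum.summable.tendsto_atTop_zero.comp (tendsto_add_atTop_nat 1)).eventually
        (gt_mem_nhds (show (0 : ℝ) < ε / 8 by positivity))).exists
    have hsum0 : Tendsto (fun j => ∑ i ∈ Finset.Icc 1 I, |y (φ j) i - x.x i|) atTop (𝓝 0) := by
      have : Tendsto (fun j => ∑ i ∈ Finset.Icc 1 I, |y (φ j) i - x.x i|) atTop
          (𝓝 (∑ i ∈ Finset.Icc 1 I, |a i - x.x i|)) :=
        tendsto_finsetSum _ fun i _ => ((hlim i).sub_const _).abs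
      rwa [Finset.sum_eq_zero fun i hi => by
        rw [hx i (Finset.mem_Icc.1 hi).1, sub_self, abs_zero]] at this
    have hy1 : Tendsto (fun j => y (φ j) (I + 1)) atTop (𝓝 (x.x (I + 1))) := by
      rw [hx (I + 1) (by omega)]; exact hlim _
    have hinv : Tendsto (fun j => 1 / (n (φ j) : ℝ)) atTop (𝓝 0) :=
      (tendsto_const_div_atTop_nhds_zero_nat 1).comp hnφ
    filter_upwards [hsum0.eventually (gt_mem_nhds (show (0 : ℝ) < ε / 8 by positivity)),
      hy1.eventually (gt_mem_nhds hI), hinv.eventually (gt_mem_nhds (show (0 : ℝ) < ε / 8 by positivity)),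
      htv (ε / 8) (by positivity)] with j h1 h2 h3 h4
    have hN := hnR (φ j)
    rw [div_lt_iff₀ hN] at h3
    have hcq : ∀ i, ((Finset.univ.filter fun v => q (φ j) v = i).card : ℝ) = y (φ j) i * n (φ j) :=
      fun i => (div_mul_cancel₀ _ hN.ne').symm
    have hcp : ∀ i, ((Finset.univ.filter fun v => (R j).part v = i).card : ℝ) =
        emp (R j).part i * n (φ j) := fun i => by
      simp only [emp, Fintype.card_fin]
      rw [div_mul_cancel₀ _ hN.ne']
      congr
    have h5 := editCount_aligned_le (hq0 (φ j)) (hq (φ j)) (hR j) I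
      (s := ε / 8 * n (φ j)) (t := ε / 8 * n (φ j) + ε / 8 * n (φ j)) (fun i hi => by
        have e1 := hqs (φ j) (I + 1) i (by omega) hi
        have e2 : ((Finset.univ.filter fun v => q (φ j) v = i).card : ℝ) ≤
            (Finset.univ.filter fun v => q (φ j) v = I + 1).card := by exact_mod_cast e1
        refine e2.trans ?_
        rw [hcq]
        exact mul_le_mul_of_nonneg_right h2.le hN.le) (fun i hi => by
        refine ((R j).card_le (by omega)).trans ?_
        have e1 := x.anti (I + 1) i (by omega) hi
        have e2 : x.x i * n (φ j) ≤ ε / 8 * n (φ j) :=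
          mul_le_mul_of_nonneg_right (e1.trans hI.le) hN.le
        linarith)
    have h6 : ∑ i ∈ Finset.Icc 1 I, |((Finset.univ.filter fun v => q (φ j) v = i).card : ℝ) -
        (Finset.univ.filter fun v => (R j).part v = i).card| ≤ (ε / 8 + ε / 8) * n (φ j) := by
      have e1 : ∀ i ∈ Finset.Icc 1 I, |((Finset.univ.filter fun v => q (φ j) v = i).card : ℝ) -
          (Finset.univ.filter fun v => (R j).part v = i).card| ≤
          (|y (φ j) i - x.x i| + |emp (R j).part i - x.x i|) * n (φ j) := by
        intro i _
        rw [hcq, hcp, ← sub_mul, abs_mul, abs_of_pos hN]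
        refine mul_le_mul_of_nonneg_right ?_ hN.le
        rw [abs_sub_comm (emp _ _)]
        exact abs_sub_le _ _ _
      refine (Finset.sum_le_sum e1).trans ?_
      rw [← Finset.sum_mul, Finset.sum_add_distrib]
      refine mul_le_mul_of_nonneg_right (add_le_add h1.le ?_) hN.le
      refine le_trans ?_ h4
      exact ((emp_isDist (R j).part).summable_abs_sub x.isDist).sum_le_tsum _
        fun _ _ => abs_nonneg _
    refine h5.trans ?_
    nlinarith
  obtain ⟨N₀, hN₀, hlip⟩ := abs_lam_sub_le (γ := γ) hM0 hM
  -- For any `w`, the graph `H (φ j)` is almost as good as every graph of its order, in particular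
  -- as a realisation of `w`; on the other side its value tends to that of `x`.
  have hopt : x ∈ OPT γ := by
    intro w
    refine le_of_forall_pos_le_add fun ε hε => ?_
    obtain ⟨N₁, h1⟩ := lam_tendsto γ x (ε / 4) (by positivity)
    obtain ⟨N₂, h2⟩ := lam_tendsto γ w (ε / 4) (by positivity)
    have hε' : 0 < ε / 4 / (8 * M * (k ^ 2 + 1)) := by positivity
    have h3 : ∀ᶠ j in atTop, 1 / ((φ j : ℝ) + 1) < ε / 4 :=
      (tendsto_one_div_add_atTop_nhds_zero_nat.comp hφ.tendsto_atTop).eventually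
        (gt_mem_nhds (show (0 : ℝ) < ε / 4 by positivity))
    obtain ⟨j, hj0, hj1, hj2, hj3, hj4⟩ := ((hnφ.eventually_ge_atTop N₀).and
      ((hnφ.eventually_ge_atTop N₁).and ((hnφ.eventually_ge_atTop N₂).and
      (h3.and (hedit _ hε'))))).exists
    obtain ⟨R'⟩ := nonempty_realisation w (n (φ j))
    have e1 := h1 _ hj1 (R j)
    have e2 := h2 _ hj2 R'
    have e3 := hle (φ j)
    have e4 := lam_le_lamMax γ R'.graph
    have e5 := hlip _ hj0 _ _ _ hj4
    have e6 : 8 * M * k ^ 2 * (ε / 4 / (8 * M * (k ^ 2 + 1))) ≤ ε / 4 := by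
      rw [mul_div_assoc', div_le_iff₀ (by positivity)]
      nlinarith
    rw [Realisation.graph_eq] at e1
    linarith [(abs_le.1 e1).2, (abs_le.1 e2).1, (abs_le.1 e5).2]
  obtain ⟨j, hj1, hj2⟩ := ((htv δ hδ).and (hedit δ hδ)).exists
  exact hcl (φ j) x hopt ⟨(R j).part, (R j).part_mem, hj1, hj2⟩

/-! ### From local stability to perfect stability -/

theorem CloseTo.trans_edit {n : ℕ} {G H : SimpleGraph (Fin n)} {x : PartiteLimit} {δ ε : ℝ}
    (h : CloseTo H x δ) (hε : 0 ≤ ε) (hGH : (editCount G H : ℝ) ≤ ε * n ^ 2) :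
    CloseTo G x (δ + ε) := by
  obtain ⟨p, h1, h2, h3⟩ := h
  refine ⟨p, h1, by linarith, ?_⟩
  have : (editCount G (partGraph p) : ℝ) ≤ editCount G H + editCount H (partGraph p) := by
    exact_mod_cast editCount_triangle _ _ _
  linarith

theorem CloseTo.mono {n : ℕ} {G : SimpleGraph (Fin n)} {x : PartiteLimit} {δ ε : ℝ}
    (h : CloseTo G x δ) (hε : δ ≤ ε) : CloseTo G x ε := by
  obtain ⟨p, h1, h2, h3⟩ := h
  exact ⟨p, h1, h2.trans hε, h3.trans (mul_le_mul_of_nonneg_right hε (by positivity))⟩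

theorem normEditDist_le {n : ℕ} (hn : 0 < n) {G H : SimpleGraph (Fin n)} {K : ℝ}
    (h : (editCount G H : ℝ) ≤ K * n ^ 2) : normEditDist G H ≤ 2 * K := by
  have hnR : (0 : ℝ) < n := by exact_mod_cast hn
  have h1 : editDist G H ≤ editCount G H := by
    refine (ciInf_le' _ (Equiv.refl _)).trans (le_of_eq ?_)
    rw [editCount_comm]
    congr 1
    exact SimpleGraph.map_id G
  have h2 : (editDist G H : ℝ) ≤ K * n ^ 2 := le_trans (by exact_mod_cast h1) h
  unfold normEditDist
  rw [div_mul_eq_mul_div, div_le_iff₀ (by positivity)]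
  linarith

theorem strictPairs_of_strict {m : ℕ} {γ : GraphClass (m + 2) → ℝ} {c : ℝ} {x : PartiteLimit}
    (h : ∀ i₁ ∈ x.suppStar, ∀ i₂ ∈ x.suppStar, c ≤ nablaPairLim γ i₁ i₂ x) :
    StrictPairs γ c x := fun i₁ h₁ i₂ h₂ => (h i₁ h₁ i₂ h₂).trans_eq (nablaPairLim_eq γ h₁ h₂)

theorem nablaPairLim_one (γ : GraphClass 1 → ℝ) {x : PartiteLimit} {i : ℕ} (hi : i ∈ x.suppStar) :
    nablaPairLim γ i i x = 0 := by
  refine limOrder_eq (eventually_nonempty_pairRealisation hi hi) ?_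
  refine tendsto_const_nhds.congr fun a => ?_
  have : ∀ G G' : SimpleGraph (Fin a.1), bigLam γ G = bigLam γ G' := fun G G' => by
    rw [bigLam_eq_sum, bigLam_eq_sum]
    refine Finset.sum_congr rfl fun X hX => classVal_congr γ fun u hu v hv => ?_
    obtain ⟨w, rfl⟩ := Finset.card_eq_one.1 (Finset.mem_powersetCard.1 hX).2
    rw [Finset.mem_singleton] at hu hv
    subst hu; subst hv
    simp
  have := this a.2.toRealisation.graph
    (symmDiff a.2.toRealisation.graph (SimpleGraph.edge a.2.v₁ a.2.v₂))
  simp [nablaPair, this]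

/-- Near `OPT` the conclusion is local stability. `hclose` shows that every large graph within `η`
of the maximum is near `OPT`; beyond that deficit a constant of order `1 / η` is enough. -/
theorem perfectlyStable_of_two_le {m : ℕ} {γ : GraphClass (m + 2) → ℝ} (hsym : Symmetrisable γ)
    (hstrict : Strict γ) : PerfectlyStable γ := by
  obtain ⟨c, hc, hstr⟩ := hstrict
  have hP : ∀ x ∈ OPT γ, StrictPairs γ c x := fun x hx => strictPairs_of_strict (hstr x hx).1
  have hV : ∀ x ∈ OPT γ, StrictVertex (m := m + 1) γ c x := fun x hx b α h0 h1 hx0 =>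
    ((hstr x hx).2 b α h0 h1 hx0).trans_eq (nablaVertexLim_eq (m := m + 1) γ x b h0 h1)
  obtain ⟨δ, hδ, C, hC, N₁, hN₁, hloc⟩ := local_stability hsym hc
  have hlocal : ∀ n, N₁ + m + 2 ≤ n → ∀ G : SimpleGraph (Fin n), (∃ x ∈ OPT γ, CloseTo G x δ) →
      ∃ H : SimpleGraph (Fin n), H.IsCompleteMultipartite ∧ lam γ G ≤ lam γ H ∧
        (editCount G H : ℝ) ≤ C * (lam γ H - lam γ G) * n ^ 2 := by
    rintro n hn G ⟨x, hx, p, hp, htv, hG⟩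
    obtain ⟨H, hH, h⟩ := hloc x (hP x hx) (hV x hx) n (by omega) p hp htv G hG
    have hnR : (0 : ℝ) < n := by exact_mod_cast (by omega : 0 < n)
    have hch : (0 : ℝ) < (n.choose (m + 2) : ℝ) := by
      exact_mod_cast Nat.choose_pos (by omega : m + 2 ≤ n)
    have hle : (n.choose (m + 2) : ℝ) ≤ (n : ℝ) ^ (m + 2) := by exact_mod_cast Nat.choose_le_pow n _
    have h0 : 0 ≤ bigLam γ H - bigLam γ G := by
      have : 0 ≤ C * (bigLam γ H - bigLam γ G) := le_trans (by positivity) h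
      exact nonneg_of_mul_nonneg_right this hC
    refine ⟨H, hH, (lam_le_iff γ (by omega) _ _).2 (sub_nonneg.1 h0), ?_⟩
    have e1 : bigLam γ H - bigLam γ G = (lam γ H - lam γ G) * (n.choose (m + 2) : ℝ) := by
      simp only [lam, Fintype.card_fin]
      field_simp
    have e2 : 0 ≤ lam γ H - lam γ G :=
      sub_nonneg.2 ((lam_le_iff γ (by omega) _ _).2 (sub_nonneg.1 h0))
    have e3 : (lam γ H - lam γ G) * (n.choose (m + 2) : ℝ) ≤
        (lam γ H - lam γ G) * (n : ℝ) ^ (m + 2) := mul_le_mul_of_nonneg_left hle e2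
    rw [e1] at h
    have hnm : (0 : ℝ) < (n : ℝ) ^ m := by positivity
    have e4 := h.trans (mul_le_mul_of_nonneg_left e3 hC.le)
    refine le_of_mul_le_mul_right ?_ hnm
    calc _ ≤ _ := e4
      _ = _ := by ring
  obtain ⟨η₂, hη₂, N₂, h₂⟩ := exists_opt_closeTo γ (half_pos hδ)
  obtain ⟨η₄, hη₄, N₄, h₄⟩ := exists_opt_closeTo γ (show 0 < δ / 4 by positivity)
  obtain ⟨N₅, hN₅, h₅⟩ := hsym (δ / 2) (half_pos hδ)
  set η := min η₂ (min η₄ (δ / (4 * C))) with hη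
  have hη0 : 0 < η := by positivity
  have hle2 : η ≤ η₂ := min_le_left _ _
  have hle4 : η ≤ η₄ := (min_le_right _ _).trans (min_le_left _ _)
  have hleC : C * η ≤ δ / 4 := by
    have : η ≤ δ / (4 * C) := (min_le_right _ _).trans (min_le_right _ _)
    rw [le_div_iff₀ (by positivity)] at this
    linarith
  have hclose : ∀ n, N₁ + m + 2 + N₂ + N₄ + N₅ ≤ n → ∀ G : SimpleGraph (Fin n),
      lamMax γ n - η ≤ lam γ G → ∃ x ∈ OPT γ, CloseTo G x δ := by
    intro n hn G hG
    by_contra hfar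
    obtain ⟨l, S, hS0, hSl, hstep⟩ := (h₅ n (by omega) G).1
    have hmono : ∀ j ≤ l, lam γ G ≤ lam γ (S j) := by
      intro j
      induction j with
      | zero => intro _; rw [hS0]
      | succ j ih => intro hj; exact (ih (by omega)).trans (hstep j (by omega)).1
    -- The last graph of the path is complete partite and almost optimal, hence close to `OPT`. The
    -- first graph within `δ / 2` of `OPT` is considered; the graph just before it is within `δ`, so
    -- local stability still applies.
    have hex : ∃ j, j ≤ l ∧ ∃ x ∈ OPT γ, CloseTo (S j) x (δ / 2) :=
      ⟨l, le_rfl, h₂ n (by omega) (S l) hSl (by linarith [hmono l le_rfl])⟩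
    obtain ⟨hjl, x, hx, hclj⟩ := Nat.find_spec hex
    set j := Nat.find hex with hj
    have hj0 : j ≠ 0 := by
      intro h0
      rw [h0, hS0] at hclj
      exact hfar ⟨x, hx, hclj.mono (by linarith)⟩
    obtain ⟨j', hj'⟩ := Nat.exists_eq_succ_of_ne_zero hj0
    have hnot : ¬ ∃ x ∈ OPT γ, CloseTo (S j') x (δ / 2) := fun h =>
      Nat.find_min hex (show j' < j by omega) ⟨by omega, h⟩
    have hst := (hstep j' (by omega)).2
    rw [show j' + 1 = j from hj'.symm] at hst
    have hst' : (editCount (S j') (S j) : ℝ) ≤ δ / 2 * n ^ 2 := by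
      have : (n.choose 2 : ℝ) ≤ (n : ℝ) ^ 2 := by exact_mod_cast Nat.choose_le_pow n 2
      nlinarith
    have hcl' : CloseTo (S j') x δ := (hclj.trans_edit (half_pos hδ).le hst').mono (by linarith)
    obtain ⟨H, hH, hlam, hed⟩ := hlocal n (by omega) (S j') ⟨x, hx, hcl'⟩
    have hmj := hmono j' (by omega)
    -- `H` is within `δ / 4` of `OPT`, and within `C * η ≤ δ / 4` of the previous graph since both
    -- are almost optimal. So the previous graph was already within `δ / 2`, contrary to the choice
    -- of `j`.
    obtain ⟨x', hx', hclH⟩ := h₄ n (by omega) H hH (by linarith)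
    refine hnot ⟨x', hx', (hclH.trans_edit (show 0 ≤ δ / 4 by positivity) ?_).mono (by linarith)⟩
    refine hed.trans (mul_le_mul_of_nonneg_right ?_ (by positivity))
    refine le_trans (mul_le_mul_of_nonneg_left ?_ hC.le) hleC
    linarith [lam_le_lamMax γ H]
  set N := N₁ + m + 2 + N₂ + N₄ + N₅ with hN
  refine ⟨max (N : ℝ) (max (2 * C) (2 / η)), by positivity, fun n hn G => ?_⟩
  have hnN : N ≤ n := by exact_mod_cast (le_max_left _ _).trans hn
  have hnR : (0 : ℝ) < n := by exact_mod_cast (by omega : 0 < n)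
  have hGmax := lam_le_lamMax γ G
  by_cases hG : lamMax γ n - η ≤ lam γ G
  · obtain ⟨H, hH, hlam, hed⟩ := hlocal n (by omega) G (hclose n hnN G hG)
    refine ⟨H, hH, (normEditDist_le (by omega) hed).trans ?_⟩
    have h1 := lam_le_lamMax γ H
    have h2 : 2 * C ≤ max (N : ℝ) (max (2 * C) (2 / η)) :=
      (le_max_left _ _).trans (le_max_right _ _)
    calc 2 * (C * (lam γ H - lam γ G)) = 2 * C * (lam γ H - lam γ G) := by ring
      _ ≤ 2 * C * (lamMax γ n - lam γ G) := mul_le_mul_of_nonneg_left (by linarith) (by positivity)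
      _ ≤ _ := mul_le_mul_of_nonneg_right h2 (by linarith)
  · push Not at hG
    -- The normalised distance to any graph is at most `2`, so the empty graph, with a single part,
    -- will do.
    refine ⟨⊥, SimpleGraph.bot_isCompleteMultipartite,
      (normEditDist_le (K := 1) (by omega) ?_).trans ?_⟩
    · have := editCount_le_of_touch (G := G) (H := ⊥) Finset.univ fun u v _ =>
        Or.inl (Finset.mem_univ u)
      rw [Finset.card_univ, Fintype.card_fin] at this
      have h1 : (editCount G ⊥ : ℝ) ≤ n * n := by exact_mod_cast this
      linarith
    · have h2 : 2 / η ≤ max (N : ℝ) (max (2 * C) (2 / η)) :=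
        (le_max_right _ _).trans (le_max_right _ _)
      calc (2 * 1 : ℝ) = 2 / η * η := by field_simp
        _ ≤ 2 / η * (lamMax γ n - lam γ G) := mul_le_mul_of_nonneg_left (by linarith) (by positivity)
        _ ≤ _ := mul_le_mul_of_nonneg_right h2 (by linarith)

/-- With `k = 1` the parameter ignores edges, so the pair derivative vanishes and cannot be at least
`c > 0`. The contradiction needs an element of `OPT`; `exists_opt_closeTo` supplies one. -/
theorem not_strict_one (γ : GraphClass 1 → ℝ) : ¬ Strict γ := by
  rintro ⟨c, hc, h⟩
  obtain ⟨η, hη, N, hN⟩ := exists_opt_closeTo γ one_pos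
  have hconst : ∀ G G' : SimpleGraph (Fin N), lam γ G = lam γ G' := fun G G' => by
    simp only [lam]
    rw [bigLam_eq_sum, bigLam_eq_sum]
    congr 1
    refine Finset.sum_congr rfl fun X hX => classVal_congr γ fun u hu v hv => ?_
    obtain ⟨w, rfl⟩ := Finset.card_eq_one.1 (Finset.mem_powersetCard.1 hX).2
    rw [Finset.mem_singleton] at hu hv
    subst hu; subst hv
    simp
  obtain ⟨x, hx, -⟩ := hN N le_rfl ⊥ SimpleGraph.bot_isCompleteMultipartite (by
    have : lamMax γ N ≤ lam γ (⊥ : SimpleGraph (Fin N)) := ciSup_le fun G => (hconst G ⊥).le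
    linarith)
  have h1 := (h x hx).1 _ x.star_mem _ x.star_mem
  rw [nablaPairLim_one γ x.star_mem] at h1
  linarith

end PartiteStability

end

theorem theorem3p5 (k : ℕ) (hk : 1 ≤ k) (γ : PartiteStability.GraphClass k → ℝ)
    (hsym : PartiteStability.Symmetrisable γ)
    (hopt : (PartiteStability.OPT γ).Finite)
    (hstrict : PartiteStability.Strict γ) :
    PartiteStability.PerfectlyStable γ := by
  match k, hk with
  | 1, _ => exact absurd hstrict (PartiteStability.not_strict_one γ)
  | m + 2, _ => exact PartiteStability.perfectlyStable_of_two_le hsym hstrict
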